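/- Let $n\ge 1$, $1<p<\infty$, $1<q<\infty$, $\frac1p+\frac1{p'}=1$, $\frac1q+\frac1{q'}=1$, $-\frac np<r<0$ and $\varrho=-n-r$. For $J\in\mathbb Z$, $M\in\mathbb Z^n$ let $Q_{J,M}=2^{-J}(M+[-1,1]^n)$. All functions are complex-valued, measurable on $\mathbb R^n$, and identified when equal almost everywhere. **Morrey spaces.** Let $L_p^r$ be the space of functions $f\in L_p^{\mathrm{loc}}$ with $\|f\|_{L_p^r}=\sup_{J,M}2^{J(n/p+r)}\|f\|_{L_p(Q_{J,M})}<\infty$. Let $L_p^r(\ell_q)$ be the space of sequences $f=(f_j)_{j\ge 0}$ in $L_p^r$ with norm $\|f\|_{L_p^r(\ell_q)}=\bigl\|(\sum_j|f_j|^q)^{1/q}\bigr\|_{L_p^r}<\infty$. Let $\mathring L_p^r(\ell_q)$ be the space of all $f\in L_p^r(\ell_q)$ for which there are $f_j^k\in C_c^\infty(\mathbb R^n)$ with $f_j^k=0$ for $j>k$ and $\|(f_j-f_j^k)_j\|_{L_p^r(\ell_q)}\to0$ as $k\to\infty$, with the norm of $L_p^r(\ell_q)$. For $1<u<\infty$ let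 $L_u(\ell_q)$ be the space of sequences $f$ with $\|f\|_{L_u(\ell_q)}=\bigl\|(\sum_j|f_j|^q)^{1/q}\bigr\|_{L_u(\mathbb R^n)}<\infty$. **Predual Morrey spaces.** Let $H^\varrho L_{p'}$ be the space of tempered distributions $h=\sum_{J,M}\lambda_{J,M}a_{J,M}$ (convergence in $S'(\mathbb R^n)$), where $\sum_{J,M}|\lambda_{J,M}|<\infty$, $\operatorname{supp}a_{J,M}\subset Q_{J,M}$ and $\|a_{J,M}\|_{L_{p'}}\le 2^{-J(n/p'+\varrho)}$; its norm is the infimum of $\sum_{J,M}|\lambda_{J,M}|$ over all such representations. Let $H^\varrho L_{p'}(\ell_{q'})$ be the space of sequences $g=(g_j)_{j\ge0}$ of functions in $H^\varrho L_{p'}$ such that $|g|_{q'}=(\sum_j|g_j|^{q'})^{1/q'}$ is finite almost everywhere and belongs to $H^\varrho L_{p'}$, with norm $\|g\|=\bigl\||g|_{q'}\bigr\|_{H^\varrho L_{p'}}$. **Theorem.** 1. $L_{-n/r}(\ell_q)\subset\mathring L_p^r(\ell_q)$, with $\|f\|_{L_p^r(\ell_q)}\le C\|f\|_{L_{-n/r}(\ell_q)}$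 for a constant $C$ that does not depend on $f$. 2. For all $g\in H^\varrho L_{p'}(\ell_{q'})$ and $f\in\mathring L_p^r(\ell_q)$ the series $\sum_j g_jf_j$ converges absolutely almost everywhere to an integrable function, and $$g\longmapsto\Bigl(f\mapsto\int_{\mathbb R^n}\sum_{j\ge0}g_j(x)f_j(x)\,dx\Bigr)$$ is a linear isometric isomorphism of $H^\varrho L_{p'}(\ell_{q'})$ onto the dual space of $\mathring L_p^r(\ell_q)$. 3. For every bounded linear functional $G$ on $\mathring L_p^r(\ell_q)$ there is exactly one $g\in H^\varrho L_{p'}(\ell_{q'})$ with $G(f)=\int_{\mathbb R^n}\sum_j g_jf_j\,dx$ for all $f\in L_{-n/r}(\ell_q)$. For this $g$ the functional $G$ is the image of $g$ under the isomorphism in 2, and $\|G\|=\|g\|$. 4. For every $g\in H^\varrho L_{p'}(\ell_{q'})$, $$\|g\|_{H^\varrho L_{p'}(\ell_{q'})}=\sup\Bigl\{\Bigl|\int_{\mathbb R^n}\sum_{j\ge0}g_jf_j\,dx\Bigr|:\ f\in\mathring L_p^r(\ell_q),\ \|f\|_{L_p^r(\ell_q)}\le1\Bigr\}.$$ -/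

import Mathlib

open MeasureTheory Filter Topology
open scoped ENNReal NNReal ContDiff SchwartzMap

namespace MorreyDuality

noncomputable section

/-- The Euclidean space of dimension `n`. -/
abbrev Sp (n : ℕ) := EuclideanSpace ℝ (Fin n)

/-- Index set of the dyadic cubes: pairs `(J, M)` of an integer and a lattice point. -/
abbrev Idx (n : ℕ) := ℤ × (Fin n → ℤ)

/-- Sequences of (classes of almost everywhere equal, measurable, complex) functions. -/
abbrev FunSeq (n : ℕ) := ℕ → (Sp n →ₘ[volume] ℂ)

/-- The closed dyadic cube `2 ^ (-J) * (M + [-1, 1] ^ n)`. -/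
def dyadicCube {n : ℕ} (i : Idx n) : Set (Sp n) :=
  {x | ∀ k, x k ∈ Set.Icc ((2 : ℝ) ^ (-i.1) * ((i.2 k : ℝ) - 1))
    ((2 : ℝ) ^ (-i.1) * ((i.2 k : ℝ) + 1))}

/-- The pointwise `ℓ_q` norm of a sequence of functions, with values in `[0, ∞]`. -/
def lqNorm {n : ℕ} (q : ℝ) (f : FunSeq n) (x : Sp n) : ℝ≥0∞ :=
  (∑' j, ‖f j x‖ₑ ^ q) ^ (1 / q)

/-! ### Pointwise `ℓ_q` norms -/

variable {n : ℕ} {p q r ρ : ℝ}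

theorem measurable_lqNorm (q : ℝ) (f : FunSeq n) : Measurable (lqNorm q f) := by
  have : ∀ j, Measurable fun x => ‖f j x‖ₑ ^ q := fun j =>
    ((f j).stronglyMeasurable.measurable.enorm).pow_const q
  exact (Measurable.tsum this).pow_const _

theorem enorm_le_lqNorm (hq : 1 < q) (f : FunSeq n) (j : ℕ) (x : Sp n) :
    ‖f j x‖ₑ ≤ lqNorm q f x := by
  have h0 : 0 < q := by linarith
  have h1 : (‖f j x‖ₑ ^ q) ^ (1 / q) = ‖f j x‖ₑ := by
    rw [← ENNReal.rpow_mul, mul_one_div_cancel h0.ne', ENNReal.rpow_one]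
  rw [← h1]
  exact ENNReal.rpow_le_rpow (ENNReal.le_tsum j) (by positivity)

theorem lqNorm_add_le (hq : 1 < q) (f g : FunSeq n) :
    ∀ᵐ x, lqNorm q (f + g) x ≤ lqNorm q f x + lqNorm q g x := by
  have h : ∀ᵐ x, ∀ j, (f + g) j x = f j x + g j x :=
    ae_all_iff.2 fun j => AEEqFun.coeFn_add (f j) (g j)
  filter_upwards [h] with x hx
  have h0 : 0 < q := by linarith
  have := ENNReal.lintegral_Lp_add_le (μ := Measure.count) (p := q)
    (f := fun j : ℕ => ‖f j x‖ₑ) (g := fun j : ℕ => ‖g j x‖ₑ)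
    (measurable_of_countable _).aemeasurable (measurable_of_countable _).aemeasurable hq.le
  simp only [lintegral_count, Pi.add_apply] at this
  refine le_trans ?_ this
  unfold lqNorm
  refine ENNReal.rpow_le_rpow (ENNReal.tsum_le_tsum fun j => ?_) (by positivity)
  rw [hx j]
  exact ENNReal.rpow_le_rpow (enorm_add_le _ _) h0.le

theorem lqNorm_smul (hq : 1 < q) (c : ℂ) (f : FunSeq n) :
    ∀ᵐ x, lqNorm q (c • f) x = ‖c‖ₑ * lqNorm q f x := by
  have h : ∀ᵐ x, ∀ j, (c • f) j x = c * f j x :=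
    ae_all_iff.2 fun j => AEEqFun.coeFn_smul c (f j)
  filter_upwards [h] with x hx
  have h0 : 0 < q := by linarith
  simp only [lqNorm, hx, enorm_mul, ENNReal.mul_rpow_of_nonneg _ _ h0.le, ENNReal.tsum_mul_left]
  rw [ENNReal.mul_rpow_of_nonneg _ _ (by positivity), ← ENNReal.rpow_mul,
    mul_one_div_cancel h0.ne', ENNReal.rpow_one]

theorem lqNorm_zero (hq : 1 < q) : ∀ᵐ x, lqNorm q (0 : FunSeq n) x = 0 := by
  have := lqNorm_smul hq 0 (0 : FunSeq n)
  rw [show (0 : ℂ) • (0 : FunSeq n) = 0 from smul_zero (A := FunSeq n) (0 : ℂ)] at this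
  simpa using this

theorem eq_zero_of_lqNorm (hq : 1 < q) (f : FunSeq n) (h : ∀ᵐ x, lqNorm q f x = 0) : f = 0 := by
  funext j
  apply AEEqFun.ext
  filter_upwards [h, AEEqFun.coeFn_zero (α := Sp n) (β := ℂ) (μ := volume)] with x hx h0
  have := enorm_le_lqNorm hq f j x
  rw [hx] at this
  rw [Pi.zero_apply, h0]
  simpa using this

/-! ### Morrey spaces -/

/-- The Morrey norm, with values in `[0, ∞]`: the supremum over all dyadic cubes `Q_{J,M}` of
`2 ^ (J (n / p + r))` times the `L_p` norm on the cube. -/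
def morreyENorm {ε : Type*} [TopologicalSpace ε] [ContinuousENorm ε] (p r : ℝ)
    (F : Sp n → ε) : ℝ≥0∞ :=
  ⨆ i : Idx n, ENNReal.ofReal ((2 : ℝ) ^ ((i.1 : ℝ) * ((n : ℝ) / p + r))) *
    eLpNorm F (ENNReal.ofReal p) (volume.restrict (dyadicCube i))

theorem morreyENorm_mono {ε ε' : Type*} [TopologicalSpace ε] [ContinuousENorm ε]
    [TopologicalSpace ε'] [ContinuousENorm ε'] {F : Sp n → ε} {G : Sp n → ε'}
    (h : ∀ᵐ x, ‖F x‖ₑ ≤ ‖G x‖ₑ) : morreyENorm p r F ≤ morreyENorm p r G :=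
  iSup_mono fun _ => mul_le_mul_right (eLpNorm_mono_enorm_ae (ae_restrict_of_ae h)) _

theorem morreyENorm_add_le (hp : 1 < p) {F G : Sp n → ℝ≥0∞} (hF : Measurable F)
    (hG : Measurable G) : morreyENorm p r (F + G) ≤ morreyENorm p r F + morreyENorm p r G := by
  refine iSup_le fun i => ?_
  have h := eLpNorm_add_le (p := ENNReal.ofReal p)
    (hF.aestronglyMeasurable (μ := volume.restrict (dyadicCube i)))
    (hG.aestronglyMeasurable (μ := volume.restrict (dyadicCube i)))
    (by simpa using ENNReal.ofReal_le_ofReal hp.le)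
  refine (mul_le_mul_right h _).trans ?_
  rw [mul_add]
  exact add_le_add (le_iSup (fun i : Idx n => ENNReal.ofReal _ *
    eLpNorm F (ENNReal.ofReal p) (volume.restrict (dyadicCube i))) i)
    (le_iSup (fun i : Idx n => ENNReal.ofReal _ *
    eLpNorm G (ENNReal.ofReal p) (volume.restrict (dyadicCube i))) i)

theorem morreyENorm_const_mul (c : ℝ≥0) (F : Sp n → ℝ≥0∞) :
    morreyENorm p r (fun x => (c : ℝ≥0∞) * F x) ≤ c * morreyENorm p r F := by
  refine iSup_le fun i => ?_
  have h : eLpNorm (fun x => (c : ℝ≥0∞) * F x) (ENNReal.ofReal p)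
      (volume.restrict (dyadicCube i)) ≤
      c * eLpNorm F (ENNReal.ofReal p) (volume.restrict (dyadicCube i)) :=
    eLpNorm_le_nnreal_smul_eLpNorm_of_ae_le_mul' (Eventually.of_forall fun x => by simp) _
  calc _ ≤ _ := mul_le_mul_right h _
    _ = c * (_ * _) := mul_left_comm _ _ _
    _ ≤ _ := mul_le_mul_right (le_iSup (fun i : Idx n => ENNReal.ofReal _ *
    eLpNorm F (ENNReal.ofReal p) (volume.restrict (dyadicCube i))) i) _

theorem exists_mem_dyadicCube (x : Sp n) : ∃ i : Idx n, x ∈ dyadicCube i := by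
  refine ⟨(0, fun k => ⌊x k⌋), fun k => ?_⟩
  have h1 := Int.floor_le (x k)
  have h2 := Int.lt_floor_add_one (x k)
  simp only [neg_zero, zpow_zero, one_mul]
  constructor <;> linarith

theorem isClosed_dyadicCube (i : Idx n) : IsClosed (dyadicCube i) := by
  have : dyadicCube i = ⋂ k, {x : Sp n | x k ∈ Set.Icc ((2 : ℝ) ^ (-i.1) * ((i.2 k : ℝ) - 1))
    ((2 : ℝ) ^ (-i.1) * ((i.2 k : ℝ) + 1))} := by
    ext x; simp [dyadicCube]
  rw [this]
  exact isClosed_iInter fun k => isClosed_Icc.preimage (by fun_prop)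

theorem ae_zero_of_morreyENorm (hp : 1 < p) {F : Sp n → ℝ≥0∞} (hF : Measurable F)
    (h : morreyENorm p r F = 0) : ∀ᵐ x, F x = 0 := by
  have h1 : ∀ i : Idx n, ∀ᵐ x, x ∈ dyadicCube i → F x = 0 := by
    intro i
    have h2 := ENNReal.iSup_eq_zero.1 h i
    have h3 : ENNReal.ofReal ((2 : ℝ) ^ ((i.1 : ℝ) * ((n : ℝ) / p + r))) ≠ 0 := by
      simp only [ne_eq, ENNReal.ofReal_eq_zero, not_le]; positivity
    have h4 := (mul_eq_zero.1 h2).resolve_left h3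
    rw [eLpNorm_eq_zero_iff hF.aestronglyMeasurable
      (by simp only [ne_eq, ENNReal.ofReal_eq_zero, not_le]; linarith)] at h4
    exact (ae_restrict_iff' (isClosed_dyadicCube i).measurableSet).1 h4
  filter_upwards [ae_all_iff.2 h1] with x hx
  obtain ⟨i, hi⟩ := exists_mem_dyadicCube x
  exact hx i hi

/-- The norm of a sequence of functions in `L_p^r(ℓ_q)`, with values in `[0, ∞]`. -/
def morreySeqENorm (p q r : ℝ) (f : FunSeq n) : ℝ≥0∞ := morreyENorm p r (lqNorm q f)

theorem morreySeqENorm_add_le (hp : 1 < p) (hq : 1 < q) (f g : FunSeq n) :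
    morreySeqENorm p q r (f + g) ≤ morreySeqENorm p q r f + morreySeqENorm p q r g :=
  (morreyENorm_mono (lqNorm_add_le hq f g)).trans
    (morreyENorm_add_le hp (measurable_lqNorm q f) (measurable_lqNorm q g))

theorem morreySeqENorm_smul_le (hq : 1 < q) (c : ℂ) (f : FunSeq n) :
    morreySeqENorm p q r (c • f) ≤ ‖c‖ₑ * morreySeqENorm p q r f := by
  refine (morreyENorm_mono ?_).trans (morreyENorm_const_mul ‖c‖₊ (lqNorm q f))
  filter_upwards [lqNorm_smul hq c f] with x hx
  rw [hx]; exact le_of_eq rfl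

theorem morreySeqENorm_smul (hq : 1 < q) (c : ℂ) (f : FunSeq n) :
    morreySeqENorm p q r (c • f) = ‖c‖ₑ * morreySeqENorm p q r f := by
  refine le_antisymm (morreySeqENorm_smul_le hq c f) ?_
  rcases eq_or_ne c 0 with rfl | hc
  · simp
  have h := morreySeqENorm_smul_le (p := p) (r := r) hq c⁻¹ (c • f)
  rw [inv_smul_smul₀ hc, enorm_inv hc] at h
  calc _ ≤ ‖c‖ₑ * (‖c‖ₑ⁻¹ * morreySeqENorm p q r (c • f)) := mul_le_mul_right h _
    _ = _ := by rw [← mul_assoc, ENNReal.mul_inv_cancel (by simpa using hc) (by simp), one_mul]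

theorem morreySeqENorm_zero (hq : 1 < q) : morreySeqENorm p q r (0 : FunSeq n) = 0 := by
  have := morreySeqENorm_smul (p := p) (r := r) hq 0 (0 : FunSeq n)
  rw [show (0 : ℂ) • (0 : FunSeq n) = 0 from smul_zero (A := FunSeq n) (0 : ℂ)] at this
  simpa using this

/-- The vector-valued Morrey space `L_p^r(ℓ_q)`: all sequences of functions in `L_p^r` whose
pointwise `ℓ_q` norm has finite Morrey norm. -/
def MorreySeq (n : ℕ) (p q r : ℝ) (hp : 1 < p) (hq : 1 < q) : Submodule ℂ (FunSeq n) where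
  carrier := {f | (∀ j, morreyENorm p r (f j) < ⊤) ∧ morreySeqENorm p q r f < ⊤}
  zero_mem' := by
    have h0 := morreySeqENorm_zero (n := n) (p := p) (r := r) hq
    refine ⟨fun j => (morreyENorm_mono (G := lqNorm q (0 : FunSeq n))
      (Eventually.of_forall fun x => enorm_le_lqNorm hq _ j x)).trans_lt ?_, ?_⟩ <;>
    · change morreySeqENorm p q r (0 : FunSeq n) < ⊤
      simp [h0]
  add_mem' := by
    intro f g hf hg
    have h : morreySeqENorm p q r (f + g) < ⊤ :=
      (morreySeqENorm_add_le hp hq f g).trans_lt (ENNReal.add_lt_top.2 ⟨hf.2, hg.2⟩)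
    exact ⟨fun j => (morreyENorm_mono (G := lqNorm q (f + g))
      (Eventually.of_forall fun x => enorm_le_lqNorm hq _ j x)).trans_lt h, h⟩
  smul_mem' := by
    intro c f hf
    have h : morreySeqENorm p q r (c • f) < ⊤ :=
      (morreySeqENorm_smul_le hq c f).trans_lt (ENNReal.mul_lt_top (by simp) hf.2)
    exact ⟨fun j => (morreyENorm_mono (G := lqNorm q (c • f))
      (Eventually.of_forall fun x => enorm_le_lqNorm hq _ j x)).trans_lt h, h⟩

variable {hp : 1 < p} {hq : 1 < q}

instance : Norm (MorreySeq n p q r hp hq) := ⟨fun f => (morreySeqENorm p q r f.1).toReal⟩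

theorem morreySeq_core : NormedSpace.Core ℂ (MorreySeq n p q r hp hq) where
  norm_nonneg _ := ENNReal.toReal_nonneg
  norm_smul c f := by
    change (morreySeqENorm p q r (c • f.1)).toReal = _
    rw [morreySeqENorm_smul hq, ENNReal.toReal_mul]
    simp [Norm.norm]
  norm_triangle f g := by
    change (morreySeqENorm p q r (f.1 + g.1)).toReal ≤
      (morreySeqENorm p q r f.1).toReal + (morreySeqENorm p q r g.1).toReal
    rw [← ENNReal.toReal_add f.2.2.ne g.2.2.ne]
    exact ENNReal.toReal_mono (ENNReal.add_lt_top.2 ⟨f.2.2, g.2.2⟩).ne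
      (morreySeqENorm_add_le hp hq f.1 g.1)
  norm_eq_zero_iff f := by
    change (morreySeqENorm p q r f.1).toReal = 0 ↔ _
    constructor
    · intro h
      rcases (ENNReal.toReal_eq_zero_iff _).1 h with h | h
      · exact Subtype.ext (eq_zero_of_lqNorm hq f.1
          (ae_zero_of_morreyENorm hp (measurable_lqNorm q f.1) h))
      · exact absurd h f.2.2.ne
    · rintro rfl
      simp [morreySeqENorm_zero hq]

instance : NormedAddCommGroup (MorreySeq n p q r hp hq) := NormedAddCommGroup.ofCore morreySeq_core

instance : NormedSpace ℂ (MorreySeq n p q r hp hq) := NormedSpace.ofCore morreySeq_core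

/-- `f` is (the class of) a test function: smooth with compact support. -/
def IsTestFun (f : Sp n →ₘ[volume] ℂ) : Prop :=
  ∃ φ : Sp n → ℂ, ContDiff ℝ ∞ φ ∧ HasCompactSupport φ ∧ f =ᵐ[volume] φ

theorem IsTestFun.zero : IsTestFun (0 : Sp n →ₘ[volume] ℂ) :=
  ⟨fun _ => 0, contDiff_const, HasCompactSupport.zero, AEEqFun.coeFn_zero⟩

theorem IsTestFun.add {f g : Sp n →ₘ[volume] ℂ} (hf : IsTestFun f) (hg : IsTestFun g) :
    IsTestFun (f + g) := by
  obtain ⟨φ, h1, h2, h3⟩ := hf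
  obtain ⟨ψ, h1', h2', h3'⟩ := hg
  exact ⟨φ + ψ, h1.add h1', h2.add h2', (AEEqFun.coeFn_add f g).trans (h3.add h3')⟩

theorem IsTestFun.smul (c : ℂ) {f : Sp n →ₘ[volume] ℂ} (hf : IsTestFun f) :
    IsTestFun (c • f) := by
  obtain ⟨φ, h1, h2, h3⟩ := hf
  exact ⟨c • φ, h1.const_smul c, HasCompactSupport.smul_left (f := fun _ => c) h2,
    (AEEqFun.coeFn_smul c f).trans (h3.const_smul c)⟩

/-- The closure in `L_p^r(ℓ_q)` of the finitely supported sequences of test functions. -/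
def MorreySeqCirc (n : ℕ) (p q r : ℝ) (hp : 1 < p) (hq : 1 < q) :
    Submodule ℂ (MorreySeq n p q r hp hq) where
  carrier := {f | ∃ φ : ℕ → FunSeq n, (∀ k j, IsTestFun (φ k j)) ∧ (∀ k j, k < j → φ k j = 0) ∧
    Tendsto (fun k => morreySeqENorm p q r (f.1 - φ k)) atTop (𝓝 0)}
  zero_mem' := ⟨fun _ _ => 0, fun _ _ => IsTestFun.zero, fun _ _ _ => rfl, by
    have : ∀ k : ℕ, ((0 : MorreySeq n p q r hp hq).1 - (fun _ => 0 : FunSeq n)) = 0 := by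
      intro k; funext j; simp
    simp_rw [this 0, morreySeqENorm_zero hq]; exact tendsto_const_nhds⟩
  add_mem' := by
    rintro f g ⟨φ, h1, h2, h3⟩ ⟨ψ, h1', h2', h3'⟩
    refine ⟨φ + ψ, fun k j => (h1 k j).add (h1' k j), fun k j hkj => ?_, ?_⟩
    · simp [h2 k j hkj, h2' k j hkj]
    · have h4 := h3.add h3'
      rw [add_zero] at h4
      refine tendsto_of_tendsto_of_tendsto_of_le_of_le tendsto_const_nhds h4
        (fun _ => zero_le) fun k => ?_
      have : (f + g).1 - (φ + ψ) k = (f.1 - φ k) + (g.1 - ψ k) := by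
        simp only [Submodule.coe_add, Pi.add_apply]; abel
      simp only [this]
      exact morreySeqENorm_add_le hp hq _ _
  smul_mem' := by
    rintro c f ⟨φ, h1, h2, h3⟩
    refine ⟨c • φ, fun k j => (h1 k j).smul c, fun k j hkj => ?_, ?_⟩
    · change c • φ k j = 0
      rw [h2 k j hkj]; exact smul_zero (A := Sp n →ₘ[volume] ℂ) c
    · have : ∀ k, morreySeqENorm p q r ((c • f).1 - (c • φ) k) =
          ‖c‖ₑ * morreySeqENorm p q r (f.1 - φ k) := fun k => by
        rw [← morreySeqENorm_smul hq, smul_sub]; rfl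
      simp_rw [this]
      simpa using ENNReal.Tendsto.const_mul h3 (Or.inr (by simp))


/-! ### Predual Morrey spaces -/

/-- Admissible coefficients `λ_{J,M}` and atoms `a_{J,M}`: the function `a_{J,M}` is in `L_p`, is
supported in `Q_{J,M}` and has `L_p` norm at most `2 ^ (-J (n / p + ρ))`, and the coefficients are
absolutely summable. -/
structure IsAtomic (p ρ : ℝ) (lam : Idx n → ℂ) (a : Idx n → Sp n → ℂ) : Prop where
  memLp : ∀ i, MemLp (a i) (ENNReal.ofReal p) volume
  supp : ∀ i, ∀ᵐ x, x ∉ dyadicCube i → a i x = 0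
  norm_le : ∀ i, eLpNorm (a i) (ENNReal.ofReal p) volume ≤
    ENNReal.ofReal ((2 : ℝ) ^ (-((i.1 : ℝ) * ((n : ℝ) / p + ρ))))
  summable : Summable fun i => ‖lam i‖

/-- `T = ∑ λ_{J,M} a_{J,M}` with convergence in the space of tempered distributions, for admissible
coefficients and atoms. -/
structure IsAtomicDecomp (p ρ : ℝ) (T : 𝓢'(Sp n, ℂ)) (lam : Idx n → ℂ) (a : Idx n → Sp n → ℂ) :
    Prop extends IsAtomic p ρ lam a where
  hasSum : ∀ φ : 𝓢(Sp n, ℂ), HasSum (fun i => lam i * ∫ x, φ x * a i x) (T φ)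

/-- The predual Morrey space `H^ρ L_p`, a set of tempered distributions. -/
def predualMorrey (n : ℕ) (p ρ : ℝ) : Set 𝓢'(Sp n, ℂ) :=
  {T | ∃ lam a, IsAtomicDecomp p ρ T lam a}

/-- The norm of `H^ρ L_p`: the infimum of `∑ |λ_{J,M}|` over all atomic decompositions. -/
def predualENorm (p ρ : ℝ) (T : 𝓢'(Sp n, ℂ)) : ℝ≥0∞ :=
  ⨅ (lam) (a) (_ : IsAtomicDecomp p ρ T lam a), ∑' i, ‖lam i‖ₑ

/-- The tempered distribution `T` is regular, and it is generated by the locally integrable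
function `h`. -/
def Generates (h : Sp n → ℂ) (T : 𝓢'(Sp n, ℂ)) : Prop :=
  LocallyIntegrable h volume ∧
    ∀ φ : 𝓢(Sp n, ℂ), Integrable (fun x => φ x * h x) volume ∧ T φ = ∫ x, φ x * h x

/-- The function `h` belongs to `H^ρ L_p`, as a regular distribution. -/
def MemPredual (p ρ : ℝ) (h : Sp n → ℂ) : Prop := ∃ T ∈ predualMorrey n p ρ, Generates h T

/-- The norm in `H^ρ L_p` of a function, with values in `[0, ∞]`. -/
def predualFunENorm (p ρ : ℝ) (h : Sp n → ℂ) : ℝ≥0∞ :=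
  ⨅ (T) (_ : Generates h T), predualENorm p ρ T

theorem dyadicCube_eq (i : Idx n) : dyadicCube i = WithLp.ofLp ⁻¹'
    (Set.Icc (fun k => (2 : ℝ) ^ (-i.1) * ((i.2 k : ℝ) - 1))
      (fun k => (2 : ℝ) ^ (-i.1) * ((i.2 k : ℝ) + 1))) := by
  ext x
  simp only [dyadicCube, Set.mem_ofPred_eq, Set.mem_preimage, Set.mem_Icc, Pi.le_def]
  exact forall_and

theorem volume_dyadicCube (i : Idx n) :
    volume (dyadicCube i) = ENNReal.ofReal ((2 : ℝ) ^ ((n : ℝ) * (1 - (i.1 : ℝ)))) := by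
  rw [dyadicCube_eq, (PiLp.volume_preserving_ofLp (Fin n)).measure_preimage
    measurableSet_Icc.nullMeasurableSet, Real.volume_Icc_pi]
  have : ∀ k : Fin n, (2 : ℝ) ^ (-i.1) * ((i.2 k : ℝ) + 1) - (2 : ℝ) ^ (-i.1) * ((i.2 k : ℝ) - 1)
      = (2 : ℝ) ^ (1 - (i.1 : ℝ)) := by
    intro k
    rw [Real.rpow_sub two_pos, Real.rpow_intCast, zpow_neg, Real.rpow_one]; ring
  simp_rw [this]
  rw [Finset.prod_const, Finset.card_univ, Fintype.card_fin, ← ENNReal.ofReal_pow (by positivity),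
    ← Real.rpow_natCast, ← Real.rpow_mul two_pos.le, mul_comm]

/-- The exponent `u = -n / ρ`, for which `H^ρ L_p` embeds into `L_u`. -/
def uExp (n : ℕ) (ρ : ℝ) : ℝ≥0∞ := ENNReal.ofReal (-(n : ℝ) / ρ)

/-- The index range of the predual Morrey spaces: `1 < p < ∞` and `-n < ρ < -n / p`. -/
structure PredualIndex (n : ℕ) (p ρ : ℝ) : Prop where
  one_lt : 1 < p
  lower : -(n : ℝ) < ρ
  upper : ρ < -(n : ℝ) / p

theorem PredualIndex.rho_neg (h : PredualIndex n p ρ) : ρ < 0 := by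
  have h1 := h.one_lt
  have : (0 : ℝ) ≤ n / p := by positivity
  have h2 := h.upper
  rw [neg_div] at h2
  linarith

theorem PredualIndex.n_pos (h : PredualIndex n p ρ) : (0 : ℝ) < n := by
  have := h.rho_neg; have := h.lower; linarith

theorem PredualIndex.one_le_u (h : PredualIndex n p ρ) : 1 ≤ uExp n ρ := by
  have h1 := h.rho_neg
  have h2 := h.lower
  rw [uExp, ← ENNReal.ofReal_one]
  apply ENNReal.ofReal_le_ofReal
  rw [le_div_iff_of_neg h1]; linarith

theorem PredualIndex.u_le (h : PredualIndex n p ρ) : uExp n ρ ≤ ENNReal.ofReal p := by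
  have h1 := h.rho_neg
  have h2 := h.upper
  have h3 := h.one_lt
  apply ENNReal.ofReal_le_ofReal
  rw [div_le_iff_of_neg h1]
  rw [lt_div_iff₀ (by linarith)] at h2
  linarith

/-- A uniform bound for the `L_u` norms of atoms. -/
def uBound (n : ℕ) (p ρ : ℝ) : ℝ≥0∞ := ENNReal.ofReal ((2 : ℝ) ^ (-((n : ℝ) / p + ρ)))

theorem atom_bound (h : PredualIndex n p ρ) {i : Idx n} {a : Sp n → ℂ}
    (ha : MemLp a (ENNReal.ofReal p) volume) (hs : ∀ᵐ x, x ∉ dyadicCube i → a x = 0)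
    (hn : eLpNorm a (ENNReal.ofReal p) volume ≤
      ENNReal.ofReal ((2 : ℝ) ^ (-((i.1 : ℝ) * ((n : ℝ) / p + ρ))))) :
    eLpNorm a (uExp n ρ) volume ≤ uBound n p ρ := by
  have hm := (isClosed_dyadicCube i).measurableSet
  have h1 : a =ᵐ[volume] (dyadicCube i).indicator a := by
    filter_upwards [hs] with x hx
    by_cases hxi : x ∈ dyadicCube i
    · rw [Set.indicator_of_mem hxi]
    · rw [Set.indicator_of_notMem hxi, hx hxi]
  rw [eLpNorm_congr_ae h1, eLpNorm_indicator_eq_eLpNorm_restrict hm]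
  have hn0 := h.n_pos
  have hr0 := h.rho_neg
  have hp0 : 0 < p := by linarith [h.one_lt]
  have hu0 : 0 < -(n : ℝ) / ρ := div_pos_of_neg_of_neg (by linarith) hr0
  refine (eLpNorm_le_eLpNorm_mul_rpow_measure_univ h.u_le ha.1.restrict).trans ?_
  rw [Measure.restrict_apply_univ, volume_dyadicCube, uExp, ENNReal.toReal_ofReal hu0.le,
    ENNReal.toReal_ofReal hp0.le]
  have h2 : eLpNorm a (ENNReal.ofReal p) (volume.restrict (dyadicCube i)) ≤ _ :=
    (eLpNorm_mono_measure a Measure.restrict_le_self).trans hn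
  refine (mul_le_mul_left h2 _).trans (le_of_eq ?_)
  rw [ENNReal.ofReal_rpow_of_pos (by positivity), ← ENNReal.ofReal_mul (by positivity),
    ← Real.rpow_mul two_pos.le, ← Real.rpow_add two_pos, uBound]
  congr 2
  field_simp
  ring

theorem IsAtomic.exists_decomp (h : PredualIndex n p ρ) {lam : Idx n → ℂ} {a : Idx n → Sp n → ℂ}
    (H : IsAtomic p ρ lam a) :
    (∀ᵐ x, Summable fun i => lam i * a i x) ∧
    AEStronglyMeasurable (fun x => ∑' i, lam i * a i x) volume ∧
    eLpNorm (fun x => ∑' i, lam i * a i x) (uExp n ρ) volume ≤ uBound n p ρ * ∑' i, ‖lam i‖ₑ ∧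
    ∃ T : 𝓢'(Sp n, ℂ), IsAtomicDecomp p ρ T lam a ∧ Generates (fun x => ∑' i, lam i * a i x) T := by
  have : Fact (1 ≤ uExp n ρ) := ⟨h.one_le_u⟩
  have hb : ∀ i, eLpNorm (a i) (uExp n ρ) volume ≤ uBound n p ρ := fun i =>
    atom_bound h (H.memLp i) (H.supp i) (H.norm_le i)
  have hU : ∀ i, MemLp (a i) (uExp n ρ) volume := fun i =>
    ⟨(H.memLp i).1, (hb i).trans_lt ENNReal.ofReal_lt_top⟩
  have hl : ∑' i, ‖lam i‖ₑ ≠ ⊤ := tsum_enorm_ne_top_iff_summable_norm.2 H.summable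
  set F : Idx n → Lp ℂ (uExp n ρ) (volume : Measure (Sp n)) := fun i => lam i • (hU i).toLp (a i)
    with hF
  have hFn : ∀ i, ‖F i‖ₑ ≤ ‖lam i‖ₑ * uBound n p ρ := fun i => by
    rw [hF]; simp only [enorm_smul, Lp.enorm_toLp]; gcongr; exact hb i
  have hsum : ∑' i, ‖F i‖ₑ ≤ uBound n p ρ * ∑' i, ‖lam i‖ₑ := by
    rw [mul_comm, ← ENNReal.tsum_mul_right]; exact ENNReal.tsum_le_tsum hFn
  have hfin : ∑' i, ‖F i‖ₑ ≠ ⊤ :=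
    (hsum.trans_lt (ENNReal.mul_lt_top ENNReal.ofReal_lt_top hl.lt_top)).ne
  have hFs : Summable F := Summable.of_enorm hfin
  have hae : ∀ᵐ x, ∀ i, F i x = lam i * a i x := by
    refine ae_all_iff.2 fun i => ?_
    filter_upwards [Lp.coeFn_smul (lam i) ((hU i).toLp (a i)), (hU i).coeFn_toLp] with x h1 h2
    rw [hF]; simp only; rw [h1, Pi.smul_apply, h2, smul_eq_mul]
  have hS := Lp.hasSum_coeFn_tsum hfin
  have hS' : ∀ᵐ x, HasSum (fun i => lam i * a i x) ((∑' i, F i : Lp ℂ (uExp n ρ) _) x) := by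
    filter_upwards [hS, hae] with x h1 h2
    simpa only [h2] using h1
  have hSe : (fun x => ∑' i, lam i * a i x) =ᵐ[volume] (∑' i, F i : Lp ℂ (uExp n ρ) _) := by
    filter_upwards [hS'] with x hx using hx.tsum_eq
  refine ⟨hS'.mono fun x hx => hx.summable, (Lp.aestronglyMeasurable _).congr hSe.symm, ?_,
    Lp.toTemperedDistribution (∑' i, F i), ⟨H, fun φ => ?_⟩,
    ?_, fun φ => ⟨?_, ?_⟩⟩
  · rw [eLpNorm_congr_ae hSe, ← Lp.enorm_def]
    exact (enorm_tsum_le_tsum_enorm).trans hsum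
  · have h1 := hFs.hasSum.mapL (Lp.toTemperedDistributionCLM ℂ volume (uExp n ρ))
    have h2 : HasSum (fun i => Lp.toTemperedDistribution (F i) φ)
        (Lp.toTemperedDistribution (∑' i, F i) φ) :=
      h1.mapL (PointwiseConvergenceCLM.evalCLM (RingHom.id ℂ) ℂ φ)
    convert h2 using 2 with i
    rw [Lp.toTemperedDistribution_apply, ← integral_const_mul]
    refine integral_congr_ae ?_
    filter_upwards [hae] with x hx
    rw [hx i, smul_eq_mul]; ring
  · exact ((Lp.memLp (∑' i, F i)).locallyIntegrable h.one_le_u).congr hSe.symm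
  · have := ENNReal.HolderConjugate.inv_one_sub_inv' h.one_le_u
    have : ENNReal.HolderTriple (1 - (uExp n ρ)⁻¹)⁻¹ (uExp n ρ) 1 := 
      ENNReal.HolderConjugate.symm (p := uExp n ρ)
    have h1 : MemLp φ (1 - (uExp n ρ)⁻¹)⁻¹ volume := φ.memLp _ _
    refine (h1.integrable_mul (Lp.memLp (∑' i, F i))).congr ?_
    filter_upwards [hSe] with x hx
    rw [hx]; rfl
  · rw [Lp.toTemperedDistribution_apply]
    refine integral_congr_ae ?_
    filter_upwards [hSe] with x hx
    rw [hx]; rfl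

theorem Generates.ae_eq {h h' : Sp n → ℂ} {T : 𝓢'(Sp n, ℂ)} (H : Generates h T)
    (H' : Generates h' T) : h =ᵐ[volume] h' := by
  refine ae_eq_of_integral_contDiff_smul_eq H.1 H'.1 fun g hg hgc => ?_
  have hg₁ : HasCompactSupport (Complex.ofRealCLM ∘ g) := hgc.comp_left rfl
  have hg₂ : ContDiff ℝ ∞ (Complex.ofRealCLM ∘ g) := by fun_prop
  have h1 := (H.2 (hg₁.toSchwartzMap hg₂)).2
  have h2 := (H'.2 (hg₁.toSchwartzMap hg₂)).2
  rw [h1] at h2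
  simpa using h2

theorem Generates.congr {h h' : Sp n → ℂ} {T : 𝓢'(Sp n, ℂ)} (H : Generates h T)
    (e : h =ᵐ[volume] h') : Generates h' T := by
  have e' : ∀ φ : 𝓢(Sp n, ℂ), (fun x => φ x * h x) =ᵐ[volume] fun x => φ x * h' x := fun φ => by
    filter_upwards [e] with x hx
    rw [hx]
  exact ⟨H.1.congr e, fun φ => ⟨(H.2 φ).1.congr (e' φ),
    (H.2 φ).2.trans (integral_congr_ae (e' φ))⟩⟩

theorem IsAtomicDecomp.ae_eq (h : PredualIndex n p ρ) {T : 𝓢'(Sp n, ℂ)} {lam : Idx n → ℂ}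
    {a : Idx n → Sp n → ℂ} (H : IsAtomicDecomp p ρ T lam a) {f : Sp n → ℂ} (hf : Generates f T) :
    f =ᵐ[volume] fun x => ∑' i, lam i * a i x := by
  obtain ⟨-, -, -, T', H', hT'⟩ := H.toIsAtomic.exists_decomp h
  have : T = T' := by
    ext φ
    exact (H.hasSum φ).unique (H'.hasSum φ)
  subst this
  exact hf.ae_eq hT'

theorem exists_of_predualFunENorm_lt (h : PredualIndex n p ρ) {f : Sp n → ℂ} {c : ℝ≥0∞}
    (hf : predualFunENorm p ρ f < c) : ∃ lam a, IsAtomic p ρ lam a ∧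
      (f =ᵐ[volume] fun x => ∑' i, lam i * a i x) ∧ ∑' i, ‖lam i‖ₑ < c := by
  simp only [predualFunENorm, predualENorm, iInf_lt_iff] at hf
  obtain ⟨T, hT, lam, a, H, hc⟩ := hf
  exact ⟨lam, a, H.toIsAtomic, H.ae_eq h hT, hc⟩

theorem IsAtomic.memPredual (h : PredualIndex n p ρ) {f : Sp n → ℂ} {lam : Idx n → ℂ}
    {a : Idx n → Sp n → ℂ} (H : IsAtomic p ρ lam a)
    (e : f =ᵐ[volume] fun x => ∑' i, lam i * a i x) :
    MemPredual p ρ f ∧ predualFunENorm p ρ f ≤ ∑' i, ‖lam i‖ₑ := by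
  obtain ⟨-, -, -, T, HT, hT⟩ := H.exists_decomp h
  have hf := hT.congr e.symm
  exact ⟨⟨T, ⟨lam, a, HT⟩, hf⟩, iInf₂_le_of_le T hf (iInf_le_of_le lam (iInf₂_le_of_le a HT le_rfl))⟩

theorem memPredual_iff (h : PredualIndex n p ρ) {f : Sp n → ℂ} :
    MemPredual p ρ f ↔ predualFunENorm p ρ f < ⊤ := by
  constructor
  · rintro ⟨T, ⟨lam, a, H⟩, hT⟩
    exact (iInf₂_le_of_le T hT (iInf_le_of_le lam (iInf₂_le_of_le a H le_rfl))).trans_lt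
      (tsum_enorm_ne_top_iff_summable_norm.2 H.summable).lt_top
  · intro hf
    obtain ⟨lam, a, H, e, -⟩ := exists_of_predualFunENorm_lt h hf
    exact (H.memPredual h e).1

theorem predualFunENorm_mono (h : PredualIndex n p ρ) {f g : Sp n → ℂ}
    (hf : AEStronglyMeasurable f volume) (hfg : ∀ᵐ x, ‖f x‖ ≤ ‖g x‖) :
    predualFunENorm p ρ f ≤ predualFunENorm p ρ g := by
  refine le_of_forall_gt fun c hc => ?_
  obtain ⟨lam, a, H, e, hlam⟩ := exists_of_predualFunENorm_lt h hc
  have hg : AEStronglyMeasurable g volume := (H.exists_decomp h).2.1.congr e.symm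
  have hm : AEStronglyMeasurable (fun x => f x / g x) volume :=
    (hf.aemeasurable.div hg.aemeasurable).aestronglyMeasurable
  have hle : ∀ i, ∀ᵐ x, ‖a i x * (f x / g x)‖ ≤ ‖a i x‖ := fun i => by
    filter_upwards [hfg] with x hx
    rw [norm_mul, norm_div]
    exact mul_le_of_le_one_right (norm_nonneg _) (div_le_one_of_le₀ hx (norm_nonneg _))
  have H' : IsAtomic p ρ lam (fun i x => a i x * (f x / g x)) :=
    ⟨fun i => (H.memLp i).mono ((H.memLp i).1.mul hm) (hle i),
      fun i => (H.supp i).mono fun x hx hxi => by rw [hx hxi, zero_mul],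
      fun i => (eLpNorm_mono_ae (hle i)).trans (H.norm_le i), H.summable⟩
  refine ((H'.memPredual h ?_).2).trans_lt hlam
  filter_upwards [e, hfg] with x hx hx'
  simp_rw [← mul_assoc]
  rw [tsum_mul_right, ← hx]
  rcases eq_or_ne (g x) 0 with h0 | h0
  · rw [h0, norm_zero] at hx'
    rw [h0, zero_mul]
    simpa using hx'
  · field_simp

theorem predualFunENorm_add_le (h : PredualIndex n p ρ) (f g : Sp n → ℂ) :
    predualFunENorm p ρ (f + g) ≤ predualFunENorm p ρ f + predualFunENorm p ρ g := by
  rcases eq_or_ne (predualFunENorm p ρ f) ⊤ with hf | hf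
  · simp [hf]
  rcases eq_or_ne (predualFunENorm p ρ g) ⊤ with hg | hg
  · simp [hg]
  refine ENNReal.le_of_forall_pos_le_add fun ε hε _ => ?_
  have hε2 : ((ε / 2 : ℝ≥0) : ℝ≥0∞) ≠ 0 := by simpa using hε.ne'
  obtain ⟨l, a, H, e, hl⟩ := exists_of_predualFunENorm_lt h (ENNReal.lt_add_right hf hε2)
  obtain ⟨m, b, K, e', hm⟩ := exists_of_predualFunENorm_lt h (ENNReal.lt_add_right hg hε2)
  have hp1 : 1 ≤ ENNReal.ofReal p := by simpa using ENNReal.ofReal_le_ofReal h.one_lt.le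
  set s : Idx n → ℝ := fun i => ‖l i‖ + ‖m i‖ with hs
  have hs0 : ∀ i, 0 ≤ s i := fun i => by positivity
  set c : Idx n → Sp n → ℂ := fun i x => (l i / s i) * a i x + (m i / s i) * b i x with hc
  have hmul : ∀ i x, (s i : ℂ) * c i x = l i * a i x + m i * b i x := by
    intro i x
    rcases eq_or_ne (s i) 0 with h0 | h0
    · have h1 : ‖l i‖ = 0 := le_antisymm (by have := norm_nonneg (m i); simp only [hs] at h0; linarith)
        (norm_nonneg _)
      have h2 : ‖m i‖ = 0 := le_antisymm (by have := norm_nonneg (l i); simp only [hs] at h0; linarith)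
        (norm_nonneg _)
      rw [norm_eq_zero] at h1 h2
      simp [h0, h1, h2]
    · have : (s i : ℂ) ≠ 0 := by exact_mod_cast h0
      simp only [hc]; field_simp
  have hcn : ∀ i, ‖l i / s i‖ₑ + ‖m i / s i‖ₑ ≤ 1 := by
    intro i
    rw [← ofReal_norm, ← ofReal_norm, ← ENNReal.ofReal_add (norm_nonneg _)
      (norm_nonneg _), ← ENNReal.ofReal_one]
    apply ENNReal.ofReal_le_ofReal
    rw [norm_div, norm_div, ← add_div, Complex.norm_real, Real.norm_of_nonneg (hs0 i)]
    exact div_self_le_one _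
  have J : IsAtomic p ρ (fun i => (s i : ℂ)) c := by
    refine ⟨fun i => ((H.memLp i).const_mul _).add ((K.memLp i).const_mul _), fun i => ?_,
      fun i => ?_, ?_⟩
    · filter_upwards [H.supp i, K.supp i] with x h1 h2 hx
      simp [hc, h1 hx, h2 hx]
    · calc eLpNorm (c i) (ENNReal.ofReal p) volume
          ≤ eLpNorm (fun x => (l i / s i) * a i x) (ENNReal.ofReal p) volume +
            eLpNorm (fun x => (m i / s i) * b i x) (ENNReal.ofReal p) volume :=
            eLpNorm_add_le ((H.memLp i).1.const_mul _) ((K.memLp i).1.const_mul _) hp1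
        _ = ‖l i / s i‖ₑ * eLpNorm (a i) (ENNReal.ofReal p) volume +
            ‖m i / s i‖ₑ * eLpNorm (b i) (ENNReal.ofReal p) volume := by
            congr 1
            · exact eLpNorm_const_smul (l i / s i : ℂ) (a i) _ _
            · exact eLpNorm_const_smul (m i / s i : ℂ) (b i) _ _
        _ ≤ _ := add_le_add (mul_le_mul_right (H.norm_le i) _) (mul_le_mul_right (K.norm_le i) _)
        _ ≤ _ := by
            rw [← add_mul]
            exact (mul_le_mul_left (hcn i) _).trans (one_mul _).le
    · have : ∀ i, ‖(s i : ℂ)‖ = ‖l i‖ + ‖m i‖ := fun i => by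
        rw [Complex.norm_real, Real.norm_of_nonneg (hs0 i)]
      simp_rw [this]
      exact H.summable.add K.summable
  have hsum : ∑' i, ‖(s i : ℂ)‖ₑ = ∑' i, ‖l i‖ₑ + ∑' i, ‖m i‖ₑ := by
    rw [← ENNReal.tsum_add]
    congr 1; funext i
    rw [← ofReal_norm, Complex.norm_real, Real.norm_of_nonneg (hs0 i),
      ENNReal.ofReal_add (norm_nonneg _) (norm_nonneg _), ofReal_norm,
      ofReal_norm]
  refine ((J.memPredual h ?_).2).trans ?_
  · filter_upwards [e, e', (H.exists_decomp h).1, (K.exists_decomp h).1] with x h1 h2 h3 h4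
    simp_rw [hmul]
    rw [Pi.add_apply, h1, h2, h3.tsum_add h4]
  · rw [hsum]
    refine (add_le_add hl.le hm.le).trans (le_of_eq ?_)
    rw [add_add_add_comm, ← ENNReal.coe_add, add_halves]

theorem predualFunENorm_const_mul_le (h : PredualIndex n p ρ) (c : ℂ) (f : Sp n → ℂ) :
    predualFunENorm p ρ (fun x => c * f x) ≤ ‖c‖ₑ * predualFunENorm p ρ f := by
  rcases eq_or_ne c 0 with rfl | hc
  · have H : IsAtomic p ρ (0 : Idx n → ℂ) (0 : Idx n → Sp n → ℂ) :=
      ⟨fun _ => MemLp.zero, fun _ => by simp, fun _ => by simp, by simp⟩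
    simpa using (H.memPredual h (f := fun x => 0 * f x) (by simp)).2
  have hc0 : ‖c‖ₑ ≠ 0 := by simpa using hc
  rw [mul_comm, ← ENNReal.div_le_iff hc0 (by simp)]
  refine le_of_forall_gt fun t ht => ?_
  obtain ⟨lam, a, H, e, hlam⟩ := exists_of_predualFunENorm_lt h ht
  have H' : IsAtomic p ρ (fun i => c * lam i) a :=
    ⟨H.memLp, H.supp, H.norm_le, by simpa using H.summable.mul_left ‖c‖⟩
  refine lt_of_le_of_lt ?_ hlam
  rw [ENNReal.div_le_iff hc0 (by simp)]
  refine ((H'.memPredual h ?_).2).trans (le_of_eq ?_)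
  · filter_upwards [e] with x hx
    simp_rw [mul_assoc]
    rw [tsum_mul_left, hx]
  · simp_rw [enorm_mul]
    rw [ENNReal.tsum_mul_left, mul_comm]

theorem ae_zero_of_predualFunENorm (h : PredualIndex n p ρ) {f : Sp n → ℂ}
    (hf : predualFunENorm p ρ f = 0) : f =ᵐ[volume] 0 := by
  have hU0 : uExp n ρ ≠ 0 := (zero_lt_one.trans_le h.one_le_u).ne'
  have hm : AEStronglyMeasurable f volume := by
    obtain ⟨lam, a, H, e, -⟩ := exists_of_predualFunENorm_lt h (hf.trans_lt ENNReal.zero_lt_top)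
    exact (H.exists_decomp h).2.1.congr e.symm
  rw [← eLpNorm_eq_zero_iff hm hU0]
  have hB : uBound n p ρ ≠ 0 := by
    simp only [uBound, ne_eq, ENNReal.ofReal_eq_zero, not_le]; positivity
  have hB' : uBound n p ρ ≠ ⊤ := ENNReal.ofReal_ne_top
  refine le_antisymm (le_of_forall_gt fun c hc => ?_) zero_le
  have hc' : 0 < c / uBound n p ρ := ENNReal.div_pos hc.ne' hB'
  obtain ⟨lam, a, H, e, hlam⟩ := exists_of_predualFunENorm_lt h (hf.trans_lt hc')
  rw [eLpNorm_congr_ae e]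
  refine (H.exists_decomp h).2.2.1.trans_lt ?_
  rw [mul_comm]
  exact (ENNReal.lt_div_iff_mul_lt (Or.inl hB) (Or.inl hB')).1 hlam

/-- The pointwise `ℓ_q` norm as a complex-valued function. -/
def lqFun (q : ℝ) (g : FunSeq n) (x : Sp n) : ℂ := ((lqNorm q g x).toReal : ℂ)

/-- The norm of a sequence of functions in `H^ρ L_p(ℓ_q)`, with values in `[0, ∞]`. -/
def predualSeqENorm (p q ρ : ℝ) (g : FunSeq n) : ℝ≥0∞ := predualFunENorm p ρ (lqFun q g)

theorem measurable_lqFun (q : ℝ) (g : FunSeq n) : Measurable (lqFun q g) :=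
  Complex.measurable_ofReal.comp (measurable_lqNorm q g).ennreal_toReal

theorem norm_lqFun (q : ℝ) (g : FunSeq n) (x : Sp n) : ‖lqFun q g x‖ = (lqNorm q g x).toReal := by
  rw [lqFun, Complex.norm_real, Real.norm_of_nonneg ENNReal.toReal_nonneg]

theorem memPredual_component (h : PredualIndex n p ρ) (hq : 1 < q) {g : FunSeq n}
    (h1 : ∀ᵐ x, lqNorm q g x < ⊤) (h2 : predualSeqENorm p q ρ g < ⊤) (j : ℕ) :
    MemPredual p ρ (g j) := by
  rw [memPredual_iff h]
  refine (predualFunENorm_mono h (g j).aestronglyMeasurable ?_).trans_lt h2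
  filter_upwards [h1] with x hx
  rw [norm_lqFun, ← toReal_enorm]
  exact ENNReal.toReal_mono hx.ne (enorm_le_lqNorm hq g j x)

theorem predualSeqENorm_add_le (h : PredualIndex n p ρ) (hq : 1 < q) {f g : FunSeq n}
    (hf : ∀ᵐ x, lqNorm q f x < ⊤) (hg : ∀ᵐ x, lqNorm q g x < ⊤) :
    predualSeqENorm p q ρ (f + g) ≤ predualSeqENorm p q ρ f + predualSeqENorm p q ρ g := by
  refine (predualFunENorm_mono h (measurable_lqFun q _).aestronglyMeasurable ?_).trans
    (predualFunENorm_add_le h (lqFun q f) (lqFun q g))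
  filter_upwards [hf, hg, lqNorm_add_le hq f g] with x h1 h2 h3
  rw [norm_lqFun, Pi.add_apply, lqFun, lqFun, ← Complex.ofReal_add, Complex.norm_real,
    Real.norm_of_nonneg (by positivity), ← ENNReal.toReal_add h1.ne h2.ne]
  exact ENNReal.toReal_mono (ENNReal.add_lt_top.2 ⟨h1, h2⟩).ne h3

theorem predualSeqENorm_smul_le (h : PredualIndex n p ρ) (hq : 1 < q) (c : ℂ) (f : FunSeq n) :
    predualSeqENorm p q ρ (c • f) ≤ ‖c‖ₑ * predualSeqENorm p q ρ f := by
  refine (predualFunENorm_mono h (measurable_lqFun q _).aestronglyMeasurable ?_).trans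
    (predualFunENorm_const_mul_le h c (lqFun q f))
  filter_upwards [lqNorm_smul hq c f] with x hx
  rw [norm_mul, norm_lqFun, norm_lqFun, hx, ENNReal.toReal_mul, toReal_enorm]

theorem predualSeqENorm_smul (h : PredualIndex n p ρ) (hq : 1 < q) (c : ℂ) (f : FunSeq n) :
    predualSeqENorm p q ρ (c • f) = ‖c‖ₑ * predualSeqENorm p q ρ f := by
  refine le_antisymm (predualSeqENorm_smul_le h hq c f) ?_
  rcases eq_or_ne c 0 with rfl | hc
  · simp
  have h := predualSeqENorm_smul_le h hq c⁻¹ (c • f)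
  rw [inv_smul_smul₀ hc, enorm_inv hc] at h
  calc _ ≤ ‖c‖ₑ * (‖c‖ₑ⁻¹ * predualSeqENorm p q ρ (c • f)) := mul_le_mul_right h _
    _ = _ := by rw [← mul_assoc, ENNReal.mul_inv_cancel (by simpa using hc) (by simp), one_mul]

theorem predualSeqENorm_zero (h : PredualIndex n p ρ) (hq : 1 < q) :
    predualSeqENorm p q ρ (0 : FunSeq n) = 0 := by
  have := predualSeqENorm_smul h hq 0 (0 : FunSeq n)
  rw [show (0 : ℂ) • (0 : FunSeq n) = 0 from smul_zero (A := FunSeq n) (0 : ℂ)] at this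
  simpa using this

/-- The vector-valued predual Morrey space `H^ρ L_p(ℓ_q)`: all sequences of functions in
`H^ρ L_p` whose pointwise `ℓ_q` norm is (finite almost everywhere and) in `H^ρ L_p`. -/
def PredualSeq (n : ℕ) (p q ρ : ℝ) (h : PredualIndex n p ρ) (hq : 1 < q) :
    Submodule ℂ (FunSeq n) where
  carrier := {g | (∀ j, MemPredual p ρ (g j)) ∧ (∀ᵐ x, lqNorm q g x < ⊤) ∧
    MemPredual p ρ (lqFun q g)}
  zero_mem' := by
    have h1 : ∀ᵐ x, lqNorm q (0 : FunSeq n) x < ⊤ :=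
      (lqNorm_zero hq).mono fun x hx => by simp [hx]
    have h2 : predualSeqENorm p q ρ (0 : FunSeq n) < ⊤ := by simp [predualSeqENorm_zero h hq]
    exact ⟨memPredual_component h hq h1 h2, h1, (memPredual_iff h).2 h2⟩
  add_mem' := by
    intro f g hf hg
    have h1 : ∀ᵐ x, lqNorm q (f + g) x < ⊤ := by
      filter_upwards [hf.2.1, hg.2.1, lqNorm_add_le hq f g] with x a b c
      exact c.trans_lt (ENNReal.add_lt_top.2 ⟨a, b⟩)
    have h2 : predualSeqENorm p q ρ (f + g) < ⊤ :=
      (predualSeqENorm_add_le h hq hf.2.1 hg.2.1).trans_lt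
        (ENNReal.add_lt_top.2 ⟨(memPredual_iff h).1 hf.2.2, (memPredual_iff h).1 hg.2.2⟩)
    exact ⟨memPredual_component h hq h1 h2, h1, (memPredual_iff h).2 h2⟩
  smul_mem' := by
    intro c f hf
    have h1 : ∀ᵐ x, lqNorm q (c • f) x < ⊤ := by
      filter_upwards [hf.2.1, lqNorm_smul hq c f] with x a b
      rw [b]; exact ENNReal.mul_lt_top (by simp) a
    have h2 : predualSeqENorm p q ρ (c • f) < ⊤ :=
      (predualSeqENorm_smul_le h hq c f).trans_lt
        (ENNReal.mul_lt_top (by simp) ((memPredual_iff h).1 hf.2.2))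
    exact ⟨memPredual_component h hq h1 h2, h1, (memPredual_iff h).2 h2⟩

variable {h : PredualIndex n p ρ}

theorem PredualSeq.enorm_lt_top (g : PredualSeq n p q ρ h hq) :
    predualSeqENorm p q ρ g.1 < ⊤ := (memPredual_iff h).1 g.2.2.2

instance : Norm (PredualSeq n p q ρ h hq) := ⟨fun g => (predualSeqENorm p q ρ g.1).toReal⟩

theorem predualSeq_core : NormedSpace.Core ℂ (PredualSeq n p q ρ h hq) where
  norm_nonneg _ := ENNReal.toReal_nonneg
  norm_smul c f := by
    change (predualSeqENorm p q ρ (c • f.1)).toReal = _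
    rw [predualSeqENorm_smul h hq, ENNReal.toReal_mul]
    simp [Norm.norm]
  norm_triangle f g := by
    change (predualSeqENorm p q ρ (f.1 + g.1)).toReal ≤
      (predualSeqENorm p q ρ f.1).toReal + (predualSeqENorm p q ρ g.1).toReal
    rw [← ENNReal.toReal_add (PredualSeq.enorm_lt_top f).ne (PredualSeq.enorm_lt_top g).ne]
    exact ENNReal.toReal_mono (ENNReal.add_lt_top.2 ⟨(PredualSeq.enorm_lt_top f), (PredualSeq.enorm_lt_top g)⟩).ne
      (predualSeqENorm_add_le h hq f.2.2.1 g.2.2.1)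
  norm_eq_zero_iff f := by
    change (predualSeqENorm p q ρ f.1).toReal = 0 ↔ _
    constructor
    · intro h0
      rcases (ENNReal.toReal_eq_zero_iff _).1 h0 with h0 | h0
      · refine Subtype.ext (eq_zero_of_lqNorm hq f.1 ?_)
        filter_upwards [ae_zero_of_predualFunENorm h h0, f.2.2.1] with x hx hx'
        have h3 := norm_lqFun q f.1 x
        rw [hx, Pi.zero_apply, norm_zero] at h3
        exact ((ENNReal.toReal_eq_zero_iff _).1 h3.symm).resolve_right hx'.ne
      · exact absurd h0 (PredualSeq.enorm_lt_top f).ne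
    · rintro rfl
      simp [predualSeqENorm_zero h hq]

instance : NormedAddCommGroup (PredualSeq n p q ρ h hq) := NormedAddCommGroup.ofCore predualSeq_core

instance : NormedSpace ℂ (PredualSeq n p q ρ h hq) := NormedSpace.ofCore predualSeq_core

/-- The norm of a sequence of functions in the Lebesgue space `L_u(ℓ_q)`, with values
in `[0, ∞]`. -/
def lebesgueSeqENorm (u q : ℝ) (f : FunSeq n) : ℝ≥0∞ :=
  eLpNorm (lqNorm q f) (ENNReal.ofReal u) volume

/-- The pairing `∫ ∑ g_j f_j` of two sequences of functions. -/
def pairing (g f : FunSeq n) : ℂ := ∫ x, ∑' j, g j x * f j x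

/-- The series `∑ g_j f_j` converges absolutely almost everywhere and its sum is integrable, so
that `pairing g f` is an honest integral. -/
def PairingConverges (g f : FunSeq n) : Prop :=
  (∀ᵐ x, Summable fun j => ‖g j x * f j x‖) ∧
    Integrable (fun x => ∑' j, g j x * f j x) volume

/-- If `1 / p + 1 / p' = 1`, `-n / p < r < 0` and `r + ρ = -n`, then `1 < p' < ∞` and
`-n < ρ < -n / p'`. -/
theorem predualIndex_of_holderConjugate {p' : ℝ} (hp : p.HolderConjugate p')
    (hr : -(n : ℝ) / p < r) (hr0 : r < 0) (hrρ : r + ρ = -(n : ℝ)) : PredualIndex n p' ρ := by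
  refine ⟨hp.symm.lt, by linarith, ?_⟩
  have h1 := hp.inv_add_inv_eq_one
  have h2 : -(n : ℝ) / p + -(n : ℝ) / p' = -n := by
    rw [div_eq_mul_inv, div_eq_mul_inv, ← mul_add, h1, mul_one]
  linarith

end

end MorreyDuality

open MorreyDuality

namespace MorreyDuality

/-! ### Inequalities for sequences -/

/-! Write `w i = 2^(J(n/p+r))` for the weight of the cube with index `i = (J, M)` in the Morrey
norm. Since `r + ρ = -n`, `w i` is also the largest `L_{p'}` norm of an atom on that cube. Hölder's
inequality on each cube, summed over an atomic decomposition of `|g|_{q'}`, therefore gives `∫ ∑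
|g_j f_j| ≤ ‖g‖ ‖f‖` with constant one (`lintegral_mul_le_predual_mul_morrey`).

For the converse, the Morrey norm is a supremum over cubes, so `f ↦ (f)_i` embeds the test closure
isometrically into families carrying a supremum norm over the cubes. By Hahn–Banach a functional `G`
extends to a functional `L` on families with the same bound (`exists_family_extension`). On families
concentrated on one cube and one entry, `L` is integration against a density `g i j`
(`exists_family_density`). Finitely many cubes can be tested simultaneously with extremal functions
for the mixed Hölder inequality, because a supremum norm does not see how many cubes are involved.
This gives `∑ i, (w i)⁻¹ ‖g i‖_{L_{p'}(ℓ_{q'})} ≤ ‖G‖` (`sum_density_le`), which says precisely that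
the sum of the `g i` has an atomic decomposition of size at most `‖G‖`
(`exists_predual_of_densities`).

The dual of a supremum-normed space is larger than the corresponding `ℓ_1` space, so the one-cube
parts of `L` need not determine `L`. They do on test sequences: these are bounded with compact
support, and `n/p + r > 0 > r` forces their contributions to vanish along very large, very small and
distant cubes (`tendsto_cubeENorm`). Hence `L` of the constant family is the sum of its one-cube
parts (`hasSum_family_single`), and density of the test sequences identifies `G` with the pairing
against `∑ i, g i` (`exists_representation`).

Testing with a single smooth entry shows that the pairing determines `g`. The representative of norm
at most `‖G‖` is then the only one, and the pairing is an isometry. The statements about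
`L_{-n/r}(ℓ_q)` follow because Hölder's inequality embeds that space in the Morrey space and test
sequences are dense in it. -/

theorem ennreal_tsum_mul_le {p q : ℝ} (hpq : p.HolderConjugate q) (a b : ℕ → ℝ≥0∞) :
    ∑' j, a j * b j ≤ (∑' j, a j ^ p) ^ (1 / p) * (∑' j, b j ^ q) ^ (1 / q) := by
  have := ENNReal.lintegral_mul_le_Lp_mul_Lq (Measure.count : Measure ℕ) hpq
    (measurable_of_countable a).aemeasurable (measurable_of_countable b).aemeasurable
  simpa only [lintegral_count, Pi.mul_apply] using this

theorem ennreal_Lp_add_le_tsum {q : ℝ} (hq : 1 ≤ q) (a b : ℕ → ℝ≥0∞) :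
    (∑' j, (a j + b j) ^ q) ^ (1 / q) ≤ (∑' j, a j ^ q) ^ (1 / q) + (∑' j, b j ^ q) ^ (1 / q) := by
  have := ENNReal.lintegral_Lp_add_le (μ := Measure.count) (p := q) (f := a) (g := b)
    (measurable_of_countable _).aemeasurable (measurable_of_countable _).aemeasurable hq
  simpa only [lintegral_count, Pi.add_apply] using this

theorem ennreal_Lp_sum_le {ι : Type*} {q : ℝ} (hq : 1 ≤ q) (b : ι → ℕ → ℝ≥0∞) (s : Finset ι) :
    (∑' j, (∑ i ∈ s, b i j) ^ q) ^ (1 / q) ≤ ∑ i ∈ s, (∑' j, b i j ^ q) ^ (1 / q) := by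
  classical
  have hq0 : 0 < q := by linarith
  induction s using Finset.induction_on with
  | empty => simp [hq0]
  | insert i s hi ih =>
    simp only [Finset.sum_insert hi]
    exact (ennreal_Lp_add_le_tsum hq _ _).trans (by gcongr)

/-- The outer sum on the left is a supremum over finite sets of `j`. For such a set the inner sums
are limits of finite sums over `i`, so the finite Minkowski inequality passes to the limit. -/
theorem ennreal_Lp_tsum_le {ι : Type*} {q : ℝ} (hq : 1 ≤ q) (b : ι → ℕ → ℝ≥0∞) :
    (∑' j, (∑' i, b i j) ^ q) ^ (1 / q) ≤ ∑' i, (∑' j, b i j ^ q) ^ (1 / q) := by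
  have hq0 : 0 < q := by linarith
  rw [one_div, ENNReal.rpow_inv_le_iff hq0, ENNReal.tsum_eq_iSup_sum]
  refine iSup_le fun T => ?_
  have h1 : Tendsto (fun s : Finset ι => ∑ j ∈ T, (∑ i ∈ s, b i j) ^ q) atTop
      (𝓝 (∑ j ∈ T, (∑' i, b i j) ^ q)) :=
    tendsto_finsetSum _ fun j _ =>
      (ENNReal.continuous_rpow_const.tendsto _).comp ENNReal.summable.hasSum
  refine le_of_tendsto' h1 fun s => ?_
  rw [← ENNReal.rpow_inv_le_iff hq0, ← one_div]
  refine le_trans ?_ ((ennreal_Lp_sum_le hq b s).trans (ENNReal.sum_le_tsum s))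
  gcongr
  exact ENNReal.sum_le_tsum T

/-- Minkowski's inequality for the matrix with the numbers `a i` on its diagonal and zeros
elsewhere. -/
theorem ennreal_Lp_le_tsum {q : ℝ} (hq : 1 ≤ q) (a : ℕ → ℝ≥0∞) :
    (∑' j, a j ^ q) ^ (1 / q) ≤ ∑' j, a j := by
  have hq0 : 0 < q := by linarith
  have h := ennreal_Lp_tsum_le hq fun i j => if j = i then a i else 0
  have h1 : ∀ i : ℕ, (∑' j, (if j = i then a i else 0) ^ q) = a i ^ q := fun i => by
    rw [tsum_eq_single i fun j hj => by simp [hj, hq0]]; simp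
  have h2 : ∀ j : ℕ, (∑' i, (if j = i then a i else 0)) = a j := fun j => by
    rw [tsum_eq_single j fun i hi => by simp [hi.symm]]; simp
  simp only [h1, h2] at h
  refine h.trans (le_of_eq (tsum_congr fun i => ?_))
  rw [one_div, ENNReal.rpow_rpow_inv hq0.ne']

/-! ### The pairing -/

variable {n : ℕ} {p p' q q' r ρ : ℝ}

theorem tsum_enorm_mul_le (hq : q.HolderConjugate q') (g f : FunSeq n) (x : Sp n) :
    ∑' j, ‖g j x * f j x‖ₑ ≤ lqNorm q' g x * lqNorm q f x := by
  simp_rw [enorm_mul]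
  exact ennreal_tsum_mul_le hq.symm _ _

/-- The size allowed for an atom is exactly the Morrey weight of its cube. The relation `r + ρ = -n`
enters the pairing estimate here, and it makes the constant equal to one. -/
theorem neg_mul_exponent_eq (hp : p.HolderConjugate p') (hrρ : r + ρ = -(n : ℝ)) (J : ℝ) :
    -(J * ((n : ℝ) / p' + ρ)) = J * ((n : ℝ) / p + r) := by
  have h1 : (n : ℝ) / p + n / p' = n := by
    rw [div_eq_mul_inv, div_eq_mul_inv, ← mul_add, hp.inv_add_inv_eq_one, mul_one]
  have h2 : (n : ℝ) / p' + ρ = -((n : ℝ) / p + r) := by linarith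
  rw [h2]; ring

/-- Each atom lives on its own cube, where Hölder's inequality bounds its pairing with `F` by the
weighted local norm of `F`, hence by the Morrey norm. Summing against the coefficients gives the
product. -/
theorem lintegral_mul_le_predual_mul_morrey (hp : p.HolderConjugate p')
    (h : PredualIndex n p' ρ) (hrρ : r + ρ = -(n : ℝ)) {k : Sp n → ℂ} {F : Sp n → ℝ≥0∞}
    (hF : Measurable F) (hk : predualFunENorm p' ρ k < ⊤) (hF' : morreyENorm p r F < ⊤) :
    ∫⁻ x, ‖k x‖ₑ * F x ≤ predualFunENorm p' ρ k * morreyENorm p r F := by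
  have hp0 := hp.pos
  have hp0' := hp.symm.pos
  -- The infimum over decompositions need not be attained, so the norms are replaced by arbitrary
  -- larger `c` and `m`; finiteness of both excludes the product `0 · ∞`.
  refine ENNReal.le_mul_of_forall_lt (Or.inr hF'.ne) (Or.inl hk.ne) fun c hc m hm => ?_
  obtain ⟨lam, a, H, e, hlam⟩ := exists_of_predualFunENorm_lt h hc
  have ham : ∀ i, AEMeasurable (fun x => ‖lam i * a i x‖ₑ * F x) volume := fun i =>
    (((H.memLp i).1.const_mul (lam i)).enorm).mul hF.aemeasurable
  calc ∫⁻ x, ‖k x‖ₑ * F x ≤ ∫⁻ x, ∑' i, ‖lam i * a i x‖ₑ * F x := by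
        refine lintegral_mono_ae ?_
        filter_upwards [e] with x hx
        rw [hx, ENNReal.tsum_mul_right]
        gcongr
        exact enorm_tsum_le_tsum_enorm
    _ = ∑' i, ∫⁻ x, ‖lam i * a i x‖ₑ * F x := lintegral_tsum ham
    _ ≤ ∑' i, ‖lam i‖ₑ * morreyENorm p r F := by
        refine ENNReal.tsum_le_tsum fun i => ?_
        have h1 : ∫⁻ x, ‖lam i * a i x‖ₑ * F x =
            ‖lam i‖ₑ * ∫⁻ x in dyadicCube i, ‖a i x‖ₑ * F x := by
          have h0 : AEMeasurable (fun x => ‖a i x‖ₑ * F x) (volume.restrict (dyadicCube i)) :=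
            ((H.memLp i).1.enorm.mul hF.aemeasurable).restrict
          rw [← lintegral_const_mul'' _ h0,
            ← lintegral_indicator (isClosed_dyadicCube i).measurableSet]
          refine lintegral_congr_ae ?_
          filter_upwards [H.supp i] with x hx
          by_cases hxi : x ∈ dyadicCube i
          · simp [hxi, enorm_mul, mul_assoc]
          · simp [hxi, hx hxi]
        rw [h1]
        gcongr
        have h2 := ENNReal.lintegral_mul_le_Lp_mul_Lq (volume.restrict (dyadicCube i)) hp.symm
          (H.memLp i).1.enorm.restrict hF.aemeasurable
        simp only [Pi.mul_apply] at h2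
        refine h2.trans ?_
        have h3 : (∫⁻ x in dyadicCube i, ‖a i x‖ₑ ^ p') ^ (1 / p') ≤
            ENNReal.ofReal ((2 : ℝ) ^ ((i.1 : ℝ) * ((n : ℝ) / p + r))) := by
          have h4 := H.norm_le i
          rw [neg_mul_exponent_eq hp hrρ, eLpNorm_eq_lintegral_rpow_enorm_toReal
            (by simpa using hp0') ENNReal.ofReal_ne_top, ENNReal.toReal_ofReal hp0'.le] at h4
          refine le_trans ?_ h4
          gcongr
          exact Measure.restrict_le_self
        have h7 : (∫⁻ x in dyadicCube i, F x ^ p) ^ (1 / p) =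
            eLpNorm F (ENNReal.ofReal p) (volume.restrict (dyadicCube i)) := by
          rw [eLpNorm_eq_lintegral_rpow_enorm_toReal
            (by simpa using hp0) ENNReal.ofReal_ne_top, ENNReal.toReal_ofReal hp0.le]
          simp
        rw [h7]
        refine (mul_le_mul_left h3 _).trans ?_
        exact le_iSup (fun i : Idx n => ENNReal.ofReal _ *
          eLpNorm F (ENNReal.ofReal p) (volume.restrict (dyadicCube i))) i
    _ = (∑' i, ‖lam i‖ₑ) * morreyENorm p r F := ENNReal.tsum_mul_right
    _ ≤ c * m := by gcongr

theorem lintegral_tsum_enorm_mul_le (hp : p.HolderConjugate p') (hq : q.HolderConjugate q')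
    (h : PredualIndex n p' ρ) (hrρ : r + ρ = -(n : ℝ)) {g f : FunSeq n}
    (hg : ∀ᵐ x, lqNorm q' g x < ⊤) (hg' : predualSeqENorm p' q' ρ g < ⊤)
    (hf : morreySeqENorm p q r f < ⊤) :
    ∫⁻ x, ∑' j, ‖g j x * f j x‖ₑ ≤ predualSeqENorm p' q' ρ g * morreySeqENorm p q r f := by
  refine le_trans (lintegral_mono_ae ?_) (lintegral_mul_le_predual_mul_morrey hp h hrρ
    (measurable_lqNorm q f) hg' hf)
  filter_upwards [hg] with x hx
  refine (tsum_enorm_mul_le hq g f x).trans (le_of_eq ?_)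
  rw [← ofReal_norm, norm_lqFun, ENNReal.ofReal_toReal hx.ne]

theorem aestronglyMeasurable_tsum_mul (g f : FunSeq n) :
    AEStronglyMeasurable (fun x => ∑' j, g j x * f j x) volume := by
  have : ∀ j, Measurable fun x => g j x * f j x := fun j =>
    (g j).stronglyMeasurable.measurable.mul (f j).stronglyMeasurable.measurable
  exact (Measurable.tsum this).aestronglyMeasurable

/-- The bound for the integral of `∑ |g_j f_j|` yields the absolute convergence, the integrability
and the norm estimate at once. -/
theorem pairingConverges (hp : p.HolderConjugate p') (hq : q.HolderConjugate q')
    (h : PredualIndex n p' ρ) (hrρ : r + ρ = -(n : ℝ)) {g f : FunSeq n}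
    (hg : ∀ᵐ x, lqNorm q' g x < ⊤) (hg' : predualSeqENorm p' q' ρ g < ⊤)
    (hf : morreySeqENorm p q r f < ⊤) :
    PairingConverges g f ∧
      ‖pairing g f‖ₑ ≤ predualSeqENorm p' q' ρ g * morreySeqENorm p q r f := by
  have h1 := lintegral_tsum_enorm_mul_le hp hq h hrρ hg hg' hf
  have h2 := h1.trans_lt (ENNReal.mul_lt_top hg' hf)
  have hm : Measurable fun x => ∑' j, ‖g j x * f j x‖ₑ := Measurable.tsum fun j =>
    ((g j).stronglyMeasurable.measurable.mul (f j).stronglyMeasurable.measurable).enorm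
  refine ⟨⟨?_, aestronglyMeasurable_tsum_mul g f, ?_⟩, ?_⟩
  · filter_upwards [ae_lt_top hm h2.ne] with x hx
    exact tsum_enorm_ne_top_iff_summable_norm.1 hx.ne
  · exact (lintegral_mono fun x => enorm_tsum_le_tsum_enorm).trans_lt h2
  · refine (enorm_integral_le_lintegral_enorm _).trans ((lintegral_mono fun x => ?_).trans h1)
    exact enorm_tsum_le_tsum_enorm

theorem pairing_add_left {g g' f : FunSeq n} (h : PairingConverges g f)
    (h' : PairingConverges g' f) : pairing (g + g') f = pairing g f + pairing g' f := by
  rw [pairing, pairing, pairing, ← integral_add h.2 h'.2]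
  refine integral_congr_ae ?_
  filter_upwards [h.1, h'.1, ae_all_iff.2 fun j => AEEqFun.coeFn_add (g j) (g' j)] with x h1 h2 h3
  rw [← h1.of_norm.tsum_add h2.of_norm]
  refine tsum_congr fun j => ?_
  rw [← add_mul, ← Pi.add_apply, ← h3 j]; rfl

theorem pairing_add_right {g f f' : FunSeq n} (h : PairingConverges g f)
    (h' : PairingConverges g f') : pairing g (f + f') = pairing g f + pairing g f' := by
  rw [pairing, pairing, pairing, ← integral_add h.2 h'.2]
  refine integral_congr_ae ?_
  filter_upwards [h.1, h'.1, ae_all_iff.2 fun j => AEEqFun.coeFn_add (f j) (f' j)] with x h1 h2 h3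
  rw [← h1.of_norm.tsum_add h2.of_norm]
  refine tsum_congr fun j => ?_
  rw [← mul_add, ← Pi.add_apply, ← h3 j]; rfl

theorem pairing_smul_left (c : ℂ) (g f : FunSeq n) : pairing (c • g) f = c * pairing g f := by
  rw [pairing, pairing, ← integral_const_mul]
  refine integral_congr_ae ?_
  filter_upwards [ae_all_iff.2 fun j => AEEqFun.coeFn_smul c (g j)] with x h3
  rw [← tsum_mul_left]
  refine tsum_congr fun j => ?_
  rw [← mul_assoc]
  exact congrArg (· * f j x) (h3 j)

theorem pairing_smul_right (c : ℂ) (g f : FunSeq n) : pairing g (c • f) = c * pairing g f := by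
  rw [pairing, pairing, ← integral_const_mul]
  refine integral_congr_ae ?_
  filter_upwards [ae_all_iff.2 fun j => AEEqFun.coeFn_smul c (f j)] with x h3
  rw [← tsum_mul_left]
  refine tsum_congr fun j => ?_
  rw [mul_left_comm]
  exact congrArg (g j x * ·) (h3 j)

theorem norm_pairing_le (hp : p.HolderConjugate p') (hq : q.HolderConjugate q')
    (h : PredualIndex n p' ρ) (hrρ : r + ρ = -(n : ℝ)) (g : PredualSeq n p' q' ρ h hq.symm.lt)
    (f : MorreySeqCirc n p q r hp.lt hq.lt) : ‖pairing g.1 f.1.1‖ ≤ ‖g‖ * ‖f‖ := by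
  have h1 := ENNReal.toReal_mono
    (ENNReal.mul_ne_top (PredualSeq.enorm_lt_top g).ne f.1.2.2.ne)
    (pairingConverges hp hq h hrρ g.2.2.1 (PredualSeq.enorm_lt_top g) f.1.2.2).2
  rwa [toReal_enorm, ENNReal.toReal_mul] at h1

/-- The functional on the closure of the test sequences given by the pairing. -/
noncomputable def pairingFunctional (hp : p.HolderConjugate p') (hq : q.HolderConjugate q')
    (h : PredualIndex n p' ρ) (hrρ : r + ρ = -(n : ℝ)) :
    PredualSeq n p' q' ρ h hq.symm.lt →ₗ[ℂ]
      StrongDual ℂ (MorreySeqCirc n p q r hp.lt hq.lt) :=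
  have H (g : PredualSeq n p' q' ρ h hq.symm.lt) (f : MorreySeqCirc n p q r hp.lt hq.lt) :=
    pairingConverges hp hq h hrρ g.2.2.1 (PredualSeq.enorm_lt_top g) f.1.2.2
  { toFun := fun g => LinearMap.mkContinuous
      { toFun := fun f => pairing g.1 f.1.1
        map_add' := fun f f' => pairing_add_right (H g f).1 (H g f').1
        map_smul' := fun c f => pairing_smul_right c g.1 f.1.1 } ‖g‖ fun f =>
          norm_pairing_le hp hq h hrρ g f
    map_add' := fun g g' => ContinuousLinearMap.ext fun f =>
      pairing_add_left (H g f).1 (H g' f).1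
    map_smul' := fun c g => ContinuousLinearMap.ext fun f => pairing_smul_left c g.1 f.1.1 }

theorem norm_pairingFunctional_le (hp : p.HolderConjugate p') (hq : q.HolderConjugate q')
    (h : PredualIndex n p' ρ) (hrρ : r + ρ = -(n : ℝ))
    (g : PredualSeq n p' q' ρ h hq.symm.lt) :
    ‖pairingFunctional hp hq h hrρ (r := r) g‖ ≤ ‖g‖ :=
  ContinuousLinearMap.opNorm_le_bound _ (norm_nonneg _) fun f => norm_pairing_le hp hq h hrρ g f

theorem pairingFunctional_apply (hp : p.HolderConjugate p') (hq : q.HolderConjugate q')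
    (h : PredualIndex n p' ρ) (hrρ : r + ρ = -(n : ℝ))
    (g : PredualSeq n p' q' ρ h hq.symm.lt) (f : MorreySeqCirc n p q r hp.lt hq.lt) :
    pairingFunctional hp hq h hrρ g f = pairing g.1 f.1.1 := rfl

/-! ### Lebesgue spaces inside Morrey spaces, and density of test sequences -/

/-- With `u = -n/r`, Hölder's inequality on a cube of scale `J` costs the factor `|Q|^(1/p - 1/u) =
2^((1-J)(n/p+r))`. The Morrey weight cancels the dependence on `J`; the remaining `2^(n/p+r)` comes
from the side length `2 · 2^(-J)`. -/
theorem morreyENorm_le_eLpNorm (hp : 1 < p) (hr : -(n : ℝ) / p < r) (hr0 : r < 0)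
    {F : Sp n → ℝ≥0∞} (hF : Measurable F) :
    morreyENorm p r F ≤ ENNReal.ofReal ((2 : ℝ) ^ ((n : ℝ) / p + r)) *
      eLpNorm F (ENNReal.ofReal (-(n : ℝ) / r)) volume := by
  have hp0 : 0 < p := by linarith
  have hn0 : (0 : ℝ) < n := by
    -- For `n = 0` the hypotheses become `0 < r` and `r < 0`.
    rcases Nat.eq_zero_or_pos n with rfl | hn
    · simp at hr; linarith
    · exact_mod_cast hn
  have hu0 : 0 < -(n : ℝ) / r := div_pos_of_neg_of_neg (by linarith) hr0
  have hpu : p ≤ -(n : ℝ) / r := by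
    rw [le_div_iff_of_neg hr0]
    rw [div_lt_iff₀ hp0] at hr
    linarith
  refine iSup_le fun i => ?_
  have h1 := eLpNorm_le_eLpNorm_mul_rpow_measure_univ (ENNReal.ofReal_le_ofReal hpu)
    (hF.aestronglyMeasurable (μ := volume.restrict (dyadicCube i)))
  rw [Measure.restrict_apply_univ, volume_dyadicCube, ENNReal.toReal_ofReal hu0.le,
    ENNReal.toReal_ofReal hp0.le, ENNReal.ofReal_rpow_of_pos (by positivity),
    ← Real.rpow_mul two_pos.le] at h1
  have h2 : (2 : ℝ) ^ ((n : ℝ) / p + r) = (2 : ℝ) ^ ((i.1 : ℝ) * ((n : ℝ) / p + r)) *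
      (2 : ℝ) ^ ((n : ℝ) * (1 - (i.1 : ℝ)) * (1 / p - 1 / (-(n : ℝ) / r))) := by
    rw [← Real.rpow_add two_pos]
    congr 1
    field_simp
    ring
  rw [h2, ENNReal.ofReal_mul (by positivity), mul_assoc]
  gcongr
  refine h1.trans ?_
  rw [mul_comm]
  gcongr
  exact Measure.restrict_le_self

theorem lebesgueSeqENorm_add_le {u : ℝ} (hu : 1 ≤ u) (hq : 1 < q) (f g : FunSeq n) :
    lebesgueSeqENorm u q (f + g) ≤ lebesgueSeqENorm u q f + lebesgueSeqENorm u q g :=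
  (eLpNorm_mono_enorm_ae (g := lqNorm q f + lqNorm q g)
    (by filter_upwards [lqNorm_add_le hq f g] with x hx using hx)).trans
    (eLpNorm_add_le (measurable_lqNorm q f).aestronglyMeasurable
      (measurable_lqNorm q g).aestronglyMeasurable
      (by simpa using ENNReal.ofReal_le_ofReal hu))

theorem lqNorm_le_sum (hq : 1 < q) {f : FunSeq n} {k : ℕ} (hf : ∀ j, k < j → f j = 0) :
    ∀ᵐ x, lqNorm q f x ≤ ∑ j ∈ Finset.range (k + 1), ‖f j x‖ₑ := by
  filter_upwards [AEEqFun.coeFn_zero (α := Sp n) (β := ℂ) (μ := volume)] with x hx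
  refine (ennreal_Lp_le_tsum hq.le _).trans (le_of_eq ?_)
  refine tsum_eq_sum fun j hj => ?_
  rw [hf j (by simpa [Nat.lt_succ_iff] using hj), hx]
  simp

theorem lebesgueSeqENorm_le_sum {u : ℝ} (hu : 1 ≤ u) (hq : 1 < q) {f : FunSeq n} {k : ℕ}
    (hf : ∀ j, k < j → f j = 0) :
    lebesgueSeqENorm u q f ≤
      ∑ j ∈ Finset.range (k + 1), eLpNorm (f j) (ENNReal.ofReal u) volume := by
  have h1 : 1 ≤ ENNReal.ofReal u := by simpa using ENNReal.ofReal_le_ofReal hu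
  refine (eLpNorm_mono_enorm_ae (g := ∑ j ∈ Finset.range (k + 1), fun x => ‖f j x‖ₑ) ?_).trans
    ((eLpNorm_sum_le (fun j _ => ?_) h1).trans (Finset.sum_le_sum fun j _ => ?_))
  · filter_upwards [lqNorm_le_sum hq hf] with x hx
    simpa using hx
  · exact (f j).stronglyMeasurable.measurable.enorm.aestronglyMeasurable
  · exact (eLpNorm_enorm _).le

/-- A finitely supported sequence of test functions. -/
def IsTestSeq (f : FunSeq n) : Prop := (∀ j, IsTestFun (f j)) ∧ ∃ k, ∀ j, k < j → f j = 0

theorem IsTestSeq.lebesgueSeqENorm_lt_top {u : ℝ} (hu : 1 ≤ u) (hq : 1 < q) {f : FunSeq n}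
    (hf : IsTestSeq f) : lebesgueSeqENorm u q f < ⊤ := by
  obtain ⟨h1, k, hk⟩ := hf
  refine (lebesgueSeqENorm_le_sum hu hq hk).trans_lt (ENNReal.sum_lt_top.2 fun j _ => ?_)
  obtain ⟨φ, hφ, hφc, e⟩ := h1 j
  rw [eLpNorm_congr_ae e]
  exact (hφ.continuous.memLp_of_hasCompactSupport hφc).2

/-- The truncation of a sequence to its first entries. -/
noncomputable def truncSeq (k : ℕ) (f : FunSeq n) : FunSeq n := fun j => if j ≤ k then f j else 0

/-- Dominated convergence: almost everywhere the full `ℓ_q` norm is finite, so the tails tend to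
zero, and its power `u` is an integrable majorant. -/
theorem tendsto_lebesgueSeqENorm_sub_truncSeq {u : ℝ} (hu : 1 ≤ u) (hq : 1 < q) {f : FunSeq n}
    (hf : lebesgueSeqENorm u q f < ⊤) :
    Tendsto (fun k => lebesgueSeqENorm u q (f - truncSeq k f)) atTop (𝓝 0) := by
  have hu0 : 0 < u := by linarith
  have hq0 : 0 < q := by linarith
  have hform : ∀ f : FunSeq n, lebesgueSeqENorm u q f = (∫⁻ x, lqNorm q f x ^ u) ^ (1 / u) := by
    intro f
    rw [lebesgueSeqENorm, eLpNorm_eq_lintegral_rpow_enorm_toReal (by simpa using hu0)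
      ENNReal.ofReal_ne_top, ENNReal.toReal_ofReal hu0.le]
    simp
  have hfin : ∫⁻ x, lqNorm q f x ^ u ≠ ⊤ := by
    rw [hform] at hf
    intro h
    rw [h, ENNReal.top_rpow_of_pos (by positivity)] at hf
    exact hf.ne rfl
  have hcoe : ∀ᵐ x, ∀ k j, (f - truncSeq k f) j x = if j ≤ k then 0 else f j x := by
    refine ae_all_iff.2 fun k => ae_all_iff.2 fun j => ?_
    have e : (f - truncSeq k f) j = if j ≤ k then 0 else f j := by
      by_cases hj : j ≤ k <;> simp [truncSeq, hj]
    rw [e]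
    by_cases hj : j ≤ k
    · simp only [hj, if_true]
      exact AEEqFun.coeFn_zero (α := Sp n) (β := ℂ) (μ := volume)
    · simp [hj]
  have hlim : Tendsto (fun k => ∫⁻ x, lqNorm q (f - truncSeq k f) x ^ u) atTop
      (𝓝 (∫⁻ _ : Sp n, 0)) := by
    refine tendsto_lintegral_of_dominated_convergence (fun x => lqNorm q f x ^ u)
      (fun k => (measurable_lqNorm q _).pow_const u) (fun k => ?_) hfin ?_
    · filter_upwards [hcoe] with x hx
      refine ENNReal.rpow_le_rpow (ENNReal.rpow_le_rpow (ENNReal.tsum_le_tsum fun j => ?_)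
        (by positivity)) hu0.le
      rw [hx]
      split_ifs
      · simp [hq0]
      · exact le_rfl
    · filter_upwards [hcoe, ae_lt_top ((measurable_lqNorm q f).pow_const u) hfin] with x hx hx'
      have h1 : ∑' j, ‖f j x‖ₑ ^ q ≠ ⊤ := by
        intro h
        rw [lqNorm, h, ENNReal.top_rpow_of_pos (by positivity),
          ENNReal.top_rpow_of_pos hu0] at hx'
        exact hx'.ne rfl
      -- The truncation keeps the `k + 1` entries with index at most `k`, so the tail is the
      -- complement of `range (k + 1)`.
      have h2 := (ENNReal.tendsto_tsum_compl_atTop_zero h1).comp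
        (tendsto_finset_range.comp (tendsto_add_atTop_nat 1))
      have h3 : ∀ k, lqNorm q (f - truncSeq k f) x =
          (∑' b : {j // j ∉ Finset.range (k + 1)}, ‖f b x‖ₑ ^ q) ^ (1 / q) := by
        intro k
        rw [lqNorm]
        congr 1
        have := tsum_subtype {j | j ∉ Finset.range (k + 1)} fun j => ‖f j x‖ₑ ^ q
        refine Eq.trans (tsum_congr fun j => ?_) this.symm
        rw [hx]
        by_cases hj : j ≤ k
        · simp [hj, hq0]
        · simp [hj, not_le.1 hj]
      simp_rw [h3]
      have h4 := (((ENNReal.continuous_rpow_const (y := u)).comp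
        (ENNReal.continuous_rpow_const (y := 1 / q))).tendsto 0).comp h2
      simpa [Function.comp_def, hq0, hu0] using h4
  rw [lintegral_zero] at hlim
  simp_rw [hform]
  have h5 := ((ENNReal.continuous_rpow_const (y := 1 / u)).tendsto 0).comp hlim
  simpa [Function.comp_def, hu0] using h5

/-- Test functions are dense in `L_u`. Each of the `k + 1` retained entries is approximated up to `ε
/ (k + 1)`, and the `ℓ_q` norm is at most the sum of the entries. -/
theorem exists_test_approx {u : ℝ} (hu : 1 ≤ u) (hq : 1 < q) {f : FunSeq n}
    (hf : lebesgueSeqENorm u q f < ⊤) (k : ℕ) {ε : ℝ} (hε : 0 < ε) :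
    ∃ φ : FunSeq n, (∀ j, IsTestFun (φ j)) ∧ (∀ j, k < j → φ j = 0) ∧
      lebesgueSeqENorm u q (truncSeq k f - φ) ≤ ENNReal.ofReal ε := by
  have h1 : 1 ≤ ENNReal.ofReal u := by simpa using ENNReal.ofReal_le_ofReal hu
  have hmem : ∀ j, MemLp (f j) (ENNReal.ofReal u) volume := fun j =>
    ⟨(f j).aestronglyMeasurable, (eLpNorm_mono_enorm (g := lqNorm q f) fun x =>
      enorm_le_lqNorm hq f j x).trans_lt hf⟩
  have hδ : 0 < ε / (k + 1) := by positivity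
  choose g hg1 hg2 hg3 using fun j => MemLp.exist_eLpNorm_sub_le ENNReal.ofReal_ne_top h1
    (hmem j) hδ
  have hgm : ∀ j, AEStronglyMeasurable (g j) volume := fun j =>
    (hg2 j).continuous.aestronglyMeasurable
  refine ⟨fun j => if j ≤ k then AEEqFun.mk (g j) (hgm j) else 0, fun j => ?_, fun j hj => ?_, ?_⟩
  · dsimp only
    split_ifs
    · exact ⟨g j, hg2 j, hg1 j, AEEqFun.coeFn_mk _ _⟩
    · exact IsTestFun.zero
  · simp [not_le.2 hj]
  · refine (lebesgueSeqENorm_le_sum hu hq (k := k) fun j hj => ?_).trans ?_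
    · simp [truncSeq, not_le.2 hj]
    · calc _ ≤ ∑ j ∈ Finset.range (k + 1), ENNReal.ofReal (ε / (k + 1)) := by
            refine Finset.sum_le_sum fun j hj => ?_
            have hj' : j ≤ k := by simpa [Nat.lt_succ_iff] using hj
            simp only [Pi.sub_apply, truncSeq, hj', if_true]
            refine le_trans (le_of_eq (eLpNorm_congr_ae ?_)) (hg3 j)
            exact (AEEqFun.coeFn_sub _ _).trans ((EventuallyEq.refl _ _).sub
              (AEEqFun.coeFn_mk _ _))
        _ = ENNReal.ofReal ε := by
            rw [Finset.sum_const, Finset.card_range, ← ENNReal.ofReal_nsmul, nsmul_eq_mul]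
            congr 1
            push_cast
            field_simp

theorem one_le_lebesgueExponent (hp : 1 < p) (hr : -(n : ℝ) / p < r) (hr0 : r < 0) :
    1 ≤ -(n : ℝ) / r := by
  rw [le_div_iff_of_neg hr0]
  rw [div_lt_iff₀ (by linarith)] at hr
  nlinarith

theorem lebesgueSeq_embedding (hp : 1 < p) (hq : 1 < q) (hr : -(n : ℝ) / p < r) (hr0 : r < 0)
    {f : FunSeq n} (hf : lebesgueSeqENorm (-(n : ℝ) / r) q f < ⊤) :
    ∃ hf : f ∈ MorreySeq n p q r hp hq, ⟨f, hf⟩ ∈ MorreySeqCirc n p q r hp hq := by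
  have hu := one_le_lebesgueExponent hp hr hr0
  have hle : ∀ f : FunSeq n, morreySeqENorm p q r f ≤
      ENNReal.ofReal ((2 : ℝ) ^ ((n : ℝ) / p + r)) * lebesgueSeqENorm (-(n : ℝ) / r) q f :=
    fun f => morreyENorm_le_eLpNorm hp hr hr0 (measurable_lqNorm q f)
  have h1 : morreySeqENorm p q r f < ⊤ :=
    (hle f).trans_lt (ENNReal.mul_lt_top ENNReal.ofReal_lt_top hf)
  refine ⟨⟨fun j => (morreyENorm_mono (G := lqNorm q f)
    (Eventually.of_forall fun x => enorm_le_lqNorm hq _ j x)).trans_lt h1, h1⟩, ?_⟩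
  -- Diagonal choice: the test sequence of index `k` approximates the truncation of index `k` up to
  -- `1 / (k + 1)`, so both errors vanish together.
  choose φ hφ1 hφ2 hφ3 using fun k : ℕ =>
    exists_test_approx hu hq hf k (ε := 1 / ((k : ℝ) + 1)) (by positivity)
  refine ⟨φ, hφ1, hφ2, ?_⟩
  have h2 : Tendsto (fun k : ℕ => ENNReal.ofReal ((2 : ℝ) ^ ((n : ℝ) / p + r)) *
      (lebesgueSeqENorm (-(n : ℝ) / r) q (f - truncSeq k f) +
        ENNReal.ofReal (1 / ((k : ℝ) + 1)))) atTop (𝓝 0) := by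
    have h3 := (tendsto_lebesgueSeqENorm_sub_truncSeq hu hq hf).add
      ((ENNReal.continuous_ofReal.tendsto 0).comp tendsto_one_div_add_atTop_nhds_zero_nat)
    have h4 := ENNReal.Tendsto.const_mul (a := ENNReal.ofReal ((2 : ℝ) ^ ((n : ℝ) / p + r))) h3
      (Or.inr ENNReal.ofReal_ne_top)
    simpa using h4
  refine tendsto_of_tendsto_of_tendsto_of_le_of_le tendsto_const_nhds h2
    (fun _ => zero_le) fun k => (hle _).trans ?_
  gcongr
  refine le_trans ?_ ((lebesgueSeqENorm_add_le hu hq _ _).trans (add_le_add le_rfl (hφ3 k)))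
  rw [sub_add_sub_cancel]

/-- The approximants in the definition of the closure lie in some Lebesgue space, hence are
themselves elements of the closure. The test sequences are therefore dense in it, and continuity
suffices. -/
theorem MorreySeqCirc.ext_isTestSeq (hp : 1 < p) (hq : 1 < q) (hr : -(n : ℝ) / p < r)
    (hr0 : r < 0) {G G' : StrongDual ℂ (MorreySeqCirc n p q r hp hq)}
    (h : ∀ f : MorreySeqCirc n p q r hp hq, IsTestSeq f.1.1 → G f = G' f) : G = G' := by
  ext f
  obtain ⟨φ, h1, h2, h3⟩ := f.2
  have ht : ∀ k, IsTestSeq (φ k) := fun k => ⟨h1 k, k, h2 k⟩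
  choose hφ hφ' using fun k => lebesgueSeq_embedding (f := φ k) hp hq hr hr0
    ((ht k).lebesgueSeqENorm_lt_top (one_le_lebesgueExponent hp hr hr0) hq)
  set Φ : ℕ → MorreySeqCirc n p q r hp hq := fun k => ⟨⟨φ k, hφ k⟩, hφ' k⟩
  have hlim : Tendsto Φ atTop (𝓝 f) := by
    rw [tendsto_iff_norm_sub_tendsto_zero]
    have h4 := (ENNReal.tendsto_toReal ENNReal.zero_ne_top).comp h3
    refine h4.congr fun k => ?_
    rw [norm_sub_rev]
    rfl
  refine tendsto_nhds_unique ((G.continuous.tendsto f).comp hlim) ?_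
  refine ((G'.continuous.tendsto f).comp hlim).congr fun k => ?_
  exact (h (Φ k) (ht k)).symm

/-! ### Densities of functionals on Lebesgue spaces -/

section Density

variable {α : Type*} [MeasurableSpace α] {μ : Measure α} {p : ℝ≥0∞}

theorem memLp_of_bounded_of_support {f : α → ℂ} (hf : Measurable f) {Q : Set α}
    (hQ : MeasurableSet Q) (hμQ : μ Q ≠ ⊤) (h0 : ∀ x ∉ Q, f x = 0) {M : ℝ}
    (hM : ∀ x, ‖f x‖ ≤ M) : MemLp f p μ := by
  have : IsFiniteMeasure (μ.restrict Q) := ⟨by simpa using hμQ.lt_top⟩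
  have h1 : Q.indicator f = f := by
    funext x
    by_cases hx : x ∈ Q <;> simp [hx, h0]
  rw [← h1, memLp_indicator_iff_restrict hQ]
  exact MemLp.of_bound hf.aestronglyMeasurable M (Eventually.of_forall hM)

/-- Countable additivity of `s ↦ 1_s` with values in `L_p`: a partial union differs from the whole
union by a set whose measure is the tail of a convergent series. This needs `p ≠ ∞`. -/
theorem hasSum_indicatorConstLp [Fact (1 ≤ p)] (hp : p ≠ ⊤) {s : ℕ → Set α}
    (hs : ∀ i, MeasurableSet (s i)) (hd : Pairwise (Function.onFun Disjoint s))
    (hμ : μ (⋃ i, s i) ≠ ⊤) (hμ' : ∀ i, μ (s i) ≠ ⊤) :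
    HasSum (fun i => indicatorConstLp p (hs i) (hμ' i) (1 : ℂ))
      (indicatorConstLp p (MeasurableSet.iUnion hs) hμ (1 : ℂ)) := by
  have hsub : ∀ t : Finset ℕ, (⋃ i ∈ t, s i) ⊆ ⋃ i, s i := fun t =>
    Set.iUnion₂_subset fun i _ => Set.subset_iUnion s i
  have ht : ∀ t : Finset ℕ, MeasurableSet (⋃ i ∈ t, s i) := fun t =>
    t.measurableSet_biUnion fun i _ => hs i
  have hμt : ∀ t : Finset ℕ, μ (⋃ i ∈ t, s i) ≠ ⊤ := fun t =>
    ((measure_mono (hsub t)).trans_lt hμ.lt_top).ne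
  have h1 : ∀ t : Finset ℕ, ∑ i ∈ t, indicatorConstLp p (hs i) (hμ' i) (1 : ℂ) =
      indicatorConstLp p (ht t) (hμt t) 1 := by
    intro t
    apply Lp.ext
    refine (Lp.coeFn_fun_finsetSum t _).trans ?_
    have h2 : ∀ᵐ x ∂μ, ∀ i, indicatorConstLp p (hs i) (hμ' i) (1 : ℂ) x =
        (s i).indicator (fun _ => 1) x := ae_all_iff.2 fun i => indicatorConstLp_coeFn
    filter_upwards [h2, indicatorConstLp_coeFn (p := p) (hs := ht t) (hμs := hμt t)
      (c := (1 : ℂ))] with x hx hx'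
    rw [hx', Finset.sum_congr rfl fun i _ => hx i]
    by_cases hxt : x ∈ ⋃ i ∈ t, s i
    · obtain ⟨i, hi, hxi⟩ := Set.mem_iUnion₂.1 hxt
      rw [Set.indicator_of_mem hxt, Finset.sum_eq_single_of_mem i hi, Set.indicator_of_mem hxi]
      intro j _ hji
      exact Set.indicator_of_notMem (fun hxj => Set.disjoint_left.1 (hd hji) hxj hxi) _
    · rw [Set.indicator_of_notMem hxt]
      refine Finset.sum_eq_zero fun i hi => Set.indicator_of_notMem (fun hxi => hxt ?_) _
      exact Set.mem_iUnion₂.2 ⟨i, hi, hxi⟩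
  rw [HasSum]
  simp_rw [h1]
  refine tendsto_indicatorConstLp_set hp ?_
  have h3 : ∀ t : Finset ℕ, μ (symmDiff (⋃ i ∈ t, s i) (⋃ i, s i)) =
      μ (⋃ i, s i) - ∑ i ∈ t, μ (s i) := by
    intro t
    rw [symmDiff_of_le (hsub t), measure_sdiff (hsub t) (ht t).nullMeasurableSet (hμt t),
      measure_biUnion_finset (fun i _ j _ hij => hd hij) fun i _ => hs i]
  simp only [SummationFilter.unconditional_filter]
  simp_rw [h3, measure_iUnion hd hs]
  rw [measure_iUnion hd hs] at hμ
  have h4 := ENNReal.Tendsto.sub (tendsto_const_nhds (x := ∑' i, μ (s i)) (f := atTop))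
    (ENNReal.summable.hasSum : HasSum (fun i => μ (s i)) _) (Or.inl hμ)
  simpa using h4

/-- The real Radon–Nikodym theorem, applied to the real and imaginary parts. -/
theorem exists_density_complexMeasure {ν : Measure α} [IsFiniteMeasure ν] (m : ComplexMeasure α)
    (h : m ≪ᵥ ν.toENNRealVectorMeasure) : ∃ g : α → ℂ, Measurable g ∧ Integrable g ν ∧
      ∀ s, MeasurableSet s → m s = ∫ x in s, g x ∂ν := by
  rw [ComplexMeasure.absolutelyContinuous_ennreal_iff] at h
  have key : ∀ t : SignedMeasure α, t ≪ᵥ ν.toENNRealVectorMeasure →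
      ∃ a : α → ℝ, Measurable a ∧ Integrable a ν ∧ ν.withDensityᵥ a = t := fun t ht =>
    ⟨t.rnDeriv ν, SignedMeasure.measurable_rnDeriv _ _, SignedMeasure.integrable_rnDeriv _ _,
      SignedMeasure.withDensityᵥ_rnDeriv_eq _ _ ht⟩
  obtain ⟨a, ham, hai, hae⟩ := key _ h.1
  obtain ⟨b, hbm, hbi, hbe⟩ := key _ h.2
  refine ⟨fun x => (a x : ℂ) + (b x : ℂ) * Complex.I, by fun_prop,
    hai.ofReal.add (hbi.ofReal.mul_const _), fun s hs => ?_⟩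
  have h1 : (m s).re = ∫ x in s, a x ∂ν := by
    rw [← withDensityᵥ_apply hai hs, hae]; rfl
  have h2 : (m s).im = ∫ x in s, b x ∂ν := by
    rw [← withDensityᵥ_apply hbi hs, hbe]; rfl
  have h3 : ∫ x in s, ((a x : ℂ) + (b x : ℂ) * Complex.I) ∂ν =
      (∫ x in s, (a x : ℂ) ∂ν) + ∫ x in s, (b x : ℂ) * Complex.I ∂ν :=
    integral_add hai.ofReal.restrict (hbi.ofReal.mul_const _).restrict
  have h4 : ∫ x in s, (a x : ℂ) ∂ν = ((m s).re : ℂ) := by rw [h1]; exact integral_ofReal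
  have h5 : ∫ x in s, (b x : ℂ) ∂ν = ((m s).im : ℂ) := by rw [h2]; exact integral_ofReal
  rw [h3, integral_mul_const, h4, h5, Complex.re_add_im]

/-- The set function `s ↦ Λ(1_{s ∩ Q})` is a complex measure, by continuity of `Λ`, and it vanishes
on null sets, so it has a density. Cutting with `Q` of finite measure keeps every indicator in
`L_p`. -/
theorem exists_density_sets [Fact (1 ≤ p)] (hp : p ≠ ⊤) (Λ : Lp ℂ p μ →L[ℂ] ℂ) {Q : Set α}
    (hQ : MeasurableSet Q) (hμQ : μ Q ≠ ⊤) (hfin : ∀ s : Set α, μ (s ∩ Q) ≠ ⊤) :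
    ∃ g : α → ℂ, Measurable g ∧ Integrable g (μ.restrict Q) ∧
      ∀ s (h : MeasurableSet s), Λ (indicatorConstLp p (h.inter hQ) (hfin s) 1) =
        ∫ x in s, g x ∂(μ.restrict Q) := by
  classical
  have : IsFiniteMeasure (μ.restrict Q) := ⟨by simpa using hμQ.lt_top⟩
  let m : ComplexMeasure α :=
    { measureOf' := fun s => if h : MeasurableSet s then
        Λ (indicatorConstLp p (h.inter hQ) (hfin s) 1) else 0
      empty' := by
        have : indicatorConstLp p (MeasurableSet.empty.inter hQ) (hfin ∅) (1 : ℂ) = 0 := by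
          have := indicatorConstLp_empty (p := p) (μ := μ) (c := (1 : ℂ))
          simpa only [Set.empty_inter] using this
        simp only [MeasurableSet.empty, dif_pos, this, map_zero]
      not_measurable' := fun s h => dif_neg h
      m_iUnion' := fun s hs hd => by
        have h1 : ∀ i, MeasurableSet (s i ∩ Q) := fun i => (hs i).inter hQ
        have h2 := hasSum_indicatorConstLp (p := p) hp h1
          (fun i j hij => (hd hij).mono Set.inter_subset_left Set.inter_subset_left)
          (by rw [← Set.iUnion_inter]; exact hfin _) (fun i => hfin _)
        simp only [← Set.iUnion_inter] at h2
        have h3 := h2.mapL Λ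
        simpa only [hs, MeasurableSet.iUnion hs, dif_pos] using h3 }
  have hm : ∀ s (h : MeasurableSet s), m s = Λ (indicatorConstLp p (h.inter hQ) (hfin s) 1) :=
    fun s h => dif_pos h
  have hac : m ≪ᵥ (μ.restrict Q).toENNRealVectorMeasure := by
    intro s hs
    by_cases h : MeasurableSet s
    · rw [Measure.toENNRealVectorMeasure_apply_measurable h, Measure.restrict_apply h] at hs
      rw [hm s h]
      have : indicatorConstLp p (h.inter hQ) (hfin s) (1 : ℂ) = 0 := by
        rw [← norm_eq_zero, norm_indicatorConstLp
          (zero_lt_one.trans_le (Fact.out : 1 ≤ p)).ne' hp, measureReal_def, hs]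
        have := ENNReal.toReal_pos (zero_lt_one.trans_le (Fact.out : 1 ≤ p)).ne' hp
        simp [this.ne']
      rw [this, map_zero]
    · exact m.not_measurable h
  obtain ⟨g, hg, hgi, hgs⟩ := exists_density_complexMeasure m hac
  exact ⟨g, hg, hgi, fun s h => (hm s h).symm.trans (hgs s h)⟩

/-- Linearity passes from sets to simple functions, dominated convergence from there to bounded
functions. Integrability of `g` is enough at this stage: its `L_{p'}` bound comes later, from
testing with bounded extremal functions. -/
theorem exists_density [Fact (1 ≤ p)] (hp : p ≠ ⊤) (Λ : Lp ℂ p μ →L[ℂ] ℂ) {Q : Set α}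
    (hQ : MeasurableSet Q) (hμQ : μ Q ≠ ⊤) :
    ∃ g : α → ℂ, Measurable g ∧ Integrable g μ ∧ (∀ x ∉ Q, g x = 0) ∧
      ∀ (f : α → ℂ) (hf : MemLp f p μ), Measurable f → (∀ x ∉ Q, f x = 0) →
        (∃ M, ∀ x, ‖f x‖ ≤ M) → Λ (hf.toLp f) = ∫ x, g x * f x ∂μ := by
  have : IsFiniteMeasure (μ.restrict Q) := ⟨by simpa using hμQ.lt_top⟩
  have hfin : ∀ s : Set α, μ (s ∩ Q) ≠ ⊤ := fun s =>
    ((measure_mono Set.inter_subset_right).trans_lt hμQ.lt_top).ne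
  obtain ⟨g₀, hg₀m, hg₀i, hset⟩ := exists_density_sets hp Λ hQ hμQ hfin
  have hsimple : ∀ (f : SimpleFunc α ℂ) (hf : MemLp (Q.indicator f) p μ),
      Λ (hf.toLp _) = ∫ x in Q, g₀ x * f x ∂μ := by
    have hmem : ∀ f : SimpleFunc α ℂ, MemLp (Q.indicator f) p μ := by
      intro f
      obtain ⟨C, hC⟩ := f.exists_forall_norm_le
      refine memLp_of_bounded_of_support (f.measurable.indicator hQ) hQ hμQ
        (fun x hx => Set.indicator_of_notMem hx _) (M := C) fun x => ?_
      exact (norm_indicator_le_norm_self _ _).trans (hC x)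
    have hint : ∀ f : SimpleFunc α ℂ, Integrable (fun x => g₀ x * f x) (μ.restrict Q) := by
      intro f
      obtain ⟨C, hC⟩ := f.exists_forall_norm_le
      exact hg₀i.mul_bdd (c := C) f.aestronglyMeasurable (Eventually.of_forall hC)
    intro f
    induction f using SimpleFunc.induction with
    | const c hs =>
      rename_i s
      intro hf
      have h1 : hf.toLp _ = c • indicatorConstLp p (hs.inter hQ) (hfin s) (1 : ℂ) := by
        apply Lp.ext
        filter_upwards [hf.coeFn_toLp, Lp.coeFn_smul c
          (indicatorConstLp p (hs.inter hQ) (hfin s) (1 : ℂ)),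
          indicatorConstLp_coeFn (p := p) (hs := hs.inter hQ) (hμs := hfin s) (c := (1 : ℂ))]
          with x h1 h2 h3
        rw [h1, h2, Pi.smul_apply, h3]
        by_cases hxQ : x ∈ Q <;> by_cases hxs : x ∈ s <;> simp [hxQ, hxs]
      rw [h1, map_smul, hset s hs, smul_eq_mul, ← integral_const_mul,
        ← integral_indicator hs]
      refine integral_congr_ae (Eventually.of_forall fun x => ?_)
      by_cases hxs : x ∈ s <;> simp [hxs, mul_comm]
    | add hd ih ih' =>
      rename_i f f'
      intro hf
      have h1 : hf.toLp _ = (hmem f).toLp _ + (hmem f').toLp _ := by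
        rw [← MemLp.toLp_add]
        refine MemLp.toLp_congr _ _ (Eventually.of_forall fun x => ?_)
        by_cases hxQ : x ∈ Q <;> simp [hxQ]
      rw [h1, map_add, ih (hmem f), ih' (hmem f'), ← integral_add (hint f) (hint f')]
      refine integral_congr_ae (Eventually.of_forall fun x => ?_)
      simp [mul_add]
  refine ⟨Q.indicator g₀, hg₀m.indicator hQ, (integrable_indicator_iff hQ).2 hg₀i,
    fun x hx => Set.indicator_of_notMem hx _, fun f hf hfm h0 ⟨M, hM⟩ => ?_⟩
  have hint : ∫ x, Q.indicator g₀ x * f x ∂μ = ∫ x in Q, g₀ x * f x ∂μ := by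
    rw [← integral_indicator hQ]
    refine integral_congr_ae (Eventually.of_forall fun x => ?_)
    by_cases hx : x ∈ Q <;> simp [hx]
  rw [hint]
  -- Approximation with base value `0` keeps `‖F k‖ ≤ 2 ‖f‖`. Hence the `F k` vanish outside `Q`,
  -- and `2 M ‖g₀‖` is an integrable majorant.
  set F : ℕ → SimpleFunc α ℂ := fun k =>
    SimpleFunc.approxOn f hfm (Set.range f ∪ {0}) 0 (by simp) k with hF
  have hFb : ∀ k x, ‖F k x‖ ≤ ‖f x‖ + ‖f x‖ := fun k x =>
    SimpleFunc.norm_approxOn_zero_le hfm _ x k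
  have hFQ : ∀ k, Q.indicator (F k) = F k := by
    intro k
    funext x
    by_cases hx : x ∈ Q
    · simp [hx]
    · have := hFb k x
      rw [h0 x hx, norm_zero, add_zero] at this
      rw [Set.indicator_of_notMem hx, norm_le_zero_iff.1 this]
  have hlim := (Λ.continuous.tendsto _).comp (SimpleFunc.tendsto_approxOn_range_Lp hp hfm hf)
  refine tendsto_nhds_unique hlim ?_
  have hlim' : Tendsto (fun k => ∫ x in Q, g₀ x * F k x ∂μ) atTop
      (𝓝 (∫ x in Q, g₀ x * f x ∂μ)) := by
    refine tendsto_integral_of_dominated_convergence (fun x => ‖g₀ x‖ * (M + M))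
      (fun k => (hg₀m.mul (F k).measurable).aestronglyMeasurable) (hg₀i.norm.mul_const _)
      (fun k => Eventually.of_forall fun x => ?_) (Eventually.of_forall fun x => ?_)
    · rw [norm_mul]
      gcongr
      exact (hFb k x).trans (add_le_add (hM x) (hM x))
    · exact (SimpleFunc.tendsto_approxOn hfm _ (subset_closure (by simp))).const_mul _
  refine hlim'.congr fun k => ?_
  have h1 : MemLp (Q.indicator (F k)) p μ := by
    rw [hFQ]; exact SimpleFunc.memLp_approxOn_range hfm hf k
  rw [← hsimple (F k) h1, Function.comp_apply]
  congr 1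
  exact MemLp.toLp_congr _ _ (Eventually.of_forall fun x => by rw [hFQ])

end Density

/-! ### Extremal functions for the mixed Hölder inequality -/

section Extremal

variable {p p' q q' : ℝ}

/-- The `ℓ_q` norm of the first `N` entries of a complex sequence. -/
noncomputable def finLq (q : ℝ) (N : ℕ) (z : ℕ → ℂ) : ℝ :=
  (∑ j ∈ Finset.range N, ‖z j‖ ^ q) ^ (1 / q)

/-- The extremal sequence in Hölder's inequality for the `ℓ_q'` norm, scaled such that its `ℓ_q`
norm is the power `p' - 1` of the `ℓ_q'` norm of the given sequence. -/
noncomputable def extremalSeq (p' q' : ℝ) (N : ℕ) (z : ℕ → ℂ) (j : ℕ) : ℂ :=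
  if j < N then (starRingEnd ℂ) (z j) *
    ((‖z j‖ ^ (q' - 2) * finLq q' N z ^ (p' - q') : ℝ) : ℂ) else 0

theorem finLq_nonneg (q : ℝ) (N : ℕ) (z : ℕ → ℂ) : 0 ≤ finLq q N z := by
  unfold finLq; positivity

theorem finLq_rpow (hq : 0 < q) (N : ℕ) (z : ℕ → ℂ) :
    finLq q N z ^ q = ∑ j ∈ Finset.range N, ‖z j‖ ^ q := by
  rw [finLq, ← Real.rpow_mul (by positivity), one_div_mul_cancel hq.ne', Real.rpow_one]

theorem norm_le_finLq (hq : 0 < q) {N : ℕ} (z : ℕ → ℂ) {j : ℕ} (hj : j < N) :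
    ‖z j‖ ≤ finLq q N z := by
  rw [← Real.rpow_le_rpow_iff (norm_nonneg _) (finLq_nonneg _ _ _) hq, finLq_rpow hq]
  exact Finset.single_le_sum (f := fun j => ‖z j‖ ^ q) (fun i _ => by positivity)
    (Finset.mem_range.2 hj)

theorem ofReal_finLq (hq : 0 < q) (N : ℕ) (z : ℕ → ℂ) :
    ENNReal.ofReal (finLq q N z) = (∑ j ∈ Finset.range N, ‖z j‖ₑ ^ q) ^ (1 / q) := by
  rw [finLq, ← ENNReal.ofReal_rpow_of_nonneg (by positivity) (by positivity),
    ENNReal.ofReal_sum_of_nonneg (fun i _ => by positivity)]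
  congr 1
  refine Finset.sum_congr rfl fun j _ => ?_
  rw [← ENNReal.ofReal_rpow_of_nonneg (norm_nonneg _) hq.le, ofReal_norm]

theorem mul_extremalSeq (hp : 1 < p') (hq : 1 < q') (N : ℕ) (z : ℕ → ℂ) :
    ∑ j ∈ Finset.range N, z j * extremalSeq p' q' N z j = ((finLq q' N z ^ p' : ℝ) : ℂ) := by
  have hH := finLq_nonneg q' N z
  have h1 : ∀ j ∈ Finset.range N, z j * extremalSeq p' q' N z j =
      ((‖z j‖ ^ q' * finLq q' N z ^ (p' - q') : ℝ) : ℂ) := by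
    intro j hj
    rw [extremalSeq, if_pos (Finset.mem_range.1 hj), ← mul_assoc, Complex.mul_conj,
      Complex.normSq_eq_norm_sq, ← Complex.ofReal_mul]
    congr 1
    -- The exponent `q' - 2` may be negative, so powers of `‖z j‖` are merged only where the base is
    -- positive.
    rcases eq_or_ne (z j) 0 with h0 | h0
    · simp [h0, (by linarith : q' ≠ 0)]
    · have : 0 < ‖z j‖ := norm_pos_iff.2 h0
      rw [← mul_assoc, ← Real.rpow_two, ← Real.rpow_add this]
      congr 2
      ring
  rw [Finset.sum_congr rfl h1, ← Complex.ofReal_sum, ← Finset.sum_mul,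
    ← finLq_rpow (by linarith : 0 < q')]
  congr 1
  rcases hH.eq_or_lt with h0 | h0
  · rw [← h0, Real.zero_rpow (show q' ≠ 0 by linarith), zero_mul,
      Real.zero_rpow (show p' ≠ 0 by linarith)]
  · rw [← Real.rpow_add h0]; congr 1; ring

theorem norm_extremalSeq {N : ℕ} (hq : 1 < q') (z : ℕ → ℂ) {j : ℕ} (hj : j < N) :
    ‖extremalSeq p' q' N z j‖ = ‖z j‖ ^ (q' - 1) * finLq q' N z ^ (p' - q') := by
  have hH := finLq_nonneg q' N z
  rw [extremalSeq, if_pos hj, norm_mul, RCLike.norm_conj, Complex.norm_real,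
    Real.norm_of_nonneg (by positivity), ← mul_assoc]
  congr 1
  rcases eq_or_ne (z j) 0 with h0 | h0
  · simp [h0, (by linarith : q' - 1 ≠ 0)]
  · have : 0 < ‖z j‖ := norm_pos_iff.2 h0
    rw [← Real.rpow_one_add' this.le (by linarith)]
    congr 1; ring

/-- After raising to the power `q`, this is exponent arithmetic: `(q' - 1) q = q'` for the entries
and `q' + (p' - q') q = (p' - 1) q` for the total, both from `q q' = q + q'`. -/
theorem finLq_extremalSeq (hp : 1 < p') (hq : q.HolderConjugate q') (N : ℕ) (z : ℕ → ℂ) :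
    finLq q N (extremalSeq p' q' N z) = finLq q' N z ^ (p' - 1) := by
  have hq0 := hq.pos
  have hq1 := hq.symm.lt
  have hH := finLq_nonneg q' N z
  rw [← Real.rpow_left_inj (finLq_nonneg _ _ _) (Real.rpow_nonneg hH _) hq0.ne',
    finLq_rpow hq0]
  have h1 : ∀ j ∈ Finset.range N, ‖extremalSeq p' q' N z j‖ ^ q =
      ‖z j‖ ^ q' * (finLq q' N z ^ (p' - q')) ^ q := by
    intro j hj
    rw [norm_extremalSeq hq1 z (Finset.mem_range.1 hj), Real.mul_rpow (by positivity)
      (by positivity), ← Real.rpow_mul (norm_nonneg _)]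
    congr 2
    exact hq.symm.sub_one_mul_conj
  rw [Finset.sum_congr rfl h1, ← Finset.sum_mul, ← finLq_rpow (by linarith : 0 < q'),
    ← Real.rpow_mul hH, ← Real.rpow_mul hH]
  have h2 := hq.mul_eq_add
  rcases hH.eq_or_lt with h0 | h0
  · rw [← h0, Real.zero_rpow (show q' ≠ 0 by linarith), zero_mul,
      Real.zero_rpow (mul_pos (by linarith) hq0).ne']
  · rw [← Real.rpow_add h0]; congr 1; linarith

theorem finLq_const_mul (hq : 0 < q) {c : ℝ} (hc : 0 ≤ c) (N : ℕ) (z : ℕ → ℂ) :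
    finLq q N (fun j => (c : ℂ) * z j) = c * finLq q N z := by
  rw [← Real.rpow_left_inj (finLq_nonneg _ _ _)
    (mul_nonneg hc (finLq_nonneg _ _ _)) hq.ne', finLq_rpow hq,
    Real.mul_rpow hc (finLq_nonneg _ _ _), finLq_rpow hq, Finset.mul_sum]
  refine Finset.sum_congr rfl fun j _ => ?_
  rw [norm_mul, Complex.norm_real, Real.norm_of_nonneg hc, Real.mul_rpow hc (norm_nonneg _)]

variable {α : Type*} [MeasurableSpace α] {μ : Measure α}

theorem measurable_finLq {q : ℝ} {N : ℕ} {g : ℕ → α → ℂ} (hg : ∀ j, Measurable (g j)) :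
    Measurable fun x => finLq q N fun j => g j x := by
  unfold finLq
  have : ∀ j, Measurable fun x => ‖g j x‖ ^ q := fun j => (hg j).norm.pow_const q
  exact (Finset.measurable_sum _ fun j _ => this j).pow_const _

theorem measurable_extremalSeq {N : ℕ} {g : ℕ → α → ℂ} (hg : ∀ j, Measurable (g j)) (j : ℕ) :
    Measurable fun x => extremalSeq p' q' N (fun j => g j x) j := by
  unfold extremalSeq
  split_ifs
  · exact (Complex.continuous_conj.measurable.comp (hg j)).mul
      (Complex.measurable_ofReal.comp (((hg j).norm.pow_const _).mul
        ((measurable_finLq hg).pow_const _)))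
  · exact measurable_const

/-- Finitely many bounded functions, vanishing outside a given set and with mixed norm at
most one. -/
structure IsAdmissible (p q : ℝ) (μ : Measure α) (Q : Set α) (N : ℕ) (f : ℕ → α → ℂ) : Prop where
  measurable : ∀ j, Measurable (f j)
  bounded : ∃ M, ∀ j x, ‖f j x‖ ≤ M
  support : ∀ j, ∀ x ∉ Q, f j x = 0
  eq_zero : ∀ j, N ≤ j → f j = 0
  norm_le : eLpNorm (fun x => (∑' j, ‖f j x‖ₑ ^ q) ^ (1 / q)) (ENNReal.ofReal p) μ ≤ 1

/-- Let `H` be the pointwise `ℓ_{q'}` norm of the first `N` entries and `I = ∫ H^{p'}`. The extremal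
sequence scaled by `c = I^(-1/p)` has `ℓ_q` norm `c H^(p'-1)`, whose power `p` is `H^{p'} / I` and
integrates to one. The pairing is `c I = I^(1/p')`, the mixed norm of `g`. Boundedness and the set
`Q` of finite measure make all integrals finite. -/
theorem exists_extremal_of_bounded (hp : p.HolderConjugate p') (hq : q.HolderConjugate q')
    {Q : Set α} (hQ : MeasurableSet Q) (hμQ : μ Q ≠ ⊤) (N : ℕ) {g : ℕ → α → ℂ}
    (hg : ∀ j, Measurable (g j)) (h0 : ∀ j, ∀ x ∉ Q, g j x = 0) {M : ℝ}
    (hM : ∀ j x, ‖g j x‖ ≤ M) :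
    ∃ f : ℕ → α → ℂ, IsAdmissible p q μ Q N f ∧ (∀ j x, g j x = 0 → f j x = 0) ∧
      ∃ s : ℝ, 0 ≤ s ∧ ∑ j ∈ Finset.range N, ∫ x, g j x * f j x ∂μ = s ∧
        ENNReal.ofReal s = eLpNorm (fun x => (∑ j ∈ Finset.range N, ‖g j x‖ₑ ^ q') ^ (1 / q'))
          (ENNReal.ofReal p') μ := by
  have hp0 := hp.pos
  have hp0' := hp.symm.pos
  have hp1 := hp.symm.lt
  have hq0 := hq.pos
  have hq0' := hq.symm.pos
  have hq1 := hq.symm.lt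
  obtain ⟨H, hH⟩ : ∃ H : α → ℝ, ∀ x, H x = finLq q' N fun j => g j x := ⟨_, fun _ => rfl⟩
  have hHn : ∀ x, 0 ≤ H x := fun x => (hH x).symm ▸ finLq_nonneg _ _ _
  have hHm : Measurable H := (funext hH : H = _) ▸ measurable_finLq hg
  have hHQ : ∀ x ∉ Q, H x = 0 := by
    intro x hx
    simp [hH, finLq, h0 _ x hx, hq0'.ne']
  obtain ⟨B, hB⟩ : ∃ B : ℝ, ∀ x, H x ≤ B := by
    refine ⟨(∑ j ∈ Finset.range N, M ^ q') ^ (1 / q'), fun x => ?_⟩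
    rw [hH]
    refine Real.rpow_le_rpow (by positivity) (Finset.sum_le_sum fun j _ => ?_) (by positivity)
    exact Real.rpow_le_rpow (norm_nonneg _) (hM j x) hq0'.le
  have hHp : Integrable (fun x => H x ^ p') μ := by
    have h1 : Measurable fun x => ((H x ^ p' : ℝ) : ℂ) :=
      Complex.measurable_ofReal.comp (hHm.pow_const _)
    have h2 : MemLp (fun x => ((H x ^ p' : ℝ) : ℂ)) 1 μ :=
      memLp_of_bounded_of_support h1 hQ hμQ (fun x hx => by simp [hHQ x hx, hp0'.ne'])
        (M := B ^ p') fun x => by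
        rw [Complex.norm_real, Real.norm_of_nonneg (Real.rpow_nonneg (hHn x) _)]
        exact Real.rpow_le_rpow (hHn x) (hB x) hp0'.le
    simpa using (memLp_one_iff_integrable.1 h2).re
  obtain ⟨I, hI⟩ : ∃ I : ℝ, I = ∫ x, H x ^ p' ∂μ := ⟨_, rfl⟩
  have hI0 : 0 ≤ I := hI ▸ integral_nonneg fun x => Real.rpow_nonneg (hHn x) _
  have hlint : ∫⁻ x, ENNReal.ofReal (H x ^ p') ∂μ = ENNReal.ofReal I := by
    rw [hI]
    exact (ofReal_integral_eq_lintegral_ofReal hHp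
      (Eventually.of_forall fun x => Real.rpow_nonneg (hHn x) _)).symm
  have hnorm : eLpNorm (fun x => (∑ j ∈ Finset.range N, ‖g j x‖ₑ ^ q') ^ (1 / q'))
      (ENNReal.ofReal p') μ = ENNReal.ofReal (I ^ (1 / p')) := by
    rw [eLpNorm_eq_lintegral_rpow_enorm_toReal (by simpa using hp0') ENNReal.ofReal_ne_top,
      ENNReal.toReal_ofReal hp0'.le, ← ENNReal.ofReal_rpow_of_nonneg hI0 (by positivity),
      ← hlint]
    congr 1
    refine lintegral_congr fun x => ?_
    rw [enorm_eq_self, ← ofReal_finLq hq0' N fun j => g j x, ← hH, ENNReal.ofReal_rpow_of_nonneg (hHn x) hp0'.le]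
  -- For `I = 0` no normalisation is possible, and the zero sequence already attains the norm.
  rcases hI0.eq_or_lt with hI1 | hI1
  · refine ⟨fun _ _ => 0, ⟨fun _ => measurable_const, ⟨0, by simp⟩, by simp, fun _ _ => rfl, ?_⟩,
      by simp, 0, le_rfl, by simp, ?_⟩
    · simp [hq0]
    · rw [hnorm, ← hI1, Real.zero_rpow (by positivity)]
  obtain ⟨c, hc⟩ : ∃ c : ℝ, c = I ^ (-(1 / p)) := ⟨_, rfl⟩
  have hc0 : 0 ≤ c := hc ▸ by positivity
  obtain ⟨f, hf⟩ : ∃ f : ℕ → α → ℂ,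
      ∀ j x, f j x = (c : ℂ) * extremalSeq p' q' N (fun j => g j x) j := ⟨_, fun _ _ => rfl⟩
  have hfinf : ∀ x, (∑' j, ‖f j x‖ₑ ^ q) ^ (1 / q) = ENNReal.ofReal (c * H x ^ (p' - 1)) := by
    intro x
    have h1 : ∀ j ∉ Finset.range N, ‖f j x‖ₑ ^ q = 0 := by
      intro j hj
      simp [hf, extremalSeq, Finset.mem_range.not.1 hj, hq0]
    rw [tsum_eq_sum h1, ← ofReal_finLq hq0 N fun j => f j x]
    simp_rw [hf]
    rw [finLq_const_mul hq0 hc0, hH]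
    congr 2
    exact finLq_extremalSeq hp1 hq N _
  have hfm : ∀ j, Measurable (f j) := fun j =>
    (funext (hf j) : f j = _) ▸ (measurable_extremalSeq hg j).const_mul _
  have hfz : ∀ j x, g j x = 0 → f j x = 0 := by
    intro j x h
    simp [hf, extremalSeq, h]
  have hfb : ∀ j x, ‖f j x‖ ≤ c * B ^ (p' - 1) := by
    intro j x
    by_cases hj : j < N
    · have h1 := norm_le_finLq hq0 (extremalSeq p' q' N fun j => g j x) hj
      rw [finLq_extremalSeq hp1 hq, ← hH] at h1
      rw [hf, norm_mul, Complex.norm_real, Real.norm_of_nonneg hc0]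
      gcongr
      exact h1.trans (Real.rpow_le_rpow (hHn x) (hB x) (by linarith))
    · have : 0 ≤ B := (hHn x).trans (hB x)
      simp only [hf, extremalSeq, if_neg hj, mul_zero, norm_zero]
      positivity
  have hfQ : ∀ j, ∀ x ∉ Q, f j x = 0 := fun j x hx => hfz j x (h0 j x hx)
  refine ⟨f, ⟨hfm, ⟨_, hfb⟩, hfQ, fun j hj => ?_, ?_⟩, hfz, I ^ (1 / p'), by positivity, ?_,
    hnorm.symm⟩
  · funext x
    simp [hf, extremalSeq, not_lt.2 hj]
  · simp_rw [hfinf]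
    rw [eLpNorm_eq_lintegral_rpow_enorm_toReal (by simpa using hp0) ENNReal.ofReal_ne_top,
      ENNReal.toReal_ofReal hp0.le]
    have h1 : ∀ x, ‖ENNReal.ofReal (c * H x ^ (p' - 1))‖ₑ ^ p =
        ENNReal.ofReal (I⁻¹) * ENNReal.ofReal (H x ^ p') := by
      intro x
      have h2 := Real.rpow_nonneg (hHn x) (p' - 1)
      rw [enorm_eq_self, ENNReal.ofReal_rpow_of_nonneg (by positivity) hp0.le,
        ← ENNReal.ofReal_mul (by positivity), Real.mul_rpow hc0 h2, hc, ← Real.rpow_mul hI0,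
        ← Real.rpow_mul (hHn x), hp.symm.sub_one_mul_conj, neg_mul, one_div_mul_cancel hp0.ne',
        Real.rpow_neg_one]
    simp_rw [h1]
    rw [lintegral_const_mul' _ _ ENNReal.ofReal_ne_top, hlint,
      ← ENNReal.ofReal_mul (by positivity), inv_mul_cancel₀ hI1.ne']
    simp
  · have hi : ∀ j ∈ Finset.range N, Integrable (fun x => g j x * f j x) μ := by
      intro j _
      refine memLp_one_iff_integrable.1 (memLp_of_bounded_of_support ((hg j).mul (hfm j)) hQ hμQ
        (fun x hx => by simp [h0 j x hx]) (M := M * (c * B ^ (p' - 1))) fun x => ?_)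
      rw [norm_mul]
      exact mul_le_mul (hM j x) (hfb j x) (norm_nonneg _) ((norm_nonneg _).trans (hM j x))
    rw [← integral_finsetSum _ hi]
    have h1 : ∀ x, ∑ j ∈ Finset.range N, g j x * f j x = ((c * H x ^ p' : ℝ) : ℂ) := by
      intro x
      rw [Complex.ofReal_mul, hH, ← mul_extremalSeq hp1 hq1, Finset.mul_sum]
      exact Finset.sum_congr rfl fun j _ => by simp only [hf]; ring
    simp_rw [h1]
    have h2 : ∫ x, ((c * H x ^ p' : ℝ) : ℂ) ∂μ = ((∫ x, c * H x ^ p' ∂μ : ℝ) : ℂ) :=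
      integral_ofReal
    rw [h2, integral_const_mul, ← hI, hc]
    congr 1
    nth_rewrite 2 [← Real.rpow_one I]
    rw [← Real.rpow_add hI1]
    congr 1
    have := hp.inv_add_inv_eq_one
    rw [one_div, one_div]; linarith

/-- One parameter `N` cuts off both the number and the size of the entries; every term only grows
with `N`. -/
theorem tendsto_sum_truncated {q : ℝ} (hq : 0 < q) (z : ℕ → ℂ) :
    (Monotone fun N : ℕ => ∑ j ∈ Finset.range N, ‖if ‖z j‖ ≤ N then z j else 0‖ₑ ^ q) ∧
    Tendsto (fun N : ℕ => ∑ j ∈ Finset.range N, ‖if ‖z j‖ ≤ N then z j else 0‖ₑ ^ q) atTop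
      (𝓝 (∑' j, ‖z j‖ₑ ^ q)) := by
  have hmono : Monotone fun N : ℕ =>
      ∑ j ∈ Finset.range N, ‖if ‖z j‖ ≤ N then z j else 0‖ₑ ^ q := by
    intro N N' h
    refine (Finset.sum_le_sum fun j _ => ?_).trans
      (Finset.sum_le_sum_of_subset (Finset.range_subset_range.2 h))
    refine ENNReal.rpow_le_rpow ?_ hq.le
    have h' : (N : ℝ) ≤ N' := by exact_mod_cast h
    by_cases hz : ‖z j‖ ≤ N
    · rw [if_pos hz, if_pos (hz.trans h')]
    · simp [hz]
  refine ⟨hmono, ?_⟩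
  have h1 : ∑' j, ‖z j‖ₑ ^ q =
      ⨆ N : ℕ, ∑ j ∈ Finset.range N, ‖if ‖z j‖ ≤ N then z j else 0‖ₑ ^ q := by
    refine le_antisymm ?_ (iSup_le fun N => ?_)
    · rw [ENNReal.tsum_eq_iSup_nat]
      refine iSup_le fun m => ?_
      -- `K` dominates each of the first `m` entries, so the truncation at `max m K` leaves them
      -- unchanged.
      obtain ⟨K, hK⟩ := exists_nat_ge (∑ j ∈ Finset.range m, ‖z j‖)
      refine le_iSup_of_le (max m K) ?_
      refine (Finset.sum_le_sum fun j hj => ?_).trans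
        (Finset.sum_le_sum_of_subset (Finset.range_subset_range.2 (le_max_left m K)))
      have h2 : ‖z j‖ ≤ (max m K : ℕ) :=
        (Finset.single_le_sum (f := fun j => ‖z j‖) (fun i _ => norm_nonneg _) hj).trans
          (hK.trans (by exact_mod_cast le_max_right m K))
      rw [if_pos h2]
    · refine (Finset.sum_le_sum fun j _ => ?_).trans (ENNReal.sum_le_tsum _)
      refine ENNReal.rpow_le_rpow ?_ hq.le
      split_ifs <;> simp
  rw [h1]
  exact tendsto_atTop_iSup hmono

theorem IsAdmissible.zero (hq : 0 < q) (Q : Set α) (N : ℕ) :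
    IsAdmissible p q μ Q N fun _ _ => 0 :=
  ⟨fun _ => measurable_const, ⟨0, by simp⟩, by simp, fun _ _ => rfl, by simp [hq]⟩

/-- By monotone convergence the norms of the bounded truncations eventually exceed `t`. The extremal
functions of a truncation vanish where it does, so they pair with `g` as with the truncation. The
norm of `g` may be infinite, so `g` need not be known to lie in `L_{p'}(ℓ_{q'})`. The alternative `t
= 0` serves the case of norm zero, where no smaller `t` exists. -/
theorem exists_extremal (hp : p.HolderConjugate p') (hq : q.HolderConjugate q')
    {Q : Set α} (hQ : MeasurableSet Q) (hμQ : μ Q ≠ ⊤) {g : ℕ → α → ℂ}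
    (hg : ∀ j, Measurable (g j)) (h0 : ∀ j, ∀ x ∉ Q, g j x = 0) {t : ℝ≥0∞}
    (ht : t = 0 ∨ t < eLpNorm (fun x => (∑' j, ‖g j x‖ₑ ^ q') ^ (1 / q'))
      (ENNReal.ofReal p') μ) :
    ∃ N f, IsAdmissible p q μ Q N f ∧ ∃ s : ℝ, 0 ≤ s ∧
      ∑ j ∈ Finset.range N, ∫ x, g j x * f j x ∂μ = s ∧ t ≤ ENNReal.ofReal s := by
  have hp0' := hp.symm.pos
  have hq0' := hq.symm.pos
  rcases ht with rfl | ht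
  · exact ⟨0, _, IsAdmissible.zero hq.pos Q 0, 0, le_rfl, by simp, by simp⟩
  obtain ⟨G, hG⟩ : ∃ G : ℕ → ℕ → α → ℂ, ∀ N j x, G N j x = if ‖g j x‖ ≤ N then g j x else 0 :=
    ⟨_, fun _ _ _ => rfl⟩
  have hGm : ∀ N j, Measurable (G N j) := fun N j => by
    rw [show G N j = fun x => if ‖g j x‖ ≤ N then g j x else 0 from funext (hG N j)]
    exact Measurable.ite (measurableSet_le (hg j).norm measurable_const) (hg j) measurable_const
  have hform : ∀ F : α → ℝ≥0∞, eLpNorm (fun x => F x ^ (1 / q')) (ENNReal.ofReal p') μ =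
      (∫⁻ x, F x ^ (p' / q') ∂μ) ^ (1 / p') := by
    intro F
    rw [eLpNorm_eq_lintegral_rpow_enorm_toReal (by simpa using hp0') ENNReal.ofReal_ne_top,
      ENNReal.toReal_ofReal hp0'.le]
    congr 1
    refine lintegral_congr fun x => ?_
    rw [enorm_eq_self, ← ENNReal.rpow_mul]
    congr 1
    ring
  have hlim : Tendsto (fun N => eLpNorm (fun x =>
      (∑ j ∈ Finset.range N, ‖G N j x‖ₑ ^ q') ^ (1 / q')) (ENNReal.ofReal p') μ) atTop
      (𝓝 (eLpNorm (fun x => (∑' j, ‖g j x‖ₑ ^ q') ^ (1 / q')) (ENNReal.ofReal p') μ)) := by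
    simp_rw [hform]
    refine (ENNReal.continuous_rpow_const.tendsto _).comp
      (lintegral_tendsto_of_tendsto_of_monotone (fun N => ?_) (Eventually.of_forall fun x => ?_)
        (Eventually.of_forall fun x => ?_))
    · exact ((Finset.measurable_sum _ fun j _ =>
        ((hGm N j).enorm.pow_const q')).pow_const _).aemeasurable
    · intro N N' h
      simp_rw [hG]
      exact ENNReal.rpow_le_rpow ((tendsto_sum_truncated hq0' fun j => g j x).1 h) (by positivity)
    · simp_rw [hG]
      exact (ENNReal.continuous_rpow_const.tendsto _).comp
        (tendsto_sum_truncated hq0' fun j => g j x).2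
  obtain ⟨N, hN⟩ := (hlim.eventually (lt_mem_nhds ht)).exists
  obtain ⟨f, hf, hfz, s, hs0, hs, hs'⟩ := exists_extremal_of_bounded hp hq hQ hμQ N (hGm N)
    (fun j x hx => by simp [hG, h0 j x hx]) (M := N) fun j x => by
      rw [hG]
      split_ifs with h
      · exact h
      · simp
  refine ⟨N, f, hf, s, hs0, hs ▸ Finset.sum_congr rfl fun j _ => ?_, by rw [hs']; exact hN.le⟩
  congr 1
  funext x
  by_cases hx : ‖g j x‖ ≤ N
  · rw [hG, if_pos hx]
  · rw [hfz j x (by rw [hG, if_neg hx]), mul_zero, mul_zero]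

end Extremal

/-! ### Extension of functionals to families indexed by the dyadic cubes -/

/-- The weight of a dyadic cube in the Morrey norm. -/
noncomputable def cubeWeight (p r : ℝ) (i : Idx n) : ℝ :=
  (2 : ℝ) ^ ((i.1 : ℝ) * ((n : ℝ) / p + r))

theorem cubeWeight_pos (p r : ℝ) (i : Idx n) : 0 < cubeWeight p r i := by
  unfold cubeWeight; positivity

/-- The contribution of a single dyadic cube to the Morrey norm of a sequence. -/
noncomputable def cubeENorm (p q r : ℝ) (i : Idx n) (f : FunSeq n) : ℝ≥0∞ :=
  ENNReal.ofReal (cubeWeight p r i) *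
    eLpNorm (lqNorm q f) (ENNReal.ofReal p) (volume.restrict (dyadicCube i))

theorem cubeENorm_le_morreySeqENorm (i : Idx n) (f : FunSeq n) :
    cubeENorm p q r i f ≤ morreySeqENorm p q r f :=
  le_iSup (fun i : Idx n => cubeENorm p q r i f) i

theorem cubeENorm_add_le (hp : 1 < p) (hq : 1 < q) (i : Idx n) (f g : FunSeq n) :
    cubeENorm p q r i (f + g) ≤ cubeENorm p q r i f + cubeENorm p q r i g := by
  rw [cubeENorm, cubeENorm, cubeENorm, ← mul_add]
  gcongr
  refine (eLpNorm_mono_enorm_ae (g := lqNorm q f + lqNorm q g) ?_).trans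
    (eLpNorm_add_le (measurable_lqNorm q f).aestronglyMeasurable
      (measurable_lqNorm q g).aestronglyMeasurable
      (by simpa using ENNReal.ofReal_le_ofReal hp.le))
  exact ae_restrict_of_ae (by filter_upwards [lqNorm_add_le hq f g] with x hx using hx)

theorem cubeENorm_smul_le (hq : 1 < q) (i : Idx n) (c : ℂ) (f : FunSeq n) :
    cubeENorm p q r i (c • f) ≤ ‖c‖ₑ * cubeENorm p q r i f := by
  rw [cubeENorm, cubeENorm, mul_left_comm]
  gcongr
  refine eLpNorm_le_nnreal_smul_eLpNorm_of_ae_le_mul' (c := ‖c‖₊) ?_ _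
  refine ae_restrict_of_ae ?_
  filter_upwards [lqNorm_smul hq c f] with x hx
  rw [enorm_eq_self, enorm_eq_self, hx]
  exact le_of_eq rfl

theorem cubeENorm_zero (hq : 1 < q) (i : Idx n) : cubeENorm p q r i (0 : FunSeq n) = 0 := by
  have := cubeENorm_smul_le (p := p) (r := r) hq i 0 (0 : FunSeq n)
  rw [show (0 : ℂ) • (0 : FunSeq n) = 0 from smul_zero (A := FunSeq n) (0 : ℂ)] at this
  simpa using this

/-- The norm of a family of sequences of functions indexed by the dyadic cubes: the supremum of
the contributions of its members on their own cubes. -/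
noncomputable def familyENorm (p q r : ℝ) (F : Idx n → FunSeq n) : ℝ≥0∞ :=
  ⨆ i, cubeENorm p q r i (F i)

theorem familyENorm_add_le (hp : 1 < p) (hq : 1 < q) (F F' : Idx n → FunSeq n) :
    familyENorm p q r (F + F') ≤ familyENorm p q r F + familyENorm p q r F' :=
  iSup_le fun i => (cubeENorm_add_le hp hq i _ _).trans
    (add_le_add (le_iSup (fun i => cubeENorm p q r i (F i)) i)
      (le_iSup (fun i => cubeENorm p q r i (F' i)) i))

theorem familyENorm_smul_le (hq : 1 < q) (c : ℂ) (F : Idx n → FunSeq n) :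
    familyENorm p q r (c • F) ≤ ‖c‖ₑ * familyENorm p q r F :=
  iSup_le fun i => (cubeENorm_smul_le hq i c _).trans
    (mul_le_mul_right (le_iSup (fun i => cubeENorm p q r i (F i)) i) _)

theorem familyENorm_zero (hq : 1 < q) : familyENorm p q r (0 : Idx n → FunSeq n) = 0 := by
  simp [familyENorm, cubeENorm_zero hq]

/-- The space of all families with finite norm. -/
def FamilySpace (n : ℕ) (p q r : ℝ) (hp : 1 < p) (hq : 1 < q) :
    Submodule ℂ (Idx n → FunSeq n) where
  carrier := {F | familyENorm p q r F < ⊤}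
  zero_mem' := by
    change familyENorm p q r (0 : Idx n → FunSeq n) < ⊤
    simp [familyENorm_zero hq]
  add_mem' hF hF' := (familyENorm_add_le hp hq _ _).trans_lt (ENNReal.add_lt_top.2 ⟨hF, hF'⟩)
  smul_mem' c _ hF := (familyENorm_smul_le hq c _).trans_lt (ENNReal.mul_lt_top (by simp) hF)

/-- The seminorm of `FamilySpace`. -/
noncomputable def familySeminorm (n : ℕ) (p q r : ℝ) (hp : 1 < p) (hq : 1 < q) :
    Seminorm ℂ (FamilySpace n p q r hp hq) :=
  Seminorm.ofSMulLE (fun F => (familyENorm p q r F.1).toReal)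
    (by
      change (familyENorm p q r (0 : Idx n → FunSeq n)).toReal = 0
      simp [familyENorm_zero hq])
    (fun F F' => by
      rw [← ENNReal.toReal_add F.2.ne F'.2.ne]
      exact ENNReal.toReal_mono (ENNReal.add_lt_top.2 ⟨F.2, F'.2⟩).ne
        (familyENorm_add_le hp hq F.1 F'.1))
    (fun c F => by
      rw [← toReal_enorm, ← ENNReal.toReal_mul]
      exact ENNReal.toReal_mono (ENNReal.mul_lt_top (by simp) F.2).ne
        (familyENorm_smul_le hq c F.1))

/-- The Morrey norm of `f` is the family norm of the constant family, so `G` is a functional on the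
constant families dominated by `‖G‖` times the seminorm, and the Hahn–Banach theorem applies. A
seminorm is all there is: values outside the own cube of an index are not seen. -/
theorem exists_family_extension (hp : 1 < p) (hq : 1 < q)
    (G : StrongDual ℂ (MorreySeqCirc n p q r hp hq)) :
    ∃ L : (Idx n → FunSeq n) →ₗ[ℂ] ℂ, (∀ f : MorreySeqCirc n p q r hp hq,
        L (fun _ => f.1.1) = G f) ∧
      ∀ F, familyENorm p q r F < ⊤ → ‖L F‖ₑ ≤ ‖G‖₊ * familyENorm p q r F := by
  let ι : MorreySeqCirc n p q r hp hq →ₗ[ℂ] FamilySpace n p q r hp hq :=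
    { toFun := fun f => ⟨fun _ => f.1.1, f.1.2.2⟩
      map_add' := fun _ _ => rfl
      map_smul' := fun _ _ => rfl }
  have hι : Function.Injective ι := by
    intro f f' h
    have h1 := congrFun (congrArg Subtype.val h) ((0, fun _ => 0) : Idx n)
    exact Subtype.ext (Subtype.ext h1)
  let e := LinearEquiv.ofInjective ι hι
  let φ : Module.Dual ℂ (LinearMap.range ι) := G.toLinearMap ∘ₗ e.symm.toLinearMap
  have hφ : ∀ f, φ (e f) = G f := fun f => by
    simp only [φ, LinearMap.comp_apply, LinearEquiv.coe_coe, e.symm_apply_apply]; rfl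
  have hbound : ∀ x : LinearMap.range ι,
      ‖φ x‖ ≤ (‖G‖₊ • familySeminorm n p q r hp hq) x := by
    intro x
    obtain ⟨f, rfl⟩ := e.surjective x
    rw [hφ]
    exact G.le_opNorm f
  obtain ⟨L₀, hL₀, hL₀'⟩ := Module.Dual.exists_extension_of_le_seminorm (LinearMap.range ι) φ
    (p := ‖G‖₊ • familySeminorm n p q r hp hq) hbound
  -- A further purely algebraic extension lets `L` act on every family; its bound concerns families
  -- of finite norm only.
  obtain ⟨L, hL⟩ := L₀.exists_extend
  have hL' : ∀ F : FamilySpace n p q r hp hq, L F.1 = L₀ F := fun F =>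
    LinearMap.congr_fun hL F
  refine ⟨L, fun f => ?_, fun F hF => ?_⟩
  · exact (hL' (ι f)).trans ((hL₀ (e f)).trans (hφ f))
  · have h1 : ‖L F‖ ≤ ‖G‖ * (familyENorm p q r F).toReal := by
      rw [hL' ⟨F, hF⟩]
      exact hL₀' ⟨F, hF⟩
    rw [← ofReal_norm, ← enorm_eq_nnnorm, ← ofReal_norm]
    refine (ENNReal.ofReal_le_ofReal h1).trans (le_of_eq ?_)
    rw [ENNReal.ofReal_mul (p := ‖G‖) (norm_nonneg G), ENNReal.ofReal_toReal hF.ne]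

theorem familyENorm_single (hq : 1 < q) (i : Idx n) (f : FunSeq n) :
    familyENorm p q r (Pi.single i f) = cubeENorm p q r i f := by
  refine le_antisymm (iSup_le fun i' => ?_) ?_
  · rcases eq_or_ne i' i with rfl | h
    · rw [Pi.single_eq_same]
    · rw [Pi.single_eq_of_ne h, cubeENorm_zero hq]; exact zero_le
  · have := le_iSup (fun i' => cubeENorm p q r i' ((Pi.single i f : Idx n → FunSeq n) i')) i
    rwa [Pi.single_eq_same] at this

theorem lqNorm_single_le (hq : 1 < q) (j : ℕ) (u : Sp n →ₘ[volume] ℂ) :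
    ∀ᵐ x, lqNorm q (Pi.single j u) x ≤ ‖u x‖ₑ := by
  filter_upwards [AEEqFun.coeFn_zero (α := Sp n) (β := ℂ) (μ := volume)] with x hx
  refine (ennreal_Lp_le_tsum hq.le _).trans (le_of_eq ?_)
  rw [tsum_eq_single j fun i hi => by rw [Pi.single_eq_of_ne hi, hx]; simp, Pi.single_eq_same]

theorem cubeENorm_single_le (hq : 1 < q) (i : Idx n) (j : ℕ) (u : Sp n →ₘ[volume] ℂ) :
    cubeENorm p q r i (Pi.single j u) ≤ ENNReal.ofReal (cubeWeight p r i) *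
      eLpNorm u (ENNReal.ofReal p) (volume.restrict (dyadicCube i)) :=
  mul_le_mul_right (eLpNorm_mono_enorm_ae
    (ae_restrict_of_ae (by filter_upwards [lqNorm_single_le hq j u] with x hx using hx))) _

theorem volume_dyadicCube_ne_top (i : Idx n) : volume (dyadicCube i) ≠ ⊤ := by
  rw [volume_dyadicCube]; exact ENNReal.ofReal_ne_top

/-- On families with one cube and one entry the bound for `L` is an `L_p` bound on that cube, so the
density theorem for functionals on `L_p` applies. -/
theorem exists_family_density (hp : 1 < p) (hq : 1 < q) {L : (Idx n → FunSeq n) →ₗ[ℂ] ℂ} {C : ℝ≥0}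
    (hL : ∀ F, familyENorm p q r F < ⊤ → ‖L F‖ₑ ≤ C * familyENorm p q r F) (i : Idx n)
    (j : ℕ) :
    ∃ g : Sp n → ℂ, Measurable g ∧ Integrable g volume ∧ (∀ x ∉ dyadicCube i, g x = 0) ∧
      ∀ (u : Sp n →ₘ[volume] ℂ) (f : Sp n → ℂ), u =ᵐ[volume.restrict (dyadicCube i)] f →
        Measurable f → (∃ M, ∀ x, ‖f x‖ ≤ M) →
          L (Pi.single i (Pi.single j u)) = ∫ x, g x * f x := by
  have hp1 : 1 ≤ ENNReal.ofReal p := by simpa using ENNReal.ofReal_le_ofReal hp.le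
  have : Fact (1 ≤ ENNReal.ofReal p) := ⟨hp1⟩
  have hQ := (isClosed_dyadicCube i).measurableSet
  have hμQ := volume_dyadicCube_ne_top i
  let T : (Sp n →ₘ[volume] ℂ) →ₗ[ℂ] ℂ :=
    L ∘ₗ LinearMap.single ℂ (fun _ : Idx n => FunSeq n) i ∘ₗ
      LinearMap.single ℂ (fun _ : ℕ => Sp n →ₘ[volume] ℂ) j
  have hT : ∀ u, T u = L (Pi.single i (Pi.single j u)) := fun u => rfl
  have hTb : ∀ u : Sp n →ₘ[volume] ℂ,
      eLpNorm u (ENNReal.ofReal p) (volume.restrict (dyadicCube i)) < ⊤ →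
      ‖T u‖ₑ ≤ C * (ENNReal.ofReal (cubeWeight p r i) *
        eLpNorm u (ENNReal.ofReal p) (volume.restrict (dyadicCube i))) := by
    intro u hu
    have h1 := cubeENorm_single_le (p := p) (r := r) hq i j u
    have h2 := hL (Pi.single i (Pi.single j u))
    rw [familyENorm_single hq] at h2
    exact (h2 (h1.trans_lt (ENNReal.mul_lt_top ENNReal.ofReal_lt_top hu))).trans (by gcongr)
  let Λ : Lp ℂ (ENNReal.ofReal p) (volume : Measure (Sp n)) →L[ℂ] ℂ :=
    LinearMap.mkContinuous
      { toFun := fun u => T u.1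
        map_add' := fun u v => T.map_add u.1 v.1
        map_smul' := fun c u => T.map_smul c u.1 } (C * cubeWeight p r i) fun u => by
        have h1 : eLpNorm u (ENNReal.ofReal p) (volume.restrict (dyadicCube i)) ≤
            eLpNorm u (ENNReal.ofReal p) volume := eLpNorm_mono_measure _ Measure.restrict_le_self
        have hu := Lp.eLpNorm_lt_top u
        have h2 := (hTb u.1 (h1.trans_lt hu)).trans
          (mul_le_mul_right (mul_le_mul_right h1 _) _)
        have h3 := ENNReal.toReal_mono (ENNReal.mul_lt_top (by simp)
          (ENNReal.mul_lt_top ENNReal.ofReal_lt_top hu)).ne h2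
        rw [toReal_enorm, ENNReal.toReal_mul, ENNReal.toReal_mul,
          ENNReal.coe_toReal, ENNReal.toReal_ofReal (cubeWeight_pos p r i).le, ← mul_assoc] at h3
        exact h3
  obtain ⟨g, hg, hgi, hg0, hgΛ⟩ := exists_density ENNReal.ofReal_ne_top Λ hQ hμQ
  refine ⟨g, hg, hgi, hg0, fun u f huf hf ⟨M, hM⟩ => ?_⟩
  set f' : Sp n → ℂ := (dyadicCube i).indicator f with hf'
  have hf'm : Measurable f' := hf.indicator hQ
  have hf'0 : ∀ x ∉ dyadicCube i, f' x = 0 := fun x hx => Set.indicator_of_notMem hx _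
  have hf'M : ∀ x, ‖f' x‖ ≤ M := fun x => (norm_indicator_le_norm_self _ _).trans (hM x)
  have hf'p : MemLp f' (ENNReal.ofReal p) volume :=
    memLp_of_bounded_of_support hf'm hQ hμQ hf'0 hf'M
  have h1 : ∫ x, g x * f x = ∫ x, g x * f' x := by
    congr 1
    funext x
    by_cases hx : x ∈ dyadicCube i
    · rw [hf', Set.indicator_of_mem hx]
    · rw [hg0 x hx, zero_mul, zero_mul]
  rw [h1, ← hgΛ f' hf'p hf'm hf'0 ⟨M, hf'M⟩, ← hT]
  -- `u` need not be in `L_p` of the whole space. It agrees with the cut-off `f'` on the cube, so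
  -- the difference has norm zero there and is annihilated by `T`.
  change T u = T (hf'p.toLp f').1
  rw [← sub_eq_zero, ← T.map_sub]
  have h2 : eLpNorm (u - (hf'p.toLp f').1 : Sp n →ₘ[volume] ℂ) (ENNReal.ofReal p)
      (volume.restrict (dyadicCube i)) = 0 := by
    rw [eLpNorm_congr_ae (g := fun _ => (0 : ℂ)), eLpNorm_zero']
    filter_upwards [huf, ae_restrict_of_ae (AEEqFun.coeFn_sub u (hf'p.toLp f').1),
      ae_restrict_of_ae hf'p.coeFn_toLp, ae_restrict_mem hQ] with x h1 h2 h3 h4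
    rw [h2, Pi.sub_apply, h1, h3, hf', Set.indicator_of_mem h4, sub_self]
  have h3 := hTb _ (h2.trans_lt ENNReal.zero_lt_top)
  rw [h2, mul_zero, mul_zero] at h3
  simpa using h3

/-! ### Summability of the densities -/

/-- Each `ν i` is a limit of admissible values `t i` from below; for `ν i = 0` the constant value
`0` serves. A finite sum with finite weights passes to the limit. -/
theorem sum_le_of_forall_lt {ι : Type*} (S : Finset ι) (w ν : ι → ℝ≥0∞) (hw : ∀ i, w i ≠ ⊤)
    {c : ℝ≥0∞} (h : ∀ t : ι → ℝ≥0∞, (∀ i, t i = 0 ∨ t i < ν i) → ∑ i ∈ S, w i * t i ≤ c) :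
    ∑ i ∈ S, w i * ν i ≤ c := by
  have h1 : ∀ i, ∃ u : ℕ → ℝ≥0∞, (∀ k, u k = 0 ∨ u k < ν i) ∧ Tendsto u atTop (𝓝 (ν i)) := by
    intro i
    rcases eq_or_ne (ν i) 0 with h0 | h0
    · exact ⟨fun _ => 0, fun _ => Or.inl rfl, by rw [h0]; exact tendsto_const_nhds⟩
    · obtain ⟨u, -, hu, hu'⟩ := exists_seq_strictMono_tendsto' (pos_iff_ne_zero.2 h0)
      exact ⟨u, fun k => Or.inr (hu k).2, hu'⟩
  choose u hu hu' using h1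
  exact le_of_tendsto' (tendsto_finsetSum S fun i _ =>
    ENNReal.Tendsto.const_mul (hu' i) (Or.inr (hw i))) fun k => h _ fun i => hu i k

/-- `L` is merely linear, so splitting into entries rests on finite support. -/
theorem sum_single_apply_eq (L : (Idx n → FunSeq n) →ₗ[ℂ] ℂ) (i : Idx n) {f : FunSeq n} {N : ℕ}
    (hf : ∀ j, N ≤ j → f j = 0) :
    L (Pi.single i f) = ∑ j ∈ Finset.range N, L (Pi.single i (Pi.single j (f j))) := by
  have h1 : f = ∑ j ∈ Finset.range N, Pi.single j (f j) := by
    funext k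
    rw [Finset.sum_apply]
    by_cases hk : k < N
    · rw [Finset.sum_eq_single_of_mem k (Finset.mem_range.2 hk) fun j _ hj =>
        Pi.single_eq_of_ne hj.symm _, Pi.single_eq_same]
    · rw [hf k (not_lt.1 hk)]
      refine (Finset.sum_eq_zero fun j hj => Pi.single_eq_of_ne ?_ _).symm
      rintro rfl
      exact hk (Finset.mem_range.1 hj)
  let T : FunSeq n →ₗ[ℂ] ℂ := L ∘ₗ LinearMap.single ℂ (fun _ : Idx n => FunSeq n) i
  change T f = ∑ j ∈ Finset.range N, T (Pi.single j (f j))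
  conv_lhs => rw [h1]
  exact map_sum T _ _

/-- Duality of supremum and sum. On each cube of a finite set, a nearly extremal test sequence
divided by the weight contributes at most one to the family norm, so the family of all of them has
norm at most one. The value of `L` on it is the sum of the nonnegative individual pairings, and this
is at most `C`. -/
theorem sum_density_le (hp : p.HolderConjugate p') (hq : q.HolderConjugate q')
    {L : (Idx n → FunSeq n) →ₗ[ℂ] ℂ} {C : ℝ≥0}
    (hL : ∀ F, familyENorm p q r F < ⊤ → ‖L F‖ₑ ≤ C * familyENorm p q r F)
    {g : Idx n → ℕ → Sp n → ℂ} (hg : ∀ i j, Measurable (g i j))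
    (hg0 : ∀ i j, ∀ x ∉ dyadicCube i, g i j x = 0)
    (hgL : ∀ i j (u : Sp n →ₘ[volume] ℂ) (f : Sp n → ℂ),
      u =ᵐ[volume.restrict (dyadicCube i)] f → Measurable f → (∃ M, ∀ x, ‖f x‖ ≤ M) →
        L (Pi.single i (Pi.single j u)) = ∫ x, g i j x * f x) :
    ∑' i, (ENNReal.ofReal (cubeWeight p r i))⁻¹ *
      eLpNorm (fun x => (∑' j, ‖g i j x‖ₑ ^ q') ^ (1 / q')) (ENNReal.ofReal p') volume ≤ C := by
  rw [ENNReal.tsum_eq_iSup_sum]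
  refine iSup_le fun S => sum_le_of_forall_lt S _ _ (fun i => ?_) fun t ht => ?_
  · simpa using cubeWeight_pos p r i
  choose N f hf s hs0 hs hts using fun i => exists_extremal hp hq
    (isClosed_dyadicCube i).measurableSet (volume_dyadicCube_ne_top i) (hg i) (hg0 i) (ht i)
  set w : Idx n → ℝ := cubeWeight p r with hw
  have hw0 : ∀ i, 0 < w i := cubeWeight_pos p r
  let φ : Idx n → FunSeq n := fun i j =>
    AEEqFun.mk (f i j) ((hf i).measurable j).aestronglyMeasurable
  have hφ : ∀ i, ∀ᵐ x, ∀ j, φ i j x = f i j x := fun i =>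
    ae_all_iff.2 fun j => AEEqFun.coeFn_mk _ _
  have hφL : ∀ i, L (Pi.single i (φ i)) = s i := by
    intro i
    have h0 : ∀ j, N i ≤ j → φ i j = 0 := by
      intro j hj
      apply AEEqFun.ext
      filter_upwards [hφ i, AEEqFun.coeFn_zero (α := Sp n) (β := ℂ) (μ := volume)] with x h1 h2
      rw [h1, h2, (hf i).eq_zero j hj]
    rw [sum_single_apply_eq L i h0, ← hs i]
    refine Finset.sum_congr rfl fun j _ => hgL i j _ _ ?_ ((hf i).measurable j) ?_
    · exact ae_restrict_of_ae ((hφ i).mono fun x hx => hx j)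
    · obtain ⟨M, hM⟩ := (hf i).bounded
      exact ⟨M, hM j⟩
  have hφn : ∀ i, cubeENorm p q r i (φ i) ≤ ENNReal.ofReal (w i) := by
    intro i
    refine (mul_le_mul_right ?_ _).trans (mul_one _).le
    refine (eLpNorm_mono_measure _ Measure.restrict_le_self).trans (le_trans (le_of_eq ?_)
      (hf i).norm_le)
    refine eLpNorm_congr_ae ?_
    filter_upwards [hφ i] with x hx
    simp only [lqNorm, hx]
  let F : Idx n → FunSeq n := ∑ i ∈ S, Pi.single i (((w i)⁻¹ : ℂ) • φ i)
  have hF : familyENorm p q r F ≤ 1 := by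
    refine iSup_le fun i => ?_
    have h1 : F i = ∑ i' ∈ S, (Pi.single i' (((w i')⁻¹ : ℂ) • φ i') : Idx n → FunSeq n) i :=
      Finset.sum_apply _ _ _
    by_cases hi : i ∈ S
    · rw [h1, Finset.sum_eq_single_of_mem i hi fun j _ hj => Pi.single_eq_of_ne hj.symm _,
        Pi.single_eq_same]
      refine (cubeENorm_smul_le hq.lt i _ _).trans ((mul_le_mul_right (hφn i) _).trans ?_)
      rw [← ofReal_norm, ← ENNReal.ofReal_mul (norm_nonneg _), norm_inv, Complex.norm_real,
        Real.norm_of_nonneg (hw0 i).le, inv_mul_cancel₀ (hw0 i).ne', ENNReal.ofReal_one]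
    · rw [h1, Finset.sum_eq_zero fun j hj => Pi.single_eq_of_ne
        (fun h : i = j => hi (h ▸ hj)) _,
        cubeENorm_zero hq.lt]
      exact zero_le
  have hLF : L F = ((∑ i ∈ S, (w i)⁻¹ * s i : ℝ) : ℂ) := by
    rw [map_sum, Complex.ofReal_sum]
    refine Finset.sum_congr rfl fun i _ => ?_
    have h1 : (Pi.single i (((w i)⁻¹ : ℂ) • φ i) : Idx n → FunSeq n) =
        ((w i)⁻¹ : ℂ) • Pi.single i (φ i) := by
      funext i'
      rcases eq_or_ne i' i with rfl | h
      · simp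
      · rw [Pi.smul_apply, Pi.single_eq_of_ne h, Pi.single_eq_of_ne h]
        exact (smul_zero (A := FunSeq n) ((w i)⁻¹ : ℂ)).symm
    rw [h1, map_smul, hφL, smul_eq_mul, Complex.ofReal_mul, Complex.ofReal_inv]
  calc ∑ i ∈ S, (ENNReal.ofReal (w i))⁻¹ * t i
      ≤ ∑ i ∈ S, ENNReal.ofReal ((w i)⁻¹ * s i) := by
        refine Finset.sum_le_sum fun i _ => ?_
        rw [ENNReal.ofReal_mul (inv_nonneg.2 (hw0 i).le), ENNReal.ofReal_inv_of_pos (hw0 i)]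
        gcongr
        exact hts i
    _ = ENNReal.ofReal (∑ i ∈ S, (w i)⁻¹ * s i) :=
        (ENNReal.ofReal_sum_of_nonneg fun i _ =>
          mul_nonneg (inv_nonneg.2 (hw0 i).le) (hs0 i)).symm
    _ = ‖L F‖ₑ := by
        rw [hLF, ← ofReal_norm, Complex.norm_real, Real.norm_of_nonneg]
        exact Finset.sum_nonneg fun i _ => mul_nonneg (inv_nonneg.2 (hw0 i).le) (hs0 i)
    _ ≤ C * familyENorm p q r F := hL F (hF.trans_lt ENNReal.one_lt_top)
    _ ≤ C := (mul_le_mul_right hF _).trans (mul_one _).le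

/-! ### Vanishing of the contributions of very small, very large and distant cubes -/

/-- The centre `2^(-i.1) M` is within `2^(-i.1)` of `x` in every coordinate; multiply by `2^(i.1)`.
Thus cubes of bounded scale that meet a fixed box leave only finitely many `M`. -/
theorem abs_le_of_mem_dyadicCube {i : Idx n} {x : Sp n} (hx : x ∈ dyadicCube i) {R J : ℝ}
    (hR : ∀ k, |x k| ≤ R) (hJ : (i.1 : ℝ) ≤ J) (k : Fin n) :
    |(i.2 k : ℝ)| ≤ 2 ^ J * R + 1 := by
  have h1 := hx k
  have hR0 : 0 ≤ R := (abs_nonneg _).trans (hR k)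
  have ht : (0 : ℝ) < 2 ^ (-i.1) := by positivity
  have ht' : (2 : ℝ) ^ (-i.1) * 2 ^ (i.1 : ℝ) = 1 := by
    rw [Real.rpow_intCast, ← zpow_add₀ two_ne_zero]; simp
  have h2 : (2 : ℝ) ^ (i.1 : ℝ) * R ≤ 2 ^ J * R := by
    gcongr
    exact one_le_two
  have h3 : (0 : ℝ) < 2 ^ (i.1 : ℝ) := by positivity
  have h4 := abs_le.1 (hR k)
  have h5 : (i.2 k : ℝ) - 1 ≤ 2 ^ (i.1 : ℝ) * R := by
    calc (i.2 k : ℝ) - 1 = 2 ^ (i.1 : ℝ) * (2 ^ (-i.1) * ((i.2 k : ℝ) - 1)) := by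
          rw [← mul_assoc, mul_comm ((2 : ℝ) ^ (i.1 : ℝ)), ht', one_mul]
      _ ≤ _ := by gcongr; exact h1.1.trans h4.2
  have h6 : -(2 ^ (i.1 : ℝ) * R) ≤ (i.2 k : ℝ) + 1 := by
    calc -(2 ^ (i.1 : ℝ) * R) = 2 ^ (i.1 : ℝ) * (-R) := by ring
      _ ≤ 2 ^ (i.1 : ℝ) * (2 ^ (-i.1) * ((i.2 k : ℝ) + 1)) := by gcongr; exact h4.1.trans h1.2
      _ = _ := by rw [← mul_assoc, mul_comm ((2 : ℝ) ^ (i.1 : ℝ)), ht', one_mul]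
  rw [abs_le]
  constructor <;> linarith

/-- For large cubes (`J → -∞`) the weight tends to zero because `n/p + r > 0`, while the local norm
is at most the global one. For small cubes (`J → ∞`) the bound `B` and the volume give a multiple of
`2^(J r)`, which tends to zero because `r < 0`. Only finitely many cubes of intermediate scale meet
the support. -/
theorem tendsto_cubeENorm (hp : 1 < p) (hr : -(n : ℝ) / p < r) (hr0 : r < 0) {f : FunSeq n}
    {B R : ℝ} (hf : ∀ᵐ x, lqNorm q f x ≤ ENNReal.ofReal B)
    (hf0 : ∀ᵐ x : Sp n, (∃ k, R < |x k|) → lqNorm q f x = 0)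
    (hfp : eLpNorm (lqNorm q f) (ENNReal.ofReal p) volume < ⊤) :
    Tendsto (fun i => cubeENorm p q r i f) cofinite (𝓝 0) := by
  have hp0 : 0 < p := by linarith
  have hα : 0 < (n : ℝ) / p + r := by rw [neg_div] at hr; linarith
  have hbig : ∀ i : Idx n, cubeENorm p q r i f ≤
      ENNReal.ofReal ((2 : ℝ) ^ ((i.1 : ℝ) * ((n : ℝ) / p + r)) *
        (eLpNorm (lqNorm q f) (ENNReal.ofReal p) volume).toReal) := by
    intro i
    rw [ENNReal.ofReal_mul (by positivity), ENNReal.ofReal_toReal hfp.ne]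
    exact mul_le_mul_right (eLpNorm_mono_measure _ Measure.restrict_le_self) _
  have hsmall : ∀ i : Idx n, cubeENorm p q r i f ≤
      ENNReal.ofReal ((2 : ℝ) ^ ((i.1 : ℝ) * r) * ((2 : ℝ) ^ ((n : ℝ) / p) * B)) := by
    intro i
    have h1 : eLpNorm (lqNorm q f) (ENNReal.ofReal p) (volume.restrict (dyadicCube i)) ≤
        ENNReal.ofReal B * volume (dyadicCube i) ^ (1 / p) := by
      have h2 : eLpNorm (lqNorm q f) (ENNReal.ofReal p) (volume.restrict (dyadicCube i)) ≤
          eLpNorm (fun _ : Sp n => ENNReal.ofReal B) (ENNReal.ofReal p)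
            (volume.restrict (dyadicCube i)) :=
        eLpNorm_mono_enorm_ae (ae_restrict_of_ae hf)
      refine h2.trans (le_of_eq ?_)
      rw [eLpNorm_const' _ (by simpa using hp0) ENNReal.ofReal_ne_top,
        Measure.restrict_apply_univ, ENNReal.toReal_ofReal hp0.le, enorm_eq_self]
    refine (mul_le_mul_right h1 _).trans (le_of_eq ?_)
    rw [volume_dyadicCube, ENNReal.ofReal_rpow_of_pos (by positivity), mul_left_comm,
      ← ENNReal.ofReal_mul (cubeWeight_pos p r i).le, mul_comm, ← ENNReal.ofReal_mul
      (by have := cubeWeight_pos p r i; positivity), cubeWeight, ← Real.rpow_mul two_pos.le,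
      ← Real.rpow_add two_pos, ← mul_assoc, ← Real.rpow_add two_pos]
    congr 3
    field_simp
    ring
  refine ENNReal.tendsto_nhds_zero.2 fun ε hε => ?_
  have hlim1 : Tendsto (fun J : ℝ => ENNReal.ofReal ((2 : ℝ) ^ (J * ((n : ℝ) / p + r)) *
      (eLpNorm (lqNorm q f) (ENNReal.ofReal p) volume).toReal)) atBot (𝓝 0) := by
    have h1 : Tendsto (fun J : ℝ => (2 : ℝ) ^ (J * ((n : ℝ) / p + r))) atBot (𝓝 0) :=
      (tendsto_rpow_atBot_of_base_gt_one 2 one_lt_two).comp (tendsto_id.atBot_mul_const hα)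
    have h2 := (ENNReal.continuous_ofReal.tendsto _).comp
      (h1.mul_const (eLpNorm (lqNorm q f) (ENNReal.ofReal p) volume).toReal)
    simpa [Function.comp_def] using h2
  have hlim2 : Tendsto (fun J : ℝ => ENNReal.ofReal ((2 : ℝ) ^ (J * r) *
      ((2 : ℝ) ^ ((n : ℝ) / p) * B))) atTop (𝓝 0) := by
    have h1 : Tendsto (fun J : ℝ => (2 : ℝ) ^ (J * r)) atTop (𝓝 0) :=
      (tendsto_rpow_atBot_of_base_gt_one 2 one_lt_two).comp
        (tendsto_id.atTop_mul_const_of_neg hr0)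
    have h2 := (ENNReal.continuous_ofReal.tendsto _).comp
      (h1.mul_const ((2 : ℝ) ^ ((n : ℝ) / p) * B))
    simpa [Function.comp_def] using h2
  obtain ⟨J₁, hJ₁⟩ := eventually_atBot.1 (hlim1.eventually (ge_mem_nhds hε))
  obtain ⟨J₂, hJ₂⟩ := eventually_atTop.1 (hlim2.eventually (ge_mem_nhds hε))
  obtain ⟨K, hK⟩ := exists_nat_ge (2 ^ J₂ * R + 1)
  rw [eventually_cofinite]
  refine ((Set.finite_Icc ⌊J₁⌋ ⌈J₂⌉).prod
    (Set.finite_Icc (fun _ : Fin n => -(K : ℤ)) fun _ => (K : ℤ))).subset ?_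
  intro i hi
  have hi' : ¬ cubeENorm p q r i f ≤ ε := hi
  have h1 : J₁ < i.1 := by
    by_contra h
    exact hi' ((hbig i).trans (hJ₁ _ (not_lt.1 h)))
  have h2 : (i.1 : ℝ) < J₂ := by
    by_contra h
    exact hi' ((hsmall i).trans (hJ₂ _ (not_lt.1 h)))
  have h3 : ∃ x ∈ dyadicCube i, ∀ k, |x k| ≤ R := by
    by_contra! h
    refine hi' (le_trans (le_of_eq ?_) (zero_le (a := ε)))
    rw [cubeENorm, eLpNorm_congr_ae (g := fun _ => (0 : ℝ≥0∞)), eLpNorm_zero', mul_zero]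
    filter_upwards [ae_restrict_of_ae hf0,
      ae_restrict_mem (isClosed_dyadicCube i).measurableSet] with x hx hxi
    exact hx (h x hxi)
  obtain ⟨x, hx, hxR⟩ := h3
  have h4 := fun k => (abs_le_of_mem_dyadicCube hx hxR h2.le k).trans hK
  have h5 : ∀ k, |i.2 k| ≤ (K : ℤ) := fun k => by exact_mod_cast h4 k
  refine ⟨⟨?_, ?_⟩, fun k => (abs_le.1 (h5 k)).1, fun k => (abs_le.1 (h5 k)).2⟩
  · exact_mod_cast (Int.floor_le J₁).trans h1.le
  · exact_mod_cast h2.le.trans (Int.le_ceil J₂)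

/-! ### Representation of functionals -/

/-- The pointwise norms `k i` of the densities, normalised on their cubes, are atoms, and the
hypothesis bounds the sum of the coefficients. So `K = ∑ k i` has predual norm at most `C`; by
Minkowski's inequality it dominates the `ℓ_{q'}` norm of `∑ g i`, and the predual norm is monotone.
The last conclusion supplies the majorant for exchanging sum and integral later. -/
theorem exists_predual_of_densities (hp : p.HolderConjugate p') (hq : 1 < q')
    (h : PredualIndex n p' ρ) (hrρ : r + ρ = -(n : ℝ)) {C : ℝ≥0}
    {g : Idx n → ℕ → Sp n → ℂ} (hg : ∀ i j, Measurable (g i j))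
    (hg0 : ∀ i j, ∀ x ∉ dyadicCube i, g i j x = 0)
    (hsum : ∑' i, (ENNReal.ofReal (cubeWeight p r i))⁻¹ *
      eLpNorm (fun x => (∑' j, ‖g i j x‖ₑ ^ q') ^ (1 / q')) (ENNReal.ofReal p') volume ≤ C) :
    ∃ γ : PredualSeq n p' q' ρ h hq, predualSeqENorm p' q' ρ γ.1 ≤ C ∧
      (∀ j, ∀ᵐ x, γ.1 j x = ∑' i, g i j x) ∧
      ∀ F : Sp n → ℝ≥0∞, Measurable F → morreyENorm p r F < ⊤ →
        ∫⁻ x, (∑' i, (∑' j, ‖g i j x‖ₑ ^ q') ^ (1 / q')) * F x < ⊤ := by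
  have hq0 : 0 < q' := by linarith
  have hp0' := hp.symm.pos
  have hp00 : ENNReal.ofReal p' ≠ 0 := by simpa using hp0'
  obtain ⟨k, hk⟩ : ∃ k : Idx n → Sp n → ℝ≥0∞,
      ∀ i x, k i x = (∑' j, ‖g i j x‖ₑ ^ q') ^ (1 / q') := ⟨_, fun _ _ => rfl⟩
  simp_rw [← hk] at hsum ⊢
  have hkm : ∀ i, Measurable (k i) := fun i => by
    rw [show k i = _ from funext (hk i)]
    exact (Measurable.tsum fun j => (hg i j).enorm.pow_const q').pow_const _
  have hk0 : ∀ i, ∀ x ∉ dyadicCube i, k i x = 0 := by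
    intro i x hx
    simp [hk, hg0 i _ x hx, hq0]
  obtain ⟨ν, hν⟩ : ∃ ν : Idx n → ℝ≥0∞, ∀ i, ν i = eLpNorm (k i) (ENNReal.ofReal p') volume :=
    ⟨_, fun _ => rfl⟩
  have hsum' : ∑' i, (ENNReal.ofReal (cubeWeight p r i))⁻¹ * ν i ≤ C := by
    simpa only [hν] using hsum
  have hw0 := cubeWeight_pos (n := n) p r
  have hν1 : ∀ i, ν i ≠ ⊤ := by
    intro i hi
    have h1 := (ENNReal.le_tsum i).trans hsum'
    rw [hi, ENNReal.mul_top (by simp)] at h1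
    exact (h1.trans_lt ENNReal.coe_lt_top).ne rfl
  have hkfin : ∀ᵐ x, ∀ i, k i x < ⊤ := by
    refine ae_all_iff.2 fun i => ?_
    have h1 : ∫⁻ x, ‖k i x‖ₑ ^ (ENNReal.ofReal p').toReal < ⊤ :=
      (eLpNorm_lt_top_iff_lintegral_rpow_enorm_lt_top hp00 ENNReal.ofReal_ne_top).1
        ((hν i).symm ▸ (hν1 i).lt_top)
    rw [ENNReal.toReal_ofReal hp0'.le] at h1
    filter_upwards [ae_lt_top ((hkm i).enorm.pow_const p') h1.ne] with x hx
    rw [enorm_eq_self] at hx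
    by_contra htop
    rw [not_lt_top_iff.1 htop, ENNReal.top_rpow_of_pos hp0'] at hx
    exact hx.ne rfl
  -- The coefficient is the norm of `k i` over the weight, the atom is `k i` rescaled to norm equal
  -- to the weight. If `ν i = 0`, division by zero makes the atom zero, consistently with `k i = 0`
  -- almost everywhere.
  obtain ⟨lam, hlam⟩ : ∃ lam : Idx n → ℂ,
      ∀ i, lam i = (((cubeWeight p r i)⁻¹ * (ν i).toReal : ℝ) : ℂ) := ⟨_, fun _ => rfl⟩
  obtain ⟨a, ha⟩ : ∃ a : Idx n → Sp n → ℂ,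
      ∀ i x, a i x = ((cubeWeight p r i / (ν i).toReal * (k i x).toReal : ℝ) : ℂ) :=
    ⟨_, fun _ _ => rfl⟩
  have hlamn : ∀ i, ‖lam i‖ₑ = (ENNReal.ofReal (cubeWeight p r i))⁻¹ * ν i := by
    intro i
    rw [hlam, ← ofReal_norm, Complex.norm_real, Real.norm_of_nonneg
      (mul_nonneg (inv_nonneg.2 (hw0 i).le) ENNReal.toReal_nonneg),
      ENNReal.ofReal_mul (inv_nonneg.2 (hw0 i).le), ENNReal.ofReal_toReal (hν1 i),
      ENNReal.ofReal_inv_of_pos (hw0 i)]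
  have hlams : ∑' i, ‖lam i‖ₑ ≤ C := by simpa only [hlamn] using hsum'
  have ham : ∀ i, Measurable (a i) := fun i => by
    rw [show a i = _ from funext (ha i)]
    exact Complex.measurable_ofReal.comp ((hkm i).ennreal_toReal.const_mul _)
  have han : ∀ i, eLpNorm (a i) (ENNReal.ofReal p') volume ≤
      ENNReal.ofReal (cubeWeight p r i) := by
    intro i
    have h1 : eLpNorm (a i) (ENNReal.ofReal p') volume ≤
        (cubeWeight p r i / (ν i).toReal).toNNReal • eLpNorm (k i) (ENNReal.ofReal p') volume := by
      refine eLpNorm_le_nnreal_smul_eLpNorm_of_ae_le_mul' ?_ _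
      filter_upwards [hkfin] with x hx
      rw [ha, ← ofReal_norm, Complex.norm_real, Real.norm_of_nonneg (mul_nonneg
        (div_nonneg (hw0 i).le ENNReal.toReal_nonneg) ENNReal.toReal_nonneg),
        ENNReal.ofReal_mul (div_nonneg (hw0 i).le ENNReal.toReal_nonneg),
        ENNReal.ofReal_toReal (hx i).ne, enorm_eq_self]
      exact le_rfl
    refine h1.trans ?_
    rw [← hν, ENNReal.smul_def, smul_eq_mul]
    change ENNReal.ofReal _ * _ ≤ _
    rw [← ENNReal.ofReal_toReal (hν1 i), ← ENNReal.ofReal_mul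
      (div_nonneg (hw0 i).le ENNReal.toReal_nonneg),
      ENNReal.toReal_ofReal ENNReal.toReal_nonneg]
    refine ENNReal.ofReal_le_ofReal ?_
    rcases eq_or_ne (ν i).toReal 0 with h0 | h0
    · simp [h0, (hw0 i).le]
    · rw [div_mul_cancel₀ _ h0]
  have hA : IsAtomic p' ρ lam a := by
    refine ⟨fun i => ⟨(ham i).aestronglyMeasurable, (han i).trans_lt ENNReal.ofReal_lt_top⟩,
      fun i => Eventually.of_forall fun x hx => ?_, fun i => ?_,
      tsum_enorm_ne_top_iff_summable_norm.1 (hlams.trans_lt ENNReal.coe_lt_top).ne⟩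
    · simp [ha, hk0 i x hx]
    · rw [neg_mul_exponent_eq hp hrρ]
      exact han i
  have hprod : ∀ᵐ x, ∀ i, lam i * a i x = ((k i x).toReal : ℂ) := by
    refine ae_all_iff.2 fun i => ?_
    rcases eq_or_ne (ν i).toReal 0 with h0 | h0
    · have h1 : ν i = 0 := ((ENNReal.toReal_eq_zero_iff _).1 h0).resolve_right (hν1 i)
      rw [hν, eLpNorm_eq_zero_iff (hkm i).aestronglyMeasurable hp00] at h1
      filter_upwards [h1] with x hx
      simp [ha, hx]
    · refine Eventually.of_forall fun x => ?_
      rw [hlam, ha, ← Complex.ofReal_mul]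
      have := (hw0 i).ne'
      congr 1
      field_simp
  obtain ⟨K, hK⟩ : ∃ K : Sp n → ℂ, ∀ x, K x = ∑' i, lam i * a i x := ⟨_, fun _ => rfl⟩
  have hKC : predualFunENorm p' ρ K ≤ C :=
    (hA.memPredual h (Eventually.of_forall hK)).2.trans hlams
  have hKk : ∀ᵐ x, ∑' i, k i x = ‖K x‖ₑ := by
    filter_upwards [hkfin, hprod, (hA.exists_decomp h).1] with x h1 h2 h3
    simp_rw [h2] at h3
    have h4 : Summable fun i => (k i x).toReal := by simpa using h3.norm
    have h5 : K x = ((∑' i, (k i x).toReal : ℝ) : ℂ) := by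
      rw [hK, Complex.ofReal_tsum]
      exact tsum_congr h2
    rw [h5, ← ofReal_norm, Complex.norm_real, Real.norm_of_nonneg
      (tsum_nonneg fun i => ENNReal.toReal_nonneg),
      ENNReal.ofReal_tsum_of_nonneg (fun i => ENNReal.toReal_nonneg) h4]
    exact tsum_congr fun i => (ENNReal.ofReal_toReal (h1 i).ne).symm
  have hγm : ∀ j, Measurable fun x => ∑' i, g i j x := fun j => Measurable.tsum fun i => hg i j
  let γ : FunSeq n := fun j => AEEqFun.mk _ (hγm j).aestronglyMeasurable
  have hγ : ∀ᵐ x, ∀ j, γ j x = ∑' i, g i j x := ae_all_iff.2 fun j => AEEqFun.coeFn_mk _ _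
  have hγK : ∀ᵐ x, lqNorm q' γ x ≤ ‖K x‖ₑ := by
    filter_upwards [hγ, hKk] with x h1 h2
    rw [← h2]
    simp_rw [hk]
    refine le_trans ?_ (ennreal_Lp_tsum_le hq.le fun i j => ‖g i j x‖ₑ)
    refine ENNReal.rpow_le_rpow (ENNReal.tsum_le_tsum fun j => ?_) (by positivity)
    rw [h1]
    exact ENNReal.rpow_le_rpow enorm_tsum_le_tsum_enorm hq0.le
  have hγfin : ∀ᵐ x, lqNorm q' γ x < ⊤ := hγK.mono fun x hx => hx.trans_lt (by simp)
  have hγn : predualSeqENorm p' q' ρ γ ≤ C := by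
    refine (predualFunENorm_mono h (measurable_lqFun q' γ).aestronglyMeasurable ?_).trans hKC
    filter_upwards [hγK] with x hx
    rw [norm_lqFun, ← toReal_enorm]
    exact ENNReal.toReal_mono (by simp) hx
  have hγt := hγn.trans_lt ENNReal.coe_lt_top
  refine ⟨⟨γ, memPredual_component h hq hγfin hγt, hγfin, (memPredual_iff h).2 hγt⟩, hγn,
    fun j => hγ.mono fun x hx => hx j, fun F hF hF' => ?_⟩
  have h1 : ∫⁻ x, (∑' i, k i x) * F x = ∫⁻ x, ‖K x‖ₑ * F x :=
    lintegral_congr_ae (by filter_upwards [hKk] with x hx; rw [hx])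
  rw [h1]
  have hKt := hKC.trans_lt ENNReal.coe_lt_top
  exact (lintegral_mul_le_predual_mul_morrey hp h hrρ hF hKt hF').trans_lt
    (ENNReal.mul_lt_top hKt hF')

/-- Removing finitely many indices from the constant family leaves a family whose norm is the
supremum of the remaining contributions. These tend to zero, and `L` is bounded. -/
theorem hasSum_family_single (hq : 1 < q) {L : (Idx n → FunSeq n) →ₗ[ℂ] ℂ} {C : ℝ≥0}
    (hL : ∀ F, familyENorm p q r F < ⊤ → ‖L F‖ₑ ≤ C * familyENorm p q r F) {f : FunSeq n}
    (hf : morreySeqENorm p q r f < ⊤)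
    (hlim : Tendsto (fun i => cubeENorm p q r i f) cofinite (𝓝 0)) :
    HasSum (fun i => L (Pi.single i f)) (L fun _ => f) := by
  classical
  rw [HasSum, tendsto_iff_edist_tendsto_0, ENNReal.tendsto_nhds_zero]
  intro ε hε
  -- For `C = 0` the quotient is `∞`. The later estimate remains valid, which is why finiteness of
  -- the norm of `F` is shown separately.
  have hδ : 0 < ε / C := ENNReal.div_pos hε.ne' ENNReal.coe_ne_top
  have h1 := ENNReal.tendsto_nhds_zero.1 hlim (ε / C) hδ
  rw [eventually_cofinite] at h1
  simp only [SummationFilter.unconditional_filter]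
  filter_upwards [eventually_ge_atTop h1.toFinset] with S hS
  obtain ⟨F, hF⟩ : ∃ F : Idx n → FunSeq n, F = (fun _ => f) - ∑ i ∈ S, Pi.single i f := ⟨_, rfl⟩
  have hFi : ∀ i, F i = if i ∈ S then 0 else f := by
    intro i
    rw [hF, Pi.sub_apply, Finset.sum_apply]
    split_ifs with hi
    · rw [Finset.sum_eq_single_of_mem i hi fun j _ hj => Pi.single_eq_of_ne hj.symm _,
        Pi.single_eq_same, sub_self]
    · rw [Finset.sum_eq_zero fun j hj => Pi.single_eq_of_ne
        (fun h : i = j => hi (h ▸ hj)) _, sub_zero]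
  have hF1 : familyENorm p q r F < ⊤ := by
    refine lt_of_le_of_lt (iSup_le fun i => ?_) hf
    rw [hFi]
    split_ifs
    · rw [cubeENorm_zero hq]; exact zero_le
    · exact cubeENorm_le_morreySeqENorm i f
  have hF2 : familyENorm p q r F ≤ ε / C := by
    refine iSup_le fun i => ?_
    rw [hFi]
    split_ifs with hi
    · rw [cubeENorm_zero hq]; exact zero_le
    · by_contra h
      exact hi (hS (h1.mem_toFinset.2 h))
  have hLF : L (fun _ => f) - ∑ i ∈ S, L (Pi.single i f) = L F := by
    rw [hF, map_sub, map_sum]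
  rw [edist_comm, edist_eq_enorm_sub, hLF]
  exact (hL F hF1).trans ((mul_le_mul_right hF2 _).trans ENNReal.mul_div_le)

theorem IsTestSeq.exists_bounds (hq : 1 < q) {f : FunSeq n} (hf : IsTestSeq f) :
    ∃ B R : ℝ, (∀ᵐ x, lqNorm q f x ≤ ENNReal.ofReal B) ∧
      ∀ᵐ x : Sp n, (∃ k, R < |x k|) → lqNorm q f x = 0 := by
  obtain ⟨h1, N, hN⟩ := hf
  choose φ hφ hφc hφe using h1
  have hb : ∀ j, ∃ M, ∀ x, ‖φ j x‖ ≤ M := fun j =>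
    (hφc j).exists_bound_of_continuous (hφ j).continuous
  choose M hM using hb
  have hR : ∀ j, ∃ R : ℝ, ∀ x, R < ‖x‖ → φ j x = 0 := by
    intro j
    obtain ⟨R, hR⟩ := (hφc j).isCompact.isBounded.exists_norm_le
    refine ⟨R, fun x hx => ?_⟩
    by_contra h
    exact (not_le.2 hx) (hR x (subset_tsupport _ h))
  choose R hR using hR
  refine ⟨∑ j ∈ Finset.range (N + 1), M j, ∑ j ∈ Finset.range (N + 1), |R j|, ?_, ?_⟩
  · filter_upwards [lqNorm_le_sum hq hN, ae_all_iff.2 hφe] with x hx hx'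
    refine hx.trans ?_
    rw [ENNReal.ofReal_sum_of_nonneg fun j _ => (norm_nonneg _).trans (hM j x)]
    refine Finset.sum_le_sum fun j _ => ?_
    rw [hx', ← ofReal_norm]
    exact ENNReal.ofReal_le_ofReal (hM j x)
  · filter_upwards [lqNorm_le_sum hq hN, ae_all_iff.2 hφe] with x hx hx' ⟨k, hk⟩
    refine le_antisymm (hx.trans (le_of_eq (Finset.sum_eq_zero fun j hj => ?_))) zero_le
    have h2 : R j < ‖x‖ := by
      calc R j ≤ |R j| := le_abs_self _
        _ ≤ ∑ j ∈ Finset.range (N + 1), |R j| :=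
          Finset.single_le_sum (f := fun j => |R j|) (fun j _ => abs_nonneg _) hj
        _ < |x k| := hk
        _ ≤ ‖x‖ := PiLp.norm_apply_le x k
    rw [hx', hR j x h2, enorm_zero]

/-- On a test sequence, `G` is the sum over the cubes of the one-cube values of `L`, each an
integral against the densities. Exchanging sum and integral turns this into the pairing with `∑ i, g
i`; density of the test sequences does the rest. -/
theorem exists_representation (hp : p.HolderConjugate p') (hq : q.HolderConjugate q')
    (hr : -(n : ℝ) / p < r) (hr0 : r < 0) (hrρ : r + ρ = -(n : ℝ)) (h : PredualIndex n p' ρ)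
    (G : StrongDual ℂ (MorreySeqCirc n p q r hp.lt hq.lt)) :
    ∃ γ : PredualSeq n p' q' ρ h hq.symm.lt, ‖γ‖ ≤ ‖G‖ ∧ pairingFunctional hp hq h hrρ γ = G := by
  obtain ⟨L, hLG, hL⟩ := exists_family_extension hp.lt hq.lt G
  choose g hg hgi hg0 hgL using exists_family_density hp.lt hq.lt hL
  obtain ⟨γ, hγ, hγg, hγF⟩ := exists_predual_of_densities hp hq.symm.lt h hrρ hg hg0
    (sum_density_le hp hq hL hg hg0 hgL)
  refine ⟨γ, ENNReal.toReal_le_coe_of_le_coe hγ,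
    MorreySeqCirc.ext_isTestSeq hp.lt hq.lt hr hr0 fun f hf => ?_⟩
  have hq0 := hq.symm.pos
  obtain ⟨B, R, hB, hR⟩ := hf.exists_bounds hq.lt
  have hsum := hasSum_family_single hq.lt hL f.1.2.2
    (tendsto_cubeENorm hp.lt hr hr0 hB hR (hf.lebesgueSeqENorm_lt_top hp.lt.le hq.lt))
  rw [hLG] at hsum
  obtain ⟨h1, N, hN⟩ := hf
  choose φ hφ hφc hφe using h1
  have hφb : ∀ j, ∃ M, ∀ x, ‖φ j x‖ ≤ M := fun j =>
    (hφc j).exists_bound_of_continuous (hφ j).continuous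
  have hLi : ∀ i, L (Pi.single i f.1.1) =
      ∑ j ∈ Finset.range (N + 1), ∫ x, g i j x * φ j x := by
    intro i
    rw [sum_single_apply_eq L i fun j hj => hN j hj]
    exact Finset.sum_congr rfl fun j _ => hgL i j _ _ (ae_restrict_of_ae (hφe j))
      (hφ j).continuous.measurable (hφb j)
  have hsumj : ∀ j, HasSum (fun i => ∫ x, g i j x * φ j x) (∫ x, ∑' i, g i j x * φ j x) := by
    intro j
    have hint : ∀ i, Integrable (fun x => g i j x * φ j x) volume := by
      intro i
      obtain ⟨M, hM⟩ := hφb j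
      exact (hgi i j).mul_bdd (c := M) (hφ j).continuous.aestronglyMeasurable
        (Eventually.of_forall hM)
    -- Absolute summability: `‖g i j‖` is at most the `ℓ_{q'}` norm of `g i`, and `‖φ j‖` is almost
    -- everywhere at most the `ℓ_q` norm of `f`, so `hγF` gives a finite integral.
    refine hasSum_integral_of_summable_integral_norm hint ?_
    have h2 : ∑' i, ∫⁻ x, ‖g i j x * φ j x‖ₑ ≠ ⊤ := by
      rw [← lintegral_tsum fun i => (hint i).1.enorm]
      refine (lt_of_le_of_lt (lintegral_mono_ae ?_)
        (hγF (lqNorm q f.1.1) (measurable_lqNorm _ _) f.1.2.2)).ne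
      filter_upwards [hφe j] with x hx
      simp_rw [enorm_mul]
      rw [ENNReal.tsum_mul_right, ← hx]
      refine mul_le_mul' (ENNReal.tsum_le_tsum fun i => ?_) (enorm_le_lqNorm hq.lt _ j x)
      rw [one_div, ENNReal.le_rpow_inv_iff hq0]
      exact ENNReal.le_tsum (f := fun j => ‖g i j x‖ₑ ^ q') j
    refine (ENNReal.summable_toReal h2).congr fun i => ?_
    rw [integral_norm_eq_lintegral_enorm (hint i).1]
  simp_rw [hLi] at hsum
  rw [hsum.unique (hasSum_sum fun j _ => hsumj j), pairingFunctional_apply, pairing]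
  have hgφ : ∀ j, ∫ x, ∑' i, g i j x * φ j x = ∫ x, γ.1 j x * f.1.1 j x := by
    intro j
    refine integral_congr_ae ?_
    filter_upwards [hγg j, hφe j] with x h2 h3
    rw [tsum_mul_right, ← h2, h3]
  simp_rw [hgφ]
  have hint : ∀ j ∈ Finset.range (N + 1), Integrable (fun x => γ.1 j x * f.1.1 j x) volume := by
    intro j _
    -- The entry `γ_j` is a regular tempered distribution, so its product with a test function is
    -- integrable.
    obtain ⟨T, -, hT⟩ := γ.2.1 j
    have h2 := (hT.2 ((hφc j).toSchwartzMap (hφ j))).1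
    refine h2.congr ?_
    filter_upwards [hφe j] with x hx
    rw [hx, mul_comm]
    rfl
  rw [← integral_finsetSum _ hint]
  refine integral_congr_ae ?_
  filter_upwards [AEEqFun.coeFn_zero (α := Sp n) (β := ℂ) (μ := volume)] with x hx
  refine tsum_eq_sum fun j hj => ?_
  rw [hN j (by simpa [Nat.lt_succ_iff] using hj), hx, Pi.zero_apply, mul_zero]

/-! ### Uniqueness of the representing sequence and the isometry. -/

/-- A test sequence with one nonzero entry, in place `j`, isolates the integral of `γ_j` against an
arbitrary real test function; a locally integrable function with all these integrals zero vanishes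
almost everywhere. -/
theorem pairingFunctional_injective (hp : p.HolderConjugate p') (hq : q.HolderConjugate q')
    (hr : -(n : ℝ) / p < r) (hr0 : r < 0) (hrρ : r + ρ = -(n : ℝ)) (h : PredualIndex n p' ρ) :
    Function.Injective (pairingFunctional (r := r) hp hq h hrρ) := by
  refine (injective_iff_map_eq_zero (pairingFunctional (r := r) hp hq h hrρ)).2 fun γ hγ => ?_
  refine Subtype.ext (funext fun j => ?_)
  obtain ⟨T, -, hT⟩ := γ.2.1 j
  apply AEEqFun.ext
  refine EventuallyEq.trans ?_ AEEqFun.coeFn_zero.symm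
  refine ae_eq_zero_of_integral_contDiff_smul_eq_zero hT.1 fun φ hφ hφc => ?_
  have hφ₁ : HasCompactSupport (Complex.ofRealCLM ∘ φ) := hφc.comp_left rfl
  have hφ₂ : ContDiff ℝ ∞ (Complex.ofRealCLM ∘ φ) := by fun_prop
  let u : Sp n →ₘ[volume] ℂ :=
    AEEqFun.mk (Complex.ofRealCLM ∘ φ) hφ₂.continuous.aestronglyMeasurable
  have hu : u =ᵐ[volume] Complex.ofRealCLM ∘ φ := AEEqFun.coeFn_mk _ _
  have htest : IsTestSeq (Pi.single j u : FunSeq n) := by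
    refine ⟨fun k => ?_, j, fun k hk => Pi.single_eq_of_ne hk.ne' _⟩
    rcases eq_or_ne k j with rfl | hk
    · rw [Pi.single_eq_same]; exact ⟨_, hφ₂, hφ₁, hu⟩
    · rw [Pi.single_eq_of_ne hk]; exact IsTestFun.zero
  obtain ⟨h1, h2⟩ := lebesgueSeq_embedding hp.lt hq.lt hr hr0
    (htest.lebesgueSeqENorm_lt_top (one_le_lebesgueExponent hp.lt hr hr0) hq.lt)
  have h3 := DFunLike.congr_fun hγ (⟨⟨_, h1⟩, h2⟩ : MorreySeqCirc n p q r hp.lt hq.lt)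
  rw [pairingFunctional_apply] at h3
  refine Eq.trans (integral_congr_ae ?_) h3
  filter_upwards [hu, AEEqFun.coeFn_zero (α := Sp n) (β := ℂ) (μ := volume)] with x hx h0
  rw [tsum_eq_single j fun k hk => by
    rw [Pi.single_eq_of_ne hk, h0, Pi.zero_apply, mul_zero], Pi.single_eq_same, hx]
  simp [mul_comm]

/-- The pairing as an isometric isomorphism onto the dual space. -/
noncomputable def pairingEquiv (hp : p.HolderConjugate p') (hq : q.HolderConjugate q')
    (hr : -(n : ℝ) / p < r) (hr0 : r < 0) (hrρ : r + ρ = -(n : ℝ)) (h : PredualIndex n p' ρ) :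
    PredualSeq n p' q' ρ h hq.symm.lt ≃ₗᵢ[ℂ] StrongDual ℂ (MorreySeqCirc n p q r hp.lt hq.lt) :=
  LinearIsometryEquiv.ofSurjective
    { pairingFunctional (r := r) hp hq h hrρ with
      norm_map' := fun g => by
        refine le_antisymm (norm_pairingFunctional_le hp hq h hrρ g) ?_
        -- The functional of `g` has a representative of norm at most its own norm; injectivity
        -- shows that this representative is `g`.
        obtain ⟨γ, h1, h2⟩ := exists_representation hp hq hr hr0 hrρ h
          (pairingFunctional hp hq h hrρ g)
        rwa [pairingFunctional_injective hp hq hr hr0 hrρ h h2] at h1 }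
    fun G => (exists_representation hp hq hr hr0 hrρ h G).imp fun _ hγ => hγ.2

theorem pairingEquiv_apply (hp : p.HolderConjugate p') (hq : q.HolderConjugate q')
    (hr : -(n : ℝ) / p < r) (hr0 : r < 0) (hrρ : r + ρ = -(n : ℝ)) (h : PredualIndex n p' ρ)
    (g : PredualSeq n p' q' ρ h hq.symm.lt) (f : MorreySeqCirc n p q r hp.lt hq.lt) :
    pairingEquiv hp hq hr hr0 hrρ h g f = pairing g.1 f.1.1 := rfl

/-- Test sequences belong to `L_{-n/r}(ℓ_q)` and are dense in the closure, so agreement on that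
Lebesgue space forces equality of the functionals. -/
theorem pairingEquiv_eq_of_forall (hp : p.HolderConjugate p') (hq : q.HolderConjugate q')
    (hr : -(n : ℝ) / p < r) (hr0 : r < 0) (hrρ : r + ρ = -(n : ℝ)) (h : PredualIndex n p' ρ)
    {G : StrongDual ℂ (MorreySeqCirc n p q r hp.lt hq.lt)}
    {g : PredualSeq n p' q' ρ h hq.symm.lt}
    (hg : ∀ f : MorreySeqCirc n p q r hp.lt hq.lt,
      lebesgueSeqENorm (-(n : ℝ) / r) q f.1.1 < ⊤ → G f = pairing g.1 f.1.1) :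
    pairingEquiv hp hq hr hr0 hrρ h g = G :=
  MorreySeqCirc.ext_isTestSeq hp.lt hq.lt hr hr0 fun f hf =>
    (hg f (hf.lebesgueSeqENorm_lt_top (one_le_lebesgueExponent hp.lt hr hr0) hq.lt)).symm

theorem isLUB_norm_apply {E : Type*} [NormedAddCommGroup E] [NormedSpace ℂ E]
    (G : StrongDual ℂ E) : IsLUB {t : ℝ | ∃ x : E, ‖x‖ ≤ 1 ∧ t = ‖G x‖} ‖G‖ := by
  refine ⟨?_, fun c hc => ?_⟩
  · rintro t ⟨x, hx, rfl⟩
    exact G.unit_le_opNorm x hx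
  · have hc0 : 0 ≤ c := hc ⟨0, by simp, by simp⟩
    refine G.opNorm_le_of_unit_norm hc0 fun x hx => hc ⟨x, hx.le, rfl⟩

end MorreyDuality

/-! ### The duality theorem. -/

theorem mainTheorem3 (n : ℕ) (p p' q q' r ρ : ℝ)
    (hp : p.HolderConjugate p') (hq : q.HolderConjugate q')
    (hr : -(n : ℝ) / p < r) (hr0 : r < 0) (hrρ : r + ρ = -(n : ℝ)) :
    -- the continuous embedding of `L_{-n/r}(ℓ_q)` into the closure of the test sequences
    (∃ C : ℝ≥0, ∀ f : FunSeq n, lebesgueSeqENorm (-(n : ℝ) / r) q f < ⊤ →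
      (∃ hf : f ∈ MorreySeq n p q r hp.lt hq.lt, ⟨f, hf⟩ ∈ MorreySeqCirc n p q r hp.lt hq.lt) ∧
      morreySeqENorm p q r f ≤ C * lebesgueSeqENorm (-(n : ℝ) / r) q f) ∧
    -- the dual space is `H^ρ L_{p'}(ℓ_{q'})`, isometrically, through the pairing
    ∃ Φ : PredualSeq n p' q' ρ (predualIndex_of_holderConjugate hp hr hr0 hrρ) hq.symm.lt
        ≃ₗᵢ[ℂ] StrongDual ℂ (MorreySeqCirc n p q r hp.lt hq.lt),
      (∀ g f, PairingConverges g.1 f.1.1 ∧ Φ g f = pairing g.1 f.1.1) ∧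
      -- unique representation, tested on `L_{-n/r}(ℓ_q)` only
      (∀ G : StrongDual ℂ (MorreySeqCirc n p q r hp.lt hq.lt),
        ∃! g : PredualSeq n p' q' ρ (predualIndex_of_holderConjugate hp hr hr0 hrρ) hq.symm.lt,
          ∀ f : MorreySeqCirc n p q r hp.lt hq.lt,
            lebesgueSeqENorm (-(n : ℝ) / r) q f.1.1 < ⊤ → G f = pairing g.1 f.1.1) ∧
      (∀ (G : StrongDual ℂ (MorreySeqCirc n p q r hp.lt hq.lt))
        (g : PredualSeq n p' q' ρ (predualIndex_of_holderConjugate hp hr hr0 hrρ) hq.symm.lt),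
        (∀ f : MorreySeqCirc n p q r hp.lt hq.lt,
        lebesgueSeqENorm (-(n : ℝ) / r) q f.1.1 < ⊤ → G f = pairing g.1 f.1.1) →
          Φ g = G ∧ ‖G‖ = ‖g‖) ∧
      -- the norm formula
      (∀ g : PredualSeq n p' q' ρ (predualIndex_of_holderConjugate hp hr hr0 hrρ) hq.symm.lt,
        IsLUB {t : ℝ | ∃ f : MorreySeqCirc n p q r hp.lt hq.lt,
        ‖f‖ ≤ 1 ∧ t = ‖pairing g.1 f.1.1‖} ‖g‖) := by
  have h := predualIndex_of_holderConjugate hp hr hr0 hrρ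
  refine ⟨⟨((2 : ℝ) ^ ((n : ℝ) / p + r)).toNNReal, fun f hf =>
    ⟨lebesgueSeq_embedding hp.lt hq.lt hr hr0 hf,
      morreyENorm_le_eLpNorm hp.lt hr hr0 (measurable_lqNorm q f)⟩⟩,
    pairingEquiv hp hq hr hr0 hrρ h, fun g f => ?_, ?_, ?_, fun g => ?_⟩
  · exact ⟨(pairingConverges hp hq h hrρ g.2.2.1 (PredualSeq.enorm_lt_top g) f.1.2.2).1, rfl⟩
  · intro G
    refine ⟨(pairingEquiv hp hq hr hr0 hrρ h).symm G, fun f _ => ?_, fun g hg => ?_⟩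
    · rw [← pairingEquiv_apply hp hq hr hr0 hrρ h, LinearIsometryEquiv.apply_symm_apply]
    · rw [← pairingEquiv_eq_of_forall hp hq hr hr0 hrρ h hg,
        LinearIsometryEquiv.symm_apply_apply]
  · intro G g hg
    have h1 := pairingEquiv_eq_of_forall hp hq hr hr0 hrρ h hg
    exact ⟨h1, by rw [← h1, LinearIsometryEquiv.norm_map]⟩
  · have h1 := isLUB_norm_apply (pairingEquiv hp hq hr hr0 hrρ h g)
    rw [LinearIsometryEquiv.norm_map] at h1
    exact h1
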